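/- Let $m,n\ge 0$ be integers. Let $(M_1,\varphi,\xi,\eta,g_1)$ be a Sasakian space form of dimension $2m+1$ and constant $\varphi$-sectional curvature $c$; that is, $(\varphi,\xi,\eta,g_1)$ is an almost contact metric structure with $d\eta(X,Y)=g_1(X,\varphi Y)$ (where $d\eta(X,Y)=\frac12\{X\eta(Y)-Y\eta(X)-\eta([X,Y])\}$) and $(\nabla^1_X\varphi)Y=g_1(X,Y)\xi-\eta(Y)X$, and every plane spanned by $X,\varphi X$ with $0\ne X\perp\xi$ has sectional curvature $c$. Let $(M_2,J,g_2)$ be a complex space form of real dimension $2n$, i.e. a Kähler manifold of constant holomorphic sectional curvature. Let $f$ be a positive smooth function on $M_1$, let $\pi,\sigma$ be the projections of $M_1\times M_2$ onto $M_1,M_2$, and let $M_1\times_f M_2$ be the warped product with metric $g_f=\pi^*g_1+f^2\sigma^*g_2$ and Levi-Civita connection $\nabla$. Let $\psi:(M^{2(m+n)},g)\to(M_1\times_f M_2,g_f)$ be an isometric immersion of a hypersurface such that $(\xi,0)$ is tangent to $M$ at every point of $M$. Let $B$, $A$, $\nabla^\perp$ and $H=\frac{1}{2(m+n)}\,\mathrm{trace}\,B$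 be its second fundamental form, shape operator, normal connection and mean curvature vector field ($H=0$ if $m+n=0$), and suppose that $H$ is horizontal, i.e. $\sigma_*H=0$ everywhere. Then $\psi$ is biharmonic, i.e. $$\tau_2(\psi)=\mathrm{trace}\,\nabla^2\tau(\psi)-\mathrm{trace}\,R^f(d\psi(\cdot),\tau(\psi))d\psi(\cdot)=0,\qquad \tau(\psi)=\mathrm{trace}\,\nabla d\psi,$$ where $R^f(X,Y)Z=\nabla_X\nabla_YZ-\nabla_Y\nabla_XZ-\nabla_{[X,Y]}Z$, if and only if the following two equations hold on $M$: $$\Delta^\perp H=\mathrm{trace}\,B(\cdot,A_H\cdot)-\frac{c(m+1)+3m-1}{2}\,H+\frac{2n}{f}(\nabla_H\nabla f)^\perp,$$ $$-2\,\mathrm{trace}\,A_{\nabla^\perp_{(\cdot)}H}(\cdot)-(m+n)\,\mathrm{grad}|H|^2-\frac{4n}{f}(\nabla_H\nabla f)^\top=0.$$ Here $\Delta^\perp H=\mathrm{trace}\,(\nabla^\perp)^2H$, $f$ is regarded as the function $f\circ\pi$ on $M_1\times M_2$ with gradient $\nabla f$ with respect to $g_f$, and $\top,\perp$ denote the parts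 tangent and normal to $M$. -/

import Mathlib

open scoped Manifold ContDiff

noncomputable section

/-! ### Riemannian geometry in a coordinate patch

`E`, `F` are finite-dimensional real vector spaces. A metric on (an open subset of) `E` is given by
its field of bilinear forms `g : E → E →L[ℝ] E →L[ℝ] ℝ`; vectors `u v w : E` also stand for the
constant (coordinate) vector fields. -/

namespace Coord

variable {E : Type*} [NormedAddCommGroup E] [NormedSpace ℝ E] [FiniteDimensional ℝ E]
  {F : Type*} [NormedAddCommGroup F] [NormedSpace ℝ F] [FiniteDimensional ℝ F]

/-- The vector `g^{ij} e_j` of the bilinear form `b = (g_{ij})`, where `(e_j)` is a basis of `E`: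
it is the vector `w` with `b w v = v^i` for all `v`. -/
def dualVec (b : E →L[ℝ] E →L[ℝ] ℝ) (i : Fin (Module.finrank ℝ E)) : E :=
  ContinuousLinearMap.inverse b (LinearMap.toContinuousLinearMap ((Module.finBasis ℝ E).coord i))

/-- Raising the index of a linear form: `g^{ij} α(e_i) e_j`, the vector `α^♯` with
`b α^♯ v = α v` for all `v`. -/
def raise (b : E →L[ℝ] E →L[ℝ] ℝ) (α : E → ℝ) : E :=
  ∑ i, α (Module.finBasis ℝ E i) • dualVec b i

/-- The metric trace `g^{ij} T(e_i, e_j)` of a bilinear map `T`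
(the sum of `T(e_i, e_i)` over an orthonormal basis). -/
def trace (b : E →L[ℝ] E →L[ℝ] ℝ) (T : E → E → F) : F :=
  ∑ i, T (Module.finBasis ℝ E i) (dualVec b i)

/-- The Christoffel symbols `Γ(u, v) = ∇_u v` of the Levi-Civita connection of `g`:
`g(Γ(u, v), w) = (∂_u g(v, w) + ∂_v g(u, w) - ∂_w g(u, v)) / 2`. -/
def christoffel (g : E → E →L[ℝ] E →L[ℝ] ℝ) (y u v : E) : E :=
  raise (g y) fun w =>
    (fderiv ℝ g y u v w + fderiv ℝ g y v u w - fderiv ℝ g y w u v) / 2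

/-- The curvature tensor `R(u, v)w = ∇_u ∇_v w - ∇_v ∇_u w - ∇_{[u, v]} w`. -/
def curvature (g : E → E →L[ℝ] E →L[ℝ] ℝ) (y u v w : E) : E :=
  fderiv ℝ (fun z => christoffel g z v w) y u - fderiv ℝ (fun z => christoffel g z u w) y v
    + christoffel g y u (christoffel g y v w) - christoffel g y v (christoffel g y u w)

/-- The covariant derivative `(∇_u T)v = ∇_u (T v) - T (∇_u v)` of a `(1,1)`-tensor field. -/
def covDerivEndo (g : E → E →L[ℝ] E →L[ℝ] ℝ) (T : E → E →L[ℝ] E) (y u v : E) : E :=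
  fderiv ℝ T y u v + christoffel g y u (T y v) - T y (christoffel g y u v)

/-- The gradient of a function. -/
def grad (g : E → E →L[ℝ] E →L[ℝ] ℝ) (a : E → ℝ) (y : E) : E :=
  raise (g y) fun w => fderiv ℝ a y w

/-- `∇_u grad a`. -/
def covDerivGrad (g : E → E →L[ℝ] E →L[ℝ] ℝ) (a : E → ℝ) (y u : E) : E :=
  fderiv ℝ (grad g a) y u + christoffel g y u (grad g a y)

/-- The covariant derivative `∇_u V` of a vector field `V` along a map `ψ : E → F`
(the pull-back to `ψ⁻¹TF` of the Levi-Civita connection of the metric `h` on `F`). -/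
def covDerivAlong (h : F → F →L[ℝ] F →L[ℝ] ℝ) (ψ V : E → F) (x u : E) : F :=
  fderiv ℝ V x u + christoffel h (ψ x) (fderiv ℝ ψ x u) (V x)

/-- The second fundamental form `B(u, v) = (∇dψ)(u, v) = ∇_u (dψ v) - dψ(∇_u v)`
of a map `ψ` from `(E, g)` to `(F, h)`. -/
def sff (g : E → E →L[ℝ] E →L[ℝ] ℝ) (h : F → F →L[ℝ] F →L[ℝ] ℝ) (ψ : E → F) (x u v : E) : F :=
  covDerivAlong h ψ (fun z => fderiv ℝ ψ z v) x u - fderiv ℝ ψ x (christoffel g x u v)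

/-- The tension field `τ(ψ) = trace ∇dψ`. -/
def tension (g : E → E →L[ℝ] E →L[ℝ] ℝ) (h : F → F →L[ℝ] F →L[ℝ] ℝ) (ψ : E → F) (x : E) : F :=
  trace (g x) (sff g h ψ x)

/-- The Laplacian `Δ V = - trace ∇²V`, `∇²V(u, v) = ∇_u ∇_v V - ∇_{∇_u v} V`, of vector fields
along `ψ`. -/
def laplacianAlong (g : E → E →L[ℝ] E →L[ℝ] ℝ) (h : F → F →L[ℝ] F →L[ℝ] ℝ) (ψ V : E → F)
    (x : E) : F :=
  -trace (g x) fun u v =>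
    covDerivAlong h ψ (fun z => covDerivAlong h ψ V z v) x u
      - covDerivAlong h ψ V x (christoffel g x u v)

/-- The bitension field `τ₂(ψ) = -Δ τ(ψ) - trace R(dψ ·, τ(ψ)) dψ ·`. -/
def bitension (g : E → E →L[ℝ] E →L[ℝ] ℝ) (h : F → F →L[ℝ] F →L[ℝ] ℝ) (ψ : E → F) (x : E) : F :=
  -laplacianAlong g h ψ (tension g h ψ) x
    - trace (g x) fun u v =>
        curvature h (ψ x) (fderiv ℝ ψ x u) (tension g h ψ x) (fderiv ℝ ψ x v)

/-! The remaining definitions are about an isometric immersion `ψ` of `(E, g)` in `(F, h)`. -/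

/-- The tangential part `V^⊤` (as a vector of `E`) of a vector `V` at `ψ x`:
`g(V^⊤, w) = h(V, dψ w)`. -/
def tanPart (g : E → E →L[ℝ] E →L[ℝ] ℝ) (h : F → F →L[ℝ] F →L[ℝ] ℝ) (ψ : E → F) (x : E)
    (V : F) : E :=
  raise (g x) fun w => h (ψ x) V (fderiv ℝ ψ x w)

/-- The normal part `V^⊥ = V - dψ(V^⊤)`. -/
def norPart (g : E → E →L[ℝ] E →L[ℝ] ℝ) (h : F → F →L[ℝ] F →L[ℝ] ℝ) (ψ : E → F) (x : E)
    (V : F) : F :=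
  V - fderiv ℝ ψ x (tanPart g h ψ x V)

/-- The shape operator: `g(A_ν u, w) = h(B(u, w), ν)`. -/
def shape (g : E → E →L[ℝ] E →L[ℝ] ℝ) (h : F → F →L[ℝ] F →L[ℝ] ℝ) (ψ : E → F) (x : E)
    (ν : F) (u : E) : E :=
  raise (g x) fun w => h (ψ x) (sff g h ψ x u w) ν

/-- The mean curvature vector field `H = (1 / dim E) trace B`. -/
def meanCurv (g : E → E →L[ℝ] E →L[ℝ] ℝ) (h : F → F →L[ℝ] F →L[ℝ] ℝ) (ψ : E → F) (x : E) : F :=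
  (1 / (Module.finrank ℝ E : ℝ)) • trace (g x) (sff g h ψ x)

/-- The normal connection `∇^⊥_u V = (∇_u V)^⊥`. -/
def normalDeriv (g : E → E →L[ℝ] E →L[ℝ] ℝ) (h : F → F →L[ℝ] F →L[ℝ] ℝ) (ψ V : E → F)
    (x u : E) : F :=
  norPart g h ψ x (covDerivAlong h ψ V x u)

/-- The normal Laplacian
`Δ^⊥ V = trace (∇^⊥)²V`, `(∇^⊥)²V(u, v) = ∇^⊥_u ∇^⊥_v V - ∇^⊥_{∇_u v} V`. -/
def normalLaplacian (g : E → E →L[ℝ] E →L[ℝ] ℝ) (h : F → F →L[ℝ] F →L[ℝ] ℝ) (ψ V : E → F)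
    (x : E) : F :=
  trace (g x) fun u v =>
    normalDeriv g h ψ (fun z => normalDeriv g h ψ V z v) x u
      - normalDeriv g h ψ V x (christoffel g x u v)

/-- `trace B(·, A_ν ·)`. -/
def traceSffShape (g : E → E →L[ℝ] E →L[ℝ] ℝ) (h : F → F →L[ℝ] F →L[ℝ] ℝ) (ψ : E → F) (x : E)
    (ν : F) : F :=
  trace (g x) fun u v => sff g h ψ x u (shape g h ψ x ν v)

/-- `trace A_{∇^⊥_· V} ·`. -/
def traceShapeNormalDeriv (g : E → E →L[ℝ] E →L[ℝ] ℝ) (h : F → F →L[ℝ] F →L[ℝ] ℝ)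
    (ψ V : E → F) (x : E) : E :=
  trace (g x) fun u v => shape g h ψ x (normalDeriv g h ψ V x u) v

/-- `grad |V|²` for a vector field `V` along `ψ`. -/
def gradNormSq (g : E → E →L[ℝ] E →L[ℝ] ℝ) (h : F → F →L[ℝ] F →L[ℝ] ℝ) (ψ V : E → F)
    (x : E) : E :=
  grad g (fun z => h (ψ z) (V z) (V z)) x

end Coord

/-! ### Manifolds

Tensor fields on a manifold `M` (without boundary) are read in the preferred chart at a point `p`,
which is also the chart through which the tangent space at `p` is identified with the model vector
space. All the quantities below are tensorial, hence independent of the chart. -/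

namespace RiemGeom

variable {E : Type*} [NormedAddCommGroup E] [NormedSpace ℝ E]
  {H : Type*} [TopologicalSpace H] {I : ModelWithCorners ℝ E H}
  {M : Type*} [TopologicalSpace M] [ChartedSpace H M]
  {E' : Type*} [NormedAddCommGroup E'] [NormedSpace ℝ E']
  {H' : Type*} [TopologicalSpace H'] {I' : ModelWithCorners ℝ E' H'}
  {N : Type*} [TopologicalSpace N] [ChartedSpace H' N]

/-- Fields of bilinear forms on the tangent spaces. -/
abbrev BilinField (I : ModelWithCorners ℝ E H) (M : Type*) [TopologicalSpace M]
    [ChartedSpace H M] : Type _ :=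
  ∀ x : M, TangentSpace I x →L[ℝ] TangentSpace I x →L[ℝ] ℝ

/-- Fields of endomorphisms of the tangent spaces. -/
abbrev EndoField (I : ModelWithCorners ℝ E H) (M : Type*) [TopologicalSpace M]
    [ChartedSpace H M] : Type _ :=
  ∀ x : M, TangentSpace I x →L[ℝ] TangentSpace I x

/-- The differential at `y` of the inverse of the chart at `p`. -/
def chartInvDeriv (I : ModelWithCorners ℝ E H) {M : Type*} [TopologicalSpace M] [ChartedSpace H M]
    (p : M) (y : E) : E →L[ℝ] TangentSpace I ((extChartAt I p).symm y) :=
  mfderiv 𝓘(ℝ, E) I (extChartAt I p).symm y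

/-- The differential, at the point with coordinates `y`, of the chart at `p`. -/
def chartDeriv (I : ModelWithCorners ℝ E H) {M : Type*} [TopologicalSpace M] [ChartedSpace H M]
    (p : M) (y : E) : TangentSpace I ((extChartAt I p).symm y) →L[ℝ] E :=
  mfderiv I 𝓘(ℝ, E) (extChartAt I p) ((extChartAt I p).symm y)

/-- A bilinear form field, in the chart at `p`. -/
def inChartBilin (b : BilinField I M) (p : M) (y : E) : E →L[ℝ] E →L[ℝ] ℝ :=
  (ContinuousLinearMap.precomp ℝ (chartInvDeriv I p y)).comp
    ((b ((extChartAt I p).symm y)).comp (chartInvDeriv I p y))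

/-- An endomorphism field, in the chart at `p`. -/
def inChartEndo (T : EndoField I M) (p : M) (y : E) : E →L[ℝ] E :=
  (chartDeriv I p y).comp ((T ((extChartAt I p).symm y)).comp (chartInvDeriv I p y))

/-- A vector field, in the chart at `p`. -/
def inChartVec (X : ∀ x : M, TangentSpace I x) (p : M) (y : E) : E :=
  chartDeriv I p y (X ((extChartAt I p).symm y))

/-- A `1`-form, in the chart at `p`. -/
def inChartForm (α : ∀ x : M, TangentSpace I x →L[ℝ] ℝ) (p : M) (y : E) : E →L[ℝ] ℝ :=
  (α ((extChartAt I p).symm y)).comp (chartInvDeriv I p y)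

variable [FiniteDimensional ℝ E] [FiniteDimensional ℝ E']

/-- The curvature tensor `R(u, v)w = ∇_u ∇_v w - ∇_v ∇_u w - ∇_{[u, v]} w` of `g` at `p`. -/
def curvature (g : BilinField I M) (p : M) (u v w : TangentSpace I p) : TangentSpace I p :=
  Coord.curvature (E := E) (inChartBilin g p) (extChartAt I p p) u v w

/-- The sectional curvature of the plane spanned by `u` and `v`. -/
def sectionalCurvature (g : BilinField I M) (p : M) (u v : TangentSpace I p) : ℝ :=
  g p (curvature g p u v v) u / (g p u u * g p v v - g p u v ^ 2)

/-- `∇_X grad a` at `p`. -/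
def covDerivGrad (g : BilinField I M) (a : M → ℝ) (p : M) (X : TangentSpace I p) :
    TangentSpace I p :=
  Coord.covDerivGrad (E := E) (inChartBilin g p) (a ∘ (extChartAt I p).symm) (extChartAt I p p) X

/-! Maps `ψ` from `(M, g)` to `(N, h)`, read in the charts at `p` and at `ψ p`. -/

/-- The bitension field `τ₂(ψ) = -Δ τ(ψ) - trace R(dψ ·, τ(ψ)) dψ ·`. -/
def bitensionField (g : BilinField I M) (h : BilinField I' N) (ψ : M → N) (p : M) :
    TangentSpace I' (ψ p) :=
  Coord.bitension (E := E) (F := E') (inChartBilin g p) (inChartBilin h (ψ p)) (writtenInExtChartAt I I' p ψ)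
    (extChartAt I p p)

/-- `ψ` is biharmonic: `τ₂(ψ) = 0`. -/
def IsBiharmonic (g : BilinField I M) (h : BilinField I' N) (ψ : M → N) : Prop :=
  ∀ p, bitensionField g h ψ p = 0

/-- `ψ` is isometric: `g = ψ^* h` (for a Riemannian metric `g`, it is then an immersion). -/
def IsIsometric (g : BilinField I M) (h : BilinField I' N) (ψ : M → N) : Prop :=
  ∀ (p : M) (u v : TangentSpace I p),
    g p u v = h (ψ p) (mfderiv I I' ψ p u) (mfderiv I I' ψ p v)

/-- The mean curvature vector `H`. -/
def meanCurvature (g : BilinField I M) (h : BilinField I' N) (ψ : M → N) (p : M) :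
    TangentSpace I' (ψ p) :=
  Coord.meanCurv (E := E) (F := E') (inChartBilin g p) (inChartBilin h (ψ p)) (writtenInExtChartAt I I' p ψ)
    (extChartAt I p p)

/-- The tangential part of a vector at `ψ p`, as a tangent vector of `M`. -/
def tangentialPart (g : BilinField I M) (h : BilinField I' N) (ψ : M → N) (p : M)
    (V : TangentSpace I' (ψ p)) : TangentSpace I p :=
  Coord.tanPart (E := E) (F := E') (inChartBilin g p) (inChartBilin h (ψ p)) (writtenInExtChartAt I I' p ψ)
    (extChartAt I p p) V

/-- The normal part of a vector at `ψ p`. -/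
def normalPart (g : BilinField I M) (h : BilinField I' N) (ψ : M → N) (p : M)
    (V : TangentSpace I' (ψ p)) : TangentSpace I' (ψ p) :=
  Coord.norPart (E := E) (F := E') (inChartBilin g p) (inChartBilin h (ψ p)) (writtenInExtChartAt I I' p ψ)
    (extChartAt I p p) V

/-- `Δ^⊥ H`. -/
def normalLaplacianH (g : BilinField I M) (h : BilinField I' N) (ψ : M → N) (p : M) :
    TangentSpace I' (ψ p) :=
  Coord.normalLaplacian (E := E) (F := E') (inChartBilin g p) (inChartBilin h (ψ p)) (writtenInExtChartAt I I' p ψ)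
    (Coord.meanCurv (E := E) (F := E') (inChartBilin g p) (inChartBilin h (ψ p)) (writtenInExtChartAt I I' p ψ))
    (extChartAt I p p)

/-- `trace B(·, A_H ·)`. -/
def traceSffShapeH (g : BilinField I M) (h : BilinField I' N) (ψ : M → N) (p : M) :
    TangentSpace I' (ψ p) :=
  Coord.traceSffShape (E := E) (F := E') (inChartBilin g p) (inChartBilin h (ψ p)) (writtenInExtChartAt I I' p ψ)
    (extChartAt I p p) (meanCurvature g h ψ p)

/-- `trace A_{∇^⊥_· H} ·`. -/
def traceShapeNormalDerivH (g : BilinField I M) (h : BilinField I' N) (ψ : M → N) (p : M) :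
    TangentSpace I p :=
  Coord.traceShapeNormalDeriv (E := E) (F := E') (inChartBilin g p) (inChartBilin h (ψ p))
    (writtenInExtChartAt I I' p ψ)
    (Coord.meanCurv (E := E) (F := E') (inChartBilin g p) (inChartBilin h (ψ p)) (writtenInExtChartAt I I' p ψ))
    (extChartAt I p p)

/-- `grad |H|²`. -/
def gradNormSqH (g : BilinField I M) (h : BilinField I' N) (ψ : M → N) (p : M) :
    TangentSpace I p :=
  Coord.gradNormSq (E := E) (F := E') (inChartBilin g p) (inChartBilin h (ψ p)) (writtenInExtChartAt I I' p ψ)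
    (Coord.meanCurv (E := E) (F := E') (inChartBilin g p) (inChartBilin h (ψ p)) (writtenInExtChartAt I I' p ψ))
    (extChartAt I p p)

/-! ### Metrics and structures -/

/-- Smooth Riemannian metrics on a `d`-dimensional manifold. -/
abbrev RiemannianMetric (d : ℕ) (M : Type*) [TopologicalSpace M]
    [ChartedSpace (EuclideanSpace ℝ (Fin d)) M] [IsManifold (𝓡 d) ∞ M] : Type _ :=
  Bundle.ContMDiffRiemannianMetric (𝓡 d) ∞ (EuclideanSpace ℝ (Fin d))
    (fun x : M => TangentSpace (𝓡 d) x)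

/-- Smooth vector fields. -/
abbrev SmoothVectorField (d : ℕ) (M : Type*) [TopologicalSpace M]
    [ChartedSpace (EuclideanSpace ℝ (Fin d)) M] [IsManifold (𝓡 d) ∞ M] : Type _ :=
  ContMDiffSection (𝓡 d) (EuclideanSpace ℝ (Fin d)) ∞ (fun x : M => TangentSpace (𝓡 d) x)

/-- Smooth `(1,1)`-tensor fields. -/
abbrev SmoothEndoField (d : ℕ) (M : Type*) [TopologicalSpace M]
    [ChartedSpace (EuclideanSpace ℝ (Fin d)) M] [IsManifold (𝓡 d) ∞ M] : Type _ :=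
  ContMDiffSection (𝓡 d) (EuclideanSpace ℝ (Fin d) →L[ℝ] EuclideanSpace ℝ (Fin d)) ∞
    (fun x : M => TangentSpace (𝓡 d) x →L[ℝ] TangentSpace (𝓡 d) x)

/-- The warped product metric `π^* g₁ + f² σ^* g₂` on `M₁ × M₂`. -/
def warpedMetric {d₁ d₂ : ℕ}
    {M₁ : Type*} [TopologicalSpace M₁] [ChartedSpace (EuclideanSpace ℝ (Fin d₁)) M₁]
    {M₂ : Type*} [TopologicalSpace M₂] [ChartedSpace (EuclideanSpace ℝ (Fin d₂)) M₂]
    (g₁ : BilinField (𝓡 d₁) M₁) (g₂ : BilinField (𝓡 d₂) M₂) (f : M₁ → ℝ) :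
    BilinField ((𝓡 d₁).prod (𝓡 d₂)) (M₁ × M₂) := fun x =>
  (ContinuousLinearMap.precomp ℝ (mfderiv ((𝓡 d₁).prod (𝓡 d₂)) (𝓡 d₁) Prod.fst x)).comp
      ((g₁ x.1).comp (mfderiv ((𝓡 d₁).prod (𝓡 d₂)) (𝓡 d₁) Prod.fst x))
    + f x.1 ^ 2 •
      (ContinuousLinearMap.precomp ℝ (mfderiv ((𝓡 d₁).prod (𝓡 d₂)) (𝓡 d₂) Prod.snd x)).comp
        ((g₂ x.2).comp (mfderiv ((𝓡 d₁).prod (𝓡 d₂)) (𝓡 d₂) Prod.snd x))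

section Structures

variable {d : ℕ} {M : Type*} [TopologicalSpace M]
  [ChartedSpace (EuclideanSpace ℝ (Fin d)) M] [IsManifold (𝓡 d) ∞ M]

/-- `(φ, ξ, η, g)` is an almost contact metric structure. -/
structure IsAlmostContactMetric (g : RiemannianMetric d M) (φ : SmoothEndoField d M)
    (ξ : SmoothVectorField d M) (η : ∀ x : M, TangentSpace (𝓡 d) x →L[ℝ] ℝ) : Prop where
  phi_sq : ∀ (x : M) (X : TangentSpace (𝓡 d) x), φ x (φ x X) = -X + η x X • ξ x
  eta_xi : ∀ x : M, η x (ξ x) = 1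
  eta_phi : ∀ (x : M) (X : TangentSpace (𝓡 d) x), η x (φ x X) = 0
  eta_eq : ∀ (x : M) (X : TangentSpace (𝓡 d) x), η x X = g.inner x (ξ x) X
  compatible : ∀ (x : M) (X Y : TangentSpace (𝓡 d) x),
    g.inner x (φ x X) (φ x Y) = g.inner x X Y - η x X * η x Y

/-- `(φ, ξ, η, g)` is a Sasakian structure: a contact metric structure, `dη(X, Y) = g(X, φY)` with
`dη(X, Y) = (X η(Y) - Y η(X) - η([X, Y])) / 2`, such that `(∇_X φ)Y = g(X, Y)ξ - η(Y)X`. These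
identities are read at all the points of the domain of each preferred chart. -/
structure IsSasakian (g : RiemannianMetric d M) (φ : SmoothEndoField d M)
    (ξ : SmoothVectorField d M) (η : ∀ x : M, TangentSpace (𝓡 d) x →L[ℝ] ℝ) : Prop
    extends IsAlmostContactMetric g φ ξ η where
  contact : ∀ p : M, ∀ y ∈ (extChartAt (𝓡 d) p).target, ∀ X Y : EuclideanSpace ℝ (Fin d),
    (fderiv ℝ (inChartForm η p) y X Y - fderiv ℝ (inChartForm η p) y Y X) / 2
      = inChartBilin g.inner p y X (inChartEndo (fun x => φ x) p y Y)
  nabla_phi : ∀ p : M, ∀ y ∈ (extChartAt (𝓡 d) p).target, ∀ X Y : EuclideanSpace ℝ (Fin d),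
    Coord.covDerivEndo (inChartBilin g.inner p) (inChartEndo (fun x => φ x) p) y X Y
      = inChartBilin g.inner p y X Y • inChartVec (fun x => ξ x) p y
        - inChartForm η p y Y • X

/-- Sasakian space forms: Sasakian manifolds of constant `φ`-sectional curvature `c`. -/
structure IsSasakianSpaceForm (g : RiemannianMetric d M) (φ : SmoothEndoField d M)
    (ξ : SmoothVectorField d M) (η : ∀ x : M, TangentSpace (𝓡 d) x →L[ℝ] ℝ) (c : ℝ) : Prop
    extends IsSasakian g φ ξ η where
  phi_sectional : ∀ (x : M) (X : TangentSpace (𝓡 d) x), X ≠ 0 → η x X = 0 →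
    sectionalCurvature g.inner x X (φ x X) = c

/-- `(J, g)` is a Kähler structure: `J² = -1`, `g(JX, JY) = g(X, Y)` and `∇J = 0`. -/
structure IsKahler (g : RiemannianMetric d M) (J : SmoothEndoField d M) : Prop where
  J_sq : ∀ (x : M) (X : TangentSpace (𝓡 d) x), J x (J x X) = -X
  compatible : ∀ (x : M) (X Y : TangentSpace (𝓡 d) x),
    g.inner x (J x X) (J x Y) = g.inner x X Y
  nabla_J : ∀ p : M, ∀ y ∈ (extChartAt (𝓡 d) p).target, ∀ X Y : EuclideanSpace ℝ (Fin d),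
    Coord.covDerivEndo (inChartBilin g.inner p) (inChartEndo (fun x => J x) p) y X Y = 0

/-- Complex space forms: Kähler manifolds of constant holomorphic sectional curvature `k`. -/
structure IsComplexSpaceForm (g : RiemannianMetric d M) (J : SmoothEndoField d M) (k : ℝ) : Prop
    extends IsKahler g J where
  holomorphic_sectional : ∀ (x : M) (X : TangentSpace (𝓡 d) x), X ≠ 0 →
    sectionalCurvature g.inner x X (J x X) = k

end Structures

end RiemGeom

end

/-!
Write `τ(ψ) = dim M · H`. Splitting `Δτ(ψ)` into its parts normal and tangent to `M` with the
formulas of Gauss, Weingarten and Codazzi, the equation `τ₂(ψ) = 0` for any isometric immersion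
becomes the pair

`Δ^⊥ H = trace B(·, A_H ·) + (trace R(dψ ·, H) dψ ·)^⊥`,
`-2 trace A_{∇^⊥ H} - (dim M / 2) grad |H|² - 2 (trace R(dψ ·, H) dψ ·)^⊤ = 0`.

For a hypersurface, `R(H, H) = 0` extends the trace to the whole tangent space of the ambient
manifold, so that it is `-Ric(H)`. For a horizontal `X`, the Ricci operator of the warped product is
`Ric₁(X) - (dim M₂ / f) ∇_X grad f`. Finally `ξ` is tangent to `M`, hence `H ⊥ ξ`, and on `ξ^⊥` the
Ricci operator of a Sasakian space form is multiplication by `2m + (c - 1)(m + 1) / 2`: after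
subtracting the model tensor, its curvature is a Kähler-type tensor on `ξ^⊥` with vanishing
holomorphic sectional curvature, and these are zero.
-/

noncomputable section

namespace Coord

/-! ### Traces with respect to an inner product -/

section LinearAlgebra

variable {E : Type*} [NormedAddCommGroup E] [NormedSpace ℝ E]
  {F : Type*} [NormedAddCommGroup F] [NormedSpace ℝ F]
  {G : Type*} [NormedAddCommGroup G]

/-- Inner products: symmetric positive definite bilinear forms, the values of a Riemannian
metric. -/
structure IsInner (b : E →L[ℝ] E →L[ℝ] ℝ) : Prop where
  symm : ∀ u v, b u v = b v u
  pos : ∀ u, u ≠ 0 → 0 < b u u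

theorem IsInner.ext {b : E →L[ℝ] E →L[ℝ] ℝ} (hb : IsInner b) {u w : E}
    (h : ∀ v, b u v = b w v) : u = w := by
  by_contra hne
  have := hb.pos (u - w) (sub_ne_zero.2 hne)
  simp [h] at this

variable [FiniteDimensional ℝ E]

theorem dualVec_eq_inverse (b : E →L[ℝ] E →L[ℝ] ℝ) (i : Fin (Module.finrank ℝ E)) :
    dualVec b i = b.inverse ((Module.finBasis ℝ E).coord i).toContinuousLinearMap := rfl

theorem raise_eq_inverse (b : E →L[ℝ] E →L[ℝ] ℝ) (α : E →L[ℝ] ℝ) :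
    raise b (fun w => α w) = b.inverse α := by
  have hα : α = ∑ i, α (Module.finBasis ℝ E i) •
      ((Module.finBasis ℝ E).coord i).toContinuousLinearMap := by
    ext v
    conv_lhs => rw [← (Module.finBasis ℝ E).sum_repr v]
    simp only [map_sum, map_smul, sum_apply, smul_apply, smul_eq_mul,
      LinearMap.coe_toContinuousLinearMap', Module.Basis.coord_apply, mul_comm]
  conv_rhs => rw [hα]
  simp only [raise, dualVec_eq_inverse, map_sum, map_smul]

theorem raise_add (b : E →L[ℝ] E →L[ℝ] ℝ) (α β : E → ℝ) :
    raise b (fun w => α w + β w) = raise b α + raise b β := by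
  simp [raise, add_smul, Finset.sum_add_distrib]

theorem raise_smul (b : E →L[ℝ] E →L[ℝ] ℝ) (r : ℝ) (α : E → ℝ) :
    raise b (fun w => r * α w) = r • raise b α := by
  simp [raise, mul_smul, Finset.smul_sum]

theorem trace_add (b : E →L[ℝ] E →L[ℝ] ℝ) (S T : E → E → G) :
    trace b (fun u v => S u v + T u v) = trace b S + trace b T :=
  Finset.sum_add_distrib

theorem trace_sub (b : E →L[ℝ] E →L[ℝ] ℝ) (S T : E → E → G) :
    trace b (fun u v => S u v - T u v) = trace b S - trace b T :=
  Finset.sum_sub_distrib ..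

theorem trace_of_finrank_eq_zero (hE : Module.finrank ℝ E = 0) (b : E →L[ℝ] E →L[ℝ] ℝ)
    (T : E → E → G) : trace b T = 0 :=
  have : IsEmpty (Fin (Module.finrank ℝ E)) := by rw [hE]; infer_instance
  Fintype.sum_empty _

variable [NormedSpace ℝ G]

theorem trace_smul (b : E →L[ℝ] E →L[ℝ] ℝ) (r : ℝ) (T : E → E → G) :
    trace b (fun u v => r • T u v) = r • trace b T :=
  Finset.smul_sum.symm

theorem map_trace (L : G →L[ℝ] F) (b : E →L[ℝ] E →L[ℝ] ℝ) (T : E → E → G) :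
    L (trace b T) = trace b fun u v => L (T u v) :=
  map_sum L _ _

namespace IsInner

variable {b : E →L[ℝ] E →L[ℝ] ℝ} (hb : IsInner b)

include hb

theorem isInvertible : b.IsInvertible := by
  have hinj : Function.Injective (b : E →ₗ[ℝ] (E →L[ℝ] ℝ)) := fun u w h =>
    hb.ext fun v => DFunLike.congr_fun (F := E →L[ℝ] ℝ) h v
  have hfin : Module.finrank ℝ E = Module.finrank ℝ (E →L[ℝ] ℝ) :=
    (Subspace.dual_finrank_eq (K := ℝ) (V := E)).symm.trans
      (LinearMap.toContinuousLinearMap (𝕜 := ℝ) (E := E) (F' := ℝ)).finrank_eq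
  exact ⟨(LinearEquiv.ofInjectiveOfFinrankEq _ hinj hfin).toContinuousLinearEquiv, by ext; rfl⟩

theorem apply_raise (α : E →L[ℝ] ℝ) (v : E) : b (raise b fun w => α w) v = α v := by
  rw [raise_eq_inverse, hb.isInvertible.self_apply_inverse]

theorem apply_dualVec (i : Fin (Module.finrank ℝ E)) (v : E) :
    b (dualVec b i) v = (Module.finBasis ℝ E).coord i v := by
  rw [dualVec_eq_inverse, hb.isInvertible.self_apply_inverse, LinearMap.coe_toContinuousLinearMap']

theorem sum_apply_smul_dualVec (w : E) :
    ∑ i, b w (Module.finBasis ℝ E i) • dualVec b i = w := by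
  refine hb.ext fun v => ?_
  conv_rhs => rw [← (Module.finBasis ℝ E).sum_repr v]
  simp only [map_sum, map_smul, sum_apply, smul_apply, smul_eq_mul, hb.apply_dualVec,
    Module.Basis.coord_apply, mul_comm]

theorem sum_apply_dualVec_smul (w : E) :
    ∑ i, b w (dualVec b i) • Module.finBasis ℝ E i = w := by
  simp only [hb.symm w, hb.apply_dualVec, Module.Basis.coord_apply,
    (Module.finBasis ℝ E).sum_repr w]

/-- The hypothesis on `a` and `c` says that `(c i)` spans `E` with coefficients `b · (a i)`; it is
met by a pair of dual bases and by an orthonormal basis paired with itself. -/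
theorem trace_eq_sum {ι : Type*} [Fintype ι] {a c : ι → E}
    (hac : ∀ v, ∑ i, b v (a i) • c i = v) {T : E → E → G} (hT : IsBilinearMap ℝ T) :
    trace b T = ∑ i, T (a i) (c i) := by
  have hT' : ∀ u v, T u v = hT.toLinearMap u v := fun _ _ => rfl
  simp only [trace, hT']
  set T' := hT.toLinearMap
  calc ∑ i, T' (Module.finBasis ℝ E i) (dualVec b i)
      = ∑ j, ∑ i, b (dualVec b j) (a i) • T' (Module.finBasis ℝ E j) (c i) := by
        refine Finset.sum_congr rfl fun j _ => ?_
        conv_lhs => rw [← hac (dualVec b j)]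
        simp only [map_sum, map_smul]
    _ = ∑ i, ∑ j, b (dualVec b j) (a i) • T' (Module.finBasis ℝ E j) (c i) :=
        Finset.sum_comm
    _ = ∑ i, T' (a i) (c i) := by
        refine Finset.sum_congr rfl fun i _ => ?_
        conv_rhs => rw [← hb.sum_apply_dualVec_smul (a i)]
        simp only [map_sum, map_smul, LinearMap.sum_apply, LinearMap.smul_apply,
          hb.symm (dualVec b _)]

theorem trace_comm {T : E → E → G} (hT : IsBilinearMap ℝ T) :
    trace b T = trace b fun u v => T v u :=
  hb.trace_eq_sum hb.sum_apply_dualVec_smul hT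

theorem trace_self : trace b (fun u v => b u v) = Module.finrank ℝ E := by
  simp [trace, hb.symm _ (dualVec b _), hb.apply_dualVec]

theorem trace_apply_smul {L : E → G} (hL : IsLinearMap ℝ L) (w : E) :
    trace b (fun u v => b w u • L v) = L w := by
  conv_rhs => rw [← hb.sum_apply_smul_dualVec w]
  exact ((map_sum hL.mk' _ _).trans (Finset.sum_congr rfl fun i _ => hL.map_smul _ _)).symm

theorem trace_mul (w z : E) : trace b (fun u v => b w u * b z v) = b z w :=
  hb.trace_apply_smul (L := b z) ⟨map_add _, map_smul _⟩ w

theorem exists_adjoint (L : E →L[ℝ] E) : ∃ L' : E →L[ℝ] E, ∀ u v, b (L' u) v = b u (L v) :=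
  ⟨b.inverse ∘L ContinuousLinearMap.precomp ℝ L ∘L b, fun u v => DFunLike.congr_fun
    (hb.isInvertible.self_apply_inverse (ContinuousLinearMap.precomp ℝ L (b u))) v⟩

theorem trace_adjoint {T : E → E → G} (hT : IsBilinearMap ℝ T) {L L' : E →L[ℝ] E}
    (hL : ∀ u v, b (L' u) v = b u (L v)) :
    trace b (fun u v => T u (L' v)) = trace b fun u v => T (L u) v := by
  have hT' : ∀ u v, T u v = hT.toLinearMap u v := fun _ _ => rfl
  simp only [trace, hT']
  set T' := hT.toLinearMap
  set e := Module.finBasis ℝ E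
  calc ∑ i, T' (e i) (L' (dualVec b i))
      = ∑ i, ∑ j, b (dualVec b i) (L (e j)) • T' (e i) (dualVec b j) := by
        refine Finset.sum_congr rfl fun i _ => ?_
        conv_lhs => rw [← hb.sum_apply_smul_dualVec (L' (dualVec b i))]
        simp only [map_sum, map_smul, hL, e]
    _ = ∑ j, ∑ i, b (dualVec b i) (L (e j)) • T' (e i) (dualVec b j) := Finset.sum_comm
    _ = ∑ j, T' (L (e j)) (dualVec b j) := by
        refine Finset.sum_congr rfl fun j _ => ?_
        conv_rhs => rw [← hb.sum_apply_dualVec_smul (L (e j))]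
        simp only [map_sum, map_smul, LinearMap.sum_apply, LinearMap.smul_apply,
          hb.symm (dualVec b _), e]

end IsInner

end LinearAlgebra

section Calculus

variable {E : Type*} [NormedAddCommGroup E] [NormedSpace ℝ E]
  {F : Type*} [NormedAddCommGroup F] [NormedSpace ℝ F]
  {G : Type*} [NormedAddCommGroup G] [NormedSpace ℝ G]
  {G' : Type*} [NormedAddCommGroup G'] [NormedSpace ℝ G']
  {G'' : Type*} [NormedAddCommGroup G''] [NormedSpace ℝ G'']

theorem differentiableAt_of_smooth {f : E → G} {x : E} (hf : ContDiffAt ℝ ∞ f x) :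
    DifferentiableAt ℝ f x := hf.differentiableAt (by simp)

theorem contDiffAt_fderiv {f : E → G} {x : E} (hf : ContDiffAt ℝ ∞ f x) :
    ContDiffAt ℝ ∞ (fderiv ℝ f) x := hf.fderiv_right (by simp)

theorem contDiffAt_fderiv_apply {f : E → G} {x : E} (hf : ContDiffAt ℝ ∞ f x) (v : E) :
    ContDiffAt ℝ ∞ (fun z => fderiv ℝ f z v) x :=
  (contDiffAt_fderiv hf).clm_apply contDiffAt_const

theorem contDiffAt_apply₂ {L : F → E →L[ℝ] G →L[ℝ] G'} {x : F} (hL : ContDiffAt ℝ ∞ L x) (u : E)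
    (v : G) : ContDiffAt ℝ ∞ (fun z => L z u v) x :=
  (hL.clm_apply contDiffAt_const).clm_apply contDiffAt_const

theorem contDiffAt_clm_of_apply [FiniteDimensional ℝ E] {L : F → E →L[ℝ] G} {x : F}
    (h : ∀ v, ContDiffAt ℝ ∞ (fun z => L z v) x) : ContDiffAt ℝ ∞ L x := by
  let e₁ : E ≃L[ℝ] (Fin (Module.finrank ℝ E) → ℝ) :=
    ContinuousLinearEquiv.ofFinrankEq (Module.finrank_fin_fun ℝ).symm
  let e₂ := (e₁.arrowCongr (1 : G ≃L[ℝ] G)).trans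
    (ContinuousLinearEquiv.piRing (Fin (Module.finrank ℝ E)))
  rw [← Function.id_comp L, ← e₂.symm_comp_self]
  exact e₂.symm.contDiff.contDiffAt.comp x (contDiffAt_pi.mpr fun i => h _)

theorem contDiffAt_clm₂_of_apply [FiniteDimensional ℝ E] [FiniteDimensional ℝ G]
    {L : F → E →L[ℝ] G →L[ℝ] G'} {x : F} (h : ∀ u v, ContDiffAt ℝ ∞ (fun z => L z u v) x) :
    ContDiffAt ℝ ∞ L x :=
  contDiffAt_clm_of_apply fun u => contDiffAt_clm_of_apply fun v => h u v

theorem fderiv_fderiv_comm {f : E → G} {x : E} (hf : ContDiffAt ℝ ∞ f x) (u v : E) :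
    fderiv ℝ (fderiv ℝ f) x u v = fderiv ℝ (fderiv ℝ f) x v u :=
  hf.isSymmSndFDerivAt (by simpa using ENat.LEInfty.out) u v

theorem fderiv_apply_field {L : E → G →L[ℝ] G'} {a : E → G} {x : E}
    (hL : DifferentiableAt ℝ L x) (ha : DifferentiableAt ℝ a x) (u : E) :
    fderiv ℝ (fun z => L z (a z)) x u = fderiv ℝ L x u (a x) + L x (fderiv ℝ a x u) := by
  simp [fderiv_clm_apply hL ha, add_comm]

theorem fderiv_apply_field₂ {L : E → G →L[ℝ] G' →L[ℝ] G''} {a : E → G} {c : E → G'} {x : E}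
    (hL : DifferentiableAt ℝ L x) (ha : DifferentiableAt ℝ a x) (hc : DifferentiableAt ℝ c x)
    (u : E) :
    fderiv ℝ (fun z => L z (a z) (c z)) x u =
      fderiv ℝ L x u (a x) (c x) + L x (fderiv ℝ a x u) (c x) + L x (a x) (fderiv ℝ c x u) := by
  rw [fderiv_apply_field (hL.clm_apply ha) hc, fderiv_apply_field hL ha, add_apply]

theorem fderiv_apply_const {L : E → G →L[ℝ] G'} {x : E} (hL : DifferentiableAt ℝ L x) (u : E)
    (v : G) : fderiv ℝ (fun z => L z v) x u = fderiv ℝ L x u v := by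
  simp [fderiv_apply_field hL (differentiableAt_const v)]

theorem fderiv_apply_const₂ {L : E → G →L[ℝ] G' →L[ℝ] G''} {x : E} (hL : DifferentiableAt ℝ L x)
    (u : E) (v : G) (w : G') : fderiv ℝ (fun z => L z v w) x u = fderiv ℝ L x u v w := by
  simp [fderiv_apply_field₂ hL (differentiableAt_const v) (differentiableAt_const w)]

theorem fderiv_comp_apply {f : F → G} {ψ : E → F} {x : E} (hf : DifferentiableAt ℝ f (ψ x))
    (hψ : DifferentiableAt ℝ ψ x) (u : E) :
    fderiv ℝ (fun z => f (ψ z)) x u = fderiv ℝ f (ψ x) (fderiv ℝ ψ x u) :=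
  DFunLike.congr_fun (fderiv_comp x hf hψ) u

variable [FiniteDimensional ℝ E]

theorem contDiffAt_inverse {g : F → E →L[ℝ] E →L[ℝ] ℝ} {x : F} (hg : ContDiffAt ℝ ∞ g x)
    (hx : IsInner (g x)) : ContDiffAt ℝ ∞ (fun z => (g z).inverse) x :=
  have : CompleteSpace E := FiniteDimensional.complete ℝ E
  hx.isInvertible.contDiffAt_map_inverse.comp x hg

theorem contDiffAt_dualVec {g : F → E →L[ℝ] E →L[ℝ] ℝ} {x : F} (hg : ContDiffAt ℝ ∞ g x)
    (hx : IsInner (g x)) (i : Fin (Module.finrank ℝ E)) :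
    ContDiffAt ℝ ∞ (fun z => dualVec (g z) i) x :=
  (contDiffAt_inverse hg hx).clm_apply contDiffAt_const

theorem contDiffAt_raise {g : F → E →L[ℝ] E →L[ℝ] ℝ} {x : F} (hg : ContDiffAt ℝ ∞ g x)
    (hx : IsInner (g x)) {α : F → E → ℝ} (hα : ∀ w, ContDiffAt ℝ ∞ (fun z => α z w) x) :
    ContDiffAt ℝ ∞ (fun z => raise (g z) (α z)) x :=
  ContDiffAt.sum fun i _ => (hα _).smul (contDiffAt_dualVec hg hx i)

theorem contDiffAt_trace {g : F → E →L[ℝ] E →L[ℝ] ℝ} {x : F} (hg : ContDiffAt ℝ ∞ g x)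
    (hx : IsInner (g x)) {T : F → E →L[ℝ] E →L[ℝ] G} (hT : ContDiffAt ℝ ∞ T x) :
    ContDiffAt ℝ ∞ (fun z => trace (g z) fun u v => T z u v) x :=
  ContDiffAt.sum fun i _ => (hT.clm_apply contDiffAt_const).clm_apply (contDiffAt_dualVec hg hx i)

end Calculus

/-! ### The Levi-Civita connection and its pull-back along a map -/

section LeviCivita

variable {E : Type*} [NormedAddCommGroup E] [NormedSpace ℝ E]

/-- `g` is a smooth Riemannian metric on the open set `U`. -/
structure IsMetricOn (g : E → E →L[ℝ] E →L[ℝ] ℝ) (U : Set E) : Prop where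
  isOpen : IsOpen U
  smooth : ∀ x ∈ U, ContDiffAt ℝ ∞ g x
  inner : ∀ x ∈ U, IsInner (g x)

namespace IsMetricOn

variable {g : E → E →L[ℝ] E →L[ℝ] ℝ} {U : Set E} (hg : IsMetricOn g U) {x : E} (hx : x ∈ U)

include hg hx

theorem eventually_mem : ∀ᶠ z in nhds x, z ∈ U := hg.isOpen.mem_nhds hx

theorem fderiv_symm (u v w : E) : fderiv ℝ g x u v w = fderiv ℝ g x u w v := by
  have hd := differentiableAt_of_smooth (hg.smooth _ hx)
  rw [← fderiv_apply_const₂ hd, ← fderiv_apply_const₂ hd]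
  congr 1
  refine Filter.EventuallyEq.fderiv_eq ?_
  filter_upwards [hg.eventually_mem hx] with z hz
  exact (hg.inner z hz).symm v w

end IsMetricOn

variable [FiniteDimensional ℝ E]

theorem isBilinearMap_christoffel (g : E → E →L[ℝ] E →L[ℝ] ℝ) (y : E) :
    IsBilinearMap ℝ (christoffel g y) := by
  constructor
  case add_left | add_right =>
    intros
    rw [christoffel, christoffel, christoffel, ← raise_add]
    congr 1; ext w
    simp only [map_add, add_apply]; ring
  case smul_left | smul_right =>
    intros
    rw [christoffel, christoffel, ← raise_smul]
    congr 1; ext w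
    simp only [map_smul, smul_apply, smul_eq_mul]; ring

/-- The Christoffel symbols as a field of continuous bilinear maps. -/
def christoffelL (g : E → E →L[ℝ] E →L[ℝ] ℝ) (y : E) : E →L[ℝ] E →L[ℝ] E :=
  (isBilinearMap_christoffel g y).toContinuousBilinearMap

theorem christoffel_eq (g : E → E →L[ℝ] E →L[ℝ] ℝ) (y u v : E) :
    christoffel g y u v = christoffelL g y u v := rfl

/-- The curvature tensor as a field of continuous trilinear maps: it sends `(u, v, w)` to
`(∂_u Γ)(v, w) - (∂_v Γ)(u, w) + Γ(u, Γ(v, w)) - Γ(v, Γ(u, w))`. -/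
def curvatureL (g : E → E →L[ℝ] E →L[ℝ] ℝ) (y : E) : E →L[ℝ] E →L[ℝ] E →L[ℝ] E :=
  let A := (ContinuousLinearMap.compL ℝ E E E).bilinearComp (christoffelL g y) (christoffelL g y)
  fderiv ℝ (christoffelL g) y - (fderiv ℝ (christoffelL g) y).flip + A - A.flip

theorem curvatureL_apply (g : E → E →L[ℝ] E →L[ℝ] ℝ) (y u v w : E) :
    curvatureL g y u v w = fderiv ℝ (christoffelL g) y u v w - fderiv ℝ (christoffelL g) y v u w
      + christoffelL g y u (christoffelL g y v w) - christoffelL g y v (christoffelL g y u w) :=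
  rfl

namespace IsMetricOn

variable {g : E → E →L[ℝ] E →L[ℝ] ℝ} {U : Set E} (hg : IsMetricOn g U) {x : E} (hx : x ∈ U)

include hg hx

theorem apply_christoffelL (u v w : E) :
    g x (christoffelL g x u v) w =
      (fderiv ℝ g x u v w + fderiv ℝ g x v u w - fderiv ℝ g x w u v) / 2 := by
  have hα := (hg.inner x hx).apply_raise ((2⁻¹ : ℝ) • (fderiv ℝ g x u v + fderiv ℝ g x v u
    - ((fderiv ℝ g x).flip u).flip v)) w
  rw [← christoffel_eq, christoffel]
  simpa only [smul_apply, add_apply, sub_apply, ContinuousLinearMap.flip_apply, smul_eq_mul,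
    inv_mul_eq_div] using hα

theorem christoffelL_symm (u v : E) : christoffelL g x u v = christoffelL g x v u := by
  refine (hg.inner x hx).ext fun w => ?_
  rw [hg.apply_christoffelL hx, hg.apply_christoffelL hx, hg.fderiv_symm hx w u v]
  ring

theorem fderiv_eq_christoffelL (u v w : E) :
    fderiv ℝ g x u v w = g x (christoffelL g x u v) w + g x v (christoffelL g x u w) := by
  rw [(hg.inner x hx).symm v, hg.apply_christoffelL hx, hg.apply_christoffelL hx,
    hg.fderiv_symm hx u w v, hg.fderiv_symm hx v u w, hg.fderiv_symm hx w u v]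
  ring

theorem contDiffAt_christoffelL : ContDiffAt ℝ ∞ (christoffelL g) x := by
  refine contDiffAt_clm₂_of_apply fun u v => ?_
  have h : ∀ u v w, ContDiffAt ℝ ∞ (fun z => fderiv ℝ g z u v w) x := fun u v w =>
    contDiffAt_apply₂ (contDiffAt_fderiv_apply (hg.smooth x hx) u) v w
  exact contDiffAt_raise (hg.smooth x hx) (hg.inner x hx) (α := fun z w =>
      (fderiv ℝ g z u v w + fderiv ℝ g z v u w - fderiv ℝ g z w u v) / 2)
    fun w => (((h u v w).add (h v u w)).sub (h w u v)).div_const 2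

theorem curvature_eq (u v w : E) : curvature g x u v w = curvatureL g x u v w := by
  have hΓ := differentiableAt_of_smooth (hg.contDiffAt_christoffelL hx)
  have h := fun u v w => fderiv_apply_const₂ hΓ u v w
  simp only [curvature, christoffel_eq, h, curvatureL_apply]

theorem fderiv_christoffelL_symm (u v w : E) :
    fderiv ℝ (christoffelL g) x u v w = fderiv ℝ (christoffelL g) x u w v := by
  have hΓ := differentiableAt_of_smooth (hg.contDiffAt_christoffelL hx)
  rw [← fderiv_apply_const₂ hΓ, ← fderiv_apply_const₂ hΓ]
  congr 1
  refine Filter.EventuallyEq.fderiv_eq ?_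
  filter_upwards [hg.eventually_mem hx] with z hz
  exact hg.christoffelL_symm hz v w

theorem bianchi (u v w : E) :
    curvatureL g x u v w + curvatureL g x v w u + curvatureL g x w u v = 0 := by
  rw [curvatureL_apply, curvatureL_apply, curvatureL_apply,
    hg.fderiv_christoffelL_symm hx u w v, hg.fderiv_christoffelL_symm hx v u w,
    hg.fderiv_christoffelL_symm hx w v u, hg.christoffelL_symm hx w v,
    hg.christoffelL_symm hx w u, hg.christoffelL_symm hx v u]
  abel

end IsMetricOn

theorem curvatureL_swap (g : E → E →L[ℝ] E →L[ℝ] ℝ) (x u v w : E) :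
    curvatureL g x u v w = -curvatureL g x v u w := by
  rw [curvatureL_apply, curvatureL_apply]
  abel

theorem curvatureL_self (g : E → E →L[ℝ] E →L[ℝ] ℝ) (x u w : E) : curvatureL g x u u w = 0 := by
  rw [curvatureL_apply]
  abel

end LeviCivita

section Along

variable {E : Type*} [NormedAddCommGroup E] [NormedSpace ℝ E]
  {F : Type*} [NormedAddCommGroup F] [NormedSpace ℝ F] [FiniteDimensional ℝ F]

section

variable (h : F → F →L[ℝ] F →L[ℝ] ℝ) (ψ V : E → F) (x : E)

/-- The covariant derivative `u ↦ ∇_u V` along `ψ` as a continuous linear map. -/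
def covDerivAlongL (h : F → F →L[ℝ] F →L[ℝ] ℝ) (ψ V : E → F) (x : E) : E →L[ℝ] F :=
  fderiv ℝ V x + (christoffelL h (ψ x)).flip (V x) ∘L fderiv ℝ ψ x

theorem covDerivAlong_eq (u : E) : covDerivAlong h ψ V x u = covDerivAlongL h ψ V x u := rfl

theorem covDerivAlongL_apply (u : E) : covDerivAlongL h ψ V x u =
    fderiv ℝ V x u + christoffelL h (ψ x) (fderiv ℝ ψ x u) (V x) := rfl

end

variable {h : F → F →L[ℝ] F →L[ℝ] ℝ} {ψ : E → F} {x : E}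

theorem covDerivAlong_add {V W : E → F} (hV : DifferentiableAt ℝ V x)
    (hW : DifferentiableAt ℝ W x) (u : E) :
    covDerivAlong h ψ (fun z => V z + W z) x u
      = covDerivAlong h ψ V x u + covDerivAlong h ψ W x u := by
  simp only [covDerivAlong_eq, covDerivAlongL_apply, fderiv_fun_add hV hW, map_add, add_apply]
  abel

theorem covDerivAlong_const_smul (V : E → F) (r : ℝ) (u : E) :
    covDerivAlong h ψ (fun z => r • V z) x u = r • covDerivAlong h ψ V x u := by
  simp only [covDerivAlong_eq, covDerivAlongL_apply, map_smul, smul_add]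
  rw [show fderiv ℝ (fun z => r • V z) x = r • fderiv ℝ V x from
    congrFun (fderiv_const_smul_field r) x, smul_apply]

theorem covDerivAlong_sub {V W : E → F} (hV : DifferentiableAt ℝ V x)
    (hW : DifferentiableAt ℝ W x) (u : E) :
    covDerivAlong h ψ (fun z => V z - W z) x u
      = covDerivAlong h ψ V x u - covDerivAlong h ψ W x u := by
  simp only [covDerivAlong_eq, covDerivAlongL_apply, fderiv_fun_sub hV hW, map_sub, sub_apply]
  abel

theorem covDerivAlong_smul {V : E → F} {a : E → ℝ} (ha : DifferentiableAt ℝ a x)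
    (hV : DifferentiableAt ℝ V x) (u : E) :
    covDerivAlong h ψ (fun z => a z • V z) x u
      = fderiv ℝ a x u • V x + a x • covDerivAlong h ψ V x u := by
  simp only [covDerivAlong_eq, covDerivAlongL_apply, fderiv_fun_smul ha hV, map_smul, smul_apply,
    add_apply, smul_add, ContinuousLinearMap.smulRight_apply]
  abel

theorem covDerivAlong_congr {V W : E → F} (hVW : V =ᶠ[nhds x] W) (u : E) :
    covDerivAlong h ψ V x u = covDerivAlong h ψ W x u := by
  simp only [covDerivAlong_eq, covDerivAlongL_apply, hVW.fderiv_eq, hVW.eq_of_nhds]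

variable {U : Set F} (hh : IsMetricOn h U)

include hh

theorem contDiffAt_covDerivAlong (hψ : ContDiffAt ℝ ∞ ψ x) (hx : ψ x ∈ U) {V : E → F}
    (hV : ContDiffAt ℝ ∞ V x) (u : E) : ContDiffAt ℝ ∞ (fun z => covDerivAlong h ψ V z u) x :=
  (contDiffAt_fderiv_apply hV u).add
    ((((hh.contDiffAt_christoffelL hx).comp x hψ).clm_apply
      (contDiffAt_fderiv_apply hψ u)).clm_apply hV)

theorem fderiv_metric_along (hψ : DifferentiableAt ℝ ψ x) (hx : ψ x ∈ U) {V W : E → F}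
    (hV : DifferentiableAt ℝ V x) (hW : DifferentiableAt ℝ W x) (u : E) :
    fderiv ℝ (fun z => h (ψ z) (V z) (W z)) x u
      = h (ψ x) (covDerivAlong h ψ V x u) (W x) + h (ψ x) (V x) (covDerivAlong h ψ W x u) := by
  have hd := differentiableAt_of_smooth (hh.smooth _ hx)
  have hdψ : DifferentiableAt ℝ (fun z => h (ψ z)) x := hd.comp x hψ
  rw [fderiv_apply_field₂ hdψ hV hW, fderiv_comp_apply hd hψ,
    hh.fderiv_eq_christoffelL hx]
  simp only [covDerivAlong_eq, covDerivAlongL_apply, map_add, add_apply]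
  ring

variable (hψ : ContDiffAt ℝ ∞ ψ x) (hx : ψ x ∈ U)

include hψ hx

theorem fderiv_fderiv_metric_along {V W : E → F} (hV : ContDiffAt ℝ ∞ V x)
    (hW : ContDiffAt ℝ ∞ W x) (u v : E) :
    fderiv ℝ (fun y => fderiv ℝ (fun z => h (ψ z) (V z) (W z)) y v) x u
      = h (ψ x) (covDerivAlong h ψ (fun y => covDerivAlong h ψ V y v) x u) (W x)
        + h (ψ x) (covDerivAlong h ψ V x v) (covDerivAlong h ψ W x u)
        + (h (ψ x) (covDerivAlong h ψ V x u) (covDerivAlong h ψ W x v)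
          + h (ψ x) (V x) (covDerivAlong h ψ (fun y => covDerivAlong h ψ W y v) x u)) := by
  have near : ∀ {Y : E → F}, ContDiffAt ℝ ∞ Y x → ∀ᶠ y in nhds x, DifferentiableAt ℝ Y y :=
    fun hY => ((hY.of_le (m := 1) (by simp)).eventually (by simp)).mono
      fun _ hy => hy.differentiableAt one_ne_zero
  have first : (fun y => fderiv ℝ (fun z => h (ψ z) (V z) (W z)) y v) =ᶠ[nhds x] fun y =>
      h (ψ y) (covDerivAlong h ψ V y v) (W y) + h (ψ y) (V y) (covDerivAlong h ψ W y v) := by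
    filter_upwards [near hψ, near hV, near hW,
      hψ.continuousAt.eventually (hh.eventually_mem hx)] with y hψ' hV' hW' hy
    exact fderiv_metric_along hh hψ' hy hV' hW' v
  have hψ' := differentiableAt_of_smooth hψ
  have hV' := differentiableAt_of_smooth hV
  have hW' := differentiableAt_of_smooth hW
  have hDV := differentiableAt_of_smooth (contDiffAt_covDerivAlong hh hψ hx hV v)
  have hDW := differentiableAt_of_smooth (contDiffAt_covDerivAlong hh hψ hx hW v)
  have hd := differentiableAt_of_smooth (hh.smooth _ hx)
  have hdψ : DifferentiableAt ℝ (fun z => h (ψ z)) x := hd.comp x hψ'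
  rw [first.fderiv_eq, fderiv_fun_add ((hdψ.clm_apply hDV).clm_apply hW')
    ((hdψ.clm_apply hV').clm_apply hDW), add_apply, fderiv_metric_along hh hψ' hx hDV hW',
    fderiv_metric_along hh hψ' hx hV' hDW]

theorem covDerivAlong_covDerivAlong {V : E → F} (hV : ContDiffAt ℝ ∞ V x) (u v : E) :
    covDerivAlong h ψ (fun z => covDerivAlong h ψ V z v) x u
      = fderiv ℝ (fderiv ℝ V) x u v
        + (fderiv ℝ (christoffelL h) (ψ x) (fderiv ℝ ψ x u) (fderiv ℝ ψ x v) (V x)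
          + christoffelL h (ψ x) (fderiv ℝ (fderiv ℝ ψ) x u v) (V x)
          + christoffelL h (ψ x) (fderiv ℝ ψ x v) (fderiv ℝ V x u))
        + (christoffelL h (ψ x) (fderiv ℝ ψ x u) (fderiv ℝ V x v)
          + christoffelL h (ψ x) (fderiv ℝ ψ x u)
              (christoffelL h (ψ x) (fderiv ℝ ψ x v) (V x))) := by
  have hψ' := differentiableAt_of_smooth hψ
  have hΓ := differentiableAt_of_smooth (hh.contDiffAt_christoffelL hx)
  have hΓψ : DifferentiableAt ℝ (fun z => christoffelL h (ψ z)) x := hΓ.comp x hψ'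
  have hV' := differentiableAt_of_smooth hV
  have hdV := differentiableAt_of_smooth (contDiffAt_fderiv_apply hV v)
  have hdψ := differentiableAt_of_smooth (contDiffAt_fderiv_apply hψ v)
  rw [covDerivAlong_eq, covDerivAlongL_apply]
  simp only [covDerivAlong_eq, covDerivAlongL_apply]
  rw [fderiv_fun_add hdV ((hΓψ.clm_apply hdψ).clm_apply hV'), add_apply,
    fderiv_apply_field₂ hΓψ hdψ hV', fderiv_comp_apply hΓ hψ',
    fderiv_apply_const (differentiableAt_of_smooth (contDiffAt_fderiv hV)),
    fderiv_apply_const (differentiableAt_of_smooth (contDiffAt_fderiv hψ)), map_add]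

theorem covDerivAlong_comm {V : E → F} (hV : ContDiffAt ℝ ∞ V x) (u v : E) :
    covDerivAlong h ψ (fun z => covDerivAlong h ψ V z v) x u
      - covDerivAlong h ψ (fun z => covDerivAlong h ψ V z u) x v
      = curvatureL h (ψ x) (fderiv ℝ ψ x u) (fderiv ℝ ψ x v) (V x) := by
  rw [covDerivAlong_covDerivAlong hh hψ hx hV, covDerivAlong_covDerivAlong hh hψ hx hV,
    curvatureL_apply, fderiv_fderiv_comm hV u v, fderiv_fderiv_comm hψ u v]
  abel

end Along

section CurvatureForm

variable {V : Type*} [AddCommGroup V] [Module ℝ V]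

/-- Algebraic curvature tensors: the symmetries of `(u, v, w, z) ↦ g(R(u, v)w, z)`. Linearity is
required in the first slot only; it passes to the other slots by symmetry. -/
structure IsCurvatureForm (K : V → V → V → V → ℝ) : Prop where
  linear : ∀ v w z, IsLinearMap ℝ fun u => K u v w z
  skew_left : ∀ u v w z, K u v w z = -K v u w z
  skew_right : ∀ u v w z, K u v w z = -K u v z w
  bianchi : ∀ u v w z, K u v w z + K v w u z + K w u v z = 0

theorem IsCurvatureForm.pair {K : V → V → V → V → ℝ} (hK : IsCurvatureForm K) (u v w z : V) :
    K u v w z = K w z u v := by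
  linarith [hK.bianchi u v w z, hK.bianchi v w z u, hK.bianchi w z u v, hK.bianchi z u v w,
    hK.skew_right u v z w, hK.skew_right v w z u, hK.skew_right w z v u, hK.skew_right u w z v,
    hK.skew_left u w v z, hK.skew_left z v w u, hK.skew_right v z w u, hK.skew_right z u v w]

end CurvatureForm

namespace IsMetricOn

variable {E : Type*} [NormedAddCommGroup E] [NormedSpace ℝ E] [FiniteDimensional ℝ E]
  {g : E → E →L[ℝ] E →L[ℝ] ℝ} {U : Set E} (hg : IsMetricOn g U) {x : E} (hx : x ∈ U)

include hg hx

/-- The second derivatives of `g(w, z)`, computed with the connection, commute. -/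
theorem curvatureL_skew (u v w z : E) :
    g x (curvatureL g x u v w) z = -g x (curvatureL g x u v z) w := by
  have hid : ContDiffAt ℝ ∞ (id : E → E) x := contDiffAt_id
  have hc : ∀ w : E, ContDiffAt ℝ ∞ (fun _ : E => w) x := fun w => contDiffAt_const
  have second := fderiv_fderiv_metric_along hg hid hx (hc w) (hc z)
  have hgwz : ContDiffAt ℝ ∞ (fun y => g (id y) w z) x := contDiffAt_apply₂ (hg.smooth x hx) w z
  have hfd := differentiableAt_of_smooth (contDiffAt_fderiv hgwz)
  have comm := fderiv_fderiv_comm hgwz u v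
  rw [← fderiv_apply_const hfd, ← fderiv_apply_const hfd, second, second] at comm
  have hw := covDerivAlong_comm hg hid hx (hc w) u v
  have hz := covDerivAlong_comm hg hid hx (hc z) u v
  simp only [fderiv_id, ContinuousLinearMap.id_apply, id] at hw hz comm
  rw [← hw, ← hz, (hg.inner x hx).symm _ w]
  simp only [map_sub, sub_apply]
  linarith

theorem isCurvatureForm : IsCurvatureForm fun u v w z => g x (curvatureL g x u v w) z where
  linear v w z := by constructor <;> intros <;> simp
  skew_left u v w z := by rw [curvatureL_swap, map_neg, neg_apply]
  skew_right := hg.curvatureL_skew hx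
  bianchi u v w z := by
    rw [← add_apply, ← map_add, ← add_apply, ← map_add, hg.bianchi hx, map_zero, zero_apply]

end IsMetricOn

section TraceDerivative

variable {E : Type*} [NormedAddCommGroup E] [NormedSpace ℝ E] [FiniteDimensional ℝ E]
  {F : Type*} [NormedAddCommGroup F] [NormedSpace ℝ F] [FiniteDimensional ℝ F]
  {g : E → E →L[ℝ] E →L[ℝ] ℝ} {U : Set E} (hg : IsMetricOn g U) {x : E} (hx : x ∈ U)

/-- The covariant derivative `(∇_w T)(u, v) = ∇_w (T(u, v)) - T(∇_w u, v) - T(u, ∇_w v)` of a field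
of bilinear maps with values in `ψ⁻¹TF`. -/
def covDerivBilin (g : E → E →L[ℝ] E →L[ℝ] ℝ) (h : F → F →L[ℝ] F →L[ℝ] ℝ) (ψ : E → F)
    (T : E → E →L[ℝ] E →L[ℝ] F) (x w u v : E) : F :=
  covDerivAlong h ψ (fun z => T z u v) x w - T x (christoffelL g x w u) v
    - T x u (christoffelL g x w v)

include hg hx

theorem IsMetricOn.fderiv_dualVec {w : E} {L : E →L[ℝ] E}
    (hL : ∀ u v, g x (L u) v = g x u (christoffelL g x w v)) (i : Fin (Module.finrank ℝ E)) :
    fderiv ℝ (fun z => dualVec (g z) i) x w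
      = -(christoffelL g x w (dualVec (g x) i) + L (dualVec (g x) i)) := by
  have hI := hg.inner x hx
  refine hI.ext fun v => ?_
  have const : (fun z => g z (dualVec (g z) i) v) =ᶠ[nhds x]
      fun _ => (Module.finBasis ℝ E).coord i v := by
    filter_upwards [hg.eventually_mem hx] with z hz
    exact (hg.inner z hz).apply_dualVec i v
  have hderiv := congrArg (fun L : E →L[ℝ] ℝ => L w) const.fderiv_eq
  rw [fderiv_apply_field₂ (differentiableAt_of_smooth (hg.smooth x hx))
    (differentiableAt_of_smooth (contDiffAt_dualVec (hg.smooth x hx) hI i))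
    (differentiableAt_const v), hg.fderiv_eq_christoffelL hx] at hderiv
  simp only [fderiv_fun_const, Pi.zero_apply, zero_apply, map_zero, add_zero] at hderiv
  rw [map_neg, neg_apply, map_add, add_apply, hL]
  linarith

theorem IsMetricOn.covDerivAlong_trace (h : F → F →L[ℝ] F →L[ℝ] ℝ) (ψ : E → F)
    {T : E → E →L[ℝ] E →L[ℝ] F} (hT : ContDiffAt ℝ ∞ T x) (w : E) :
    covDerivAlong h ψ (fun z => trace (g z) fun u v => T z u v) x w
      = trace (g x) (covDerivBilin g h ψ T x w) := by
  have hI := hg.inner x hx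
  obtain ⟨L, hL⟩ := hI.exists_adjoint (christoffelL g x w)
  have hT' := differentiableAt_of_smooth hT
  have hTe : ∀ u, DifferentiableAt ℝ (fun z => T z u) x := fun u =>
    hT'.clm_apply (differentiableAt_const u)
  have hdual : ∀ i, DifferentiableAt ℝ (fun z => dualVec (g z) i) x := fun i =>
    differentiableAt_of_smooth (contDiffAt_dualVec (hg.smooth x hx) hI i)
  have hΓ : christoffelL h (ψ x) (fderiv ℝ ψ x w) (trace (g x) fun u v => T x u v)
      = trace (g x) fun u v => christoffelL h (ψ x) (fderiv ℝ ψ x w) (T x u v) :=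
    map_trace (christoffelL h (ψ x) (fderiv ℝ ψ x w)) _ _
  have hadj := hI.trace_adjoint (T := fun u v => T x u v)
    (by constructor <;> intros <;> simp) hL
  have hderiv : fderiv ℝ (fun z => trace (g z) fun u v => T z u v) x w
      = trace (g x) fun u v => fderiv ℝ T x w u v - T x u (christoffelL g x w v) - T x u (L v) := by
    unfold trace
    rw [fderiv_fun_sum fun i _ => (hTe _).clm_apply (hdual i), sum_apply]
    refine Finset.sum_congr rfl fun i _ => ?_
    rw [fderiv_apply_field (hTe _) (hdual i), hg.fderiv_dualVec hx hL, fderiv_apply_const hT']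
    simp only [map_neg, map_add]
    abel
  rw [covDerivAlong_eq, covDerivAlongL_apply, hderiv, hΓ, trace_sub, trace_sub, hadj]
  unfold covDerivBilin
  simp only [covDerivAlong_eq, covDerivAlongL_apply, fderiv_apply_const₂ hT', trace_sub, trace_add]
  abel

end TraceDerivative

/-! ### The equations of Gauss, Weingarten and Codazzi -/

section SecondFundamentalForm

variable {E : Type*} [NormedAddCommGroup E] [NormedSpace ℝ E] [FiniteDimensional ℝ E]
  {F : Type*} [NormedAddCommGroup F] [NormedSpace ℝ F] [FiniteDimensional ℝ F]

/-- The second fundamental form as a field of continuous bilinear maps. -/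
def sffL (g : E → E →L[ℝ] E →L[ℝ] ℝ) (h : F → F →L[ℝ] F →L[ℝ] ℝ) (ψ : E → F) (x : E) :
    E →L[ℝ] E →L[ℝ] F :=
  fderiv ℝ (fderiv ℝ ψ) x + (christoffelL h (ψ x)).bilinearComp (fderiv ℝ ψ x) (fderiv ℝ ψ x)
    - ContinuousLinearMap.compL ℝ E E F (fderiv ℝ ψ x) ∘L christoffelL g x

/-- The tangential part as a continuous linear map. -/
def tanPartL (g : E → E →L[ℝ] E →L[ℝ] ℝ) (h : F → F →L[ℝ] F →L[ℝ] ℝ) (ψ : E → F) (x : E) :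
    F →L[ℝ] E :=
  (g x).inverse ∘L ContinuousLinearMap.precomp ℝ (fderiv ℝ ψ x) ∘L h (ψ x)

/-- The normal part as a continuous linear map. -/
def norPartL (g : E → E →L[ℝ] E →L[ℝ] ℝ) (h : F → F →L[ℝ] F →L[ℝ] ℝ) (ψ : E → F) (x : E) :
    F →L[ℝ] F :=
  ContinuousLinearMap.id ℝ F - fderiv ℝ ψ x ∘L tanPartL g h ψ x

/-- The shape operator `(ν, u) ↦ A_ν u` as a field of continuous bilinear maps. -/
def shapeL (g : E → E →L[ℝ] E →L[ℝ] ℝ) (h : F → F →L[ℝ] F →L[ℝ] ℝ) (ψ : E → F) (x : E) :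
    F →L[ℝ] E →L[ℝ] E :=
  ContinuousLinearMap.compL ℝ E (E →L[ℝ] ℝ) E (g x).inverse ∘L
    (ContinuousLinearMap.compL ℝ E (E →L[ℝ] F) (E →L[ℝ] ℝ)).flip (sffL g h ψ x) ∘L
    ContinuousLinearMap.compL ℝ E F ℝ ∘L (h (ψ x)).flip

/-- The normal covariant derivative `u ↦ ∇^⊥_u V` as a continuous linear map. -/
def normalDerivL (g : E → E →L[ℝ] E →L[ℝ] ℝ) (h : F → F →L[ℝ] F →L[ℝ] ℝ) (ψ V : E → F) (x : E) :
    E →L[ℝ] F :=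
  norPartL g h ψ x ∘L covDerivAlongL h ψ V x

variable (g : E → E →L[ℝ] E →L[ℝ] ℝ) (h : F → F →L[ℝ] F →L[ℝ] ℝ) (ψ : E → F) (x : E)

theorem sffL_apply (u v : E) :
    sffL g h ψ x u v = fderiv ℝ (fderiv ℝ ψ) x u v
      + christoffelL h (ψ x) (fderiv ℝ ψ x u) (fderiv ℝ ψ x v)
      - fderiv ℝ ψ x (christoffelL g x u v) := rfl

omit [FiniteDimensional ℝ F] in
theorem tanPart_eq (V : F) : tanPart g h ψ x V = tanPartL g h ψ x V :=
  raise_eq_inverse (g x) ((h (ψ x) V).comp (fderiv ℝ ψ x))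

omit [FiniteDimensional ℝ F] in
theorem norPart_eq (V : F) : norPart g h ψ x V = norPartL g h ψ x V := by
  rw [norPart, tanPart_eq]; rfl

omit [FiniteDimensional ℝ E] [FiniteDimensional ℝ F] in
theorem norPartL_apply (V : F) :
    norPartL g h ψ x V = V - fderiv ℝ ψ x (tanPartL g h ψ x V) := rfl

theorem shapeL_eq_raise (ν : F) (u : E) :
    shapeL g h ψ x ν u = raise (g x) fun w => h (ψ x) (sffL g h ψ x u w) ν :=
  (raise_eq_inverse (g x) (((h (ψ x)).flip ν).comp (sffL g h ψ x u))).symm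

theorem normalDeriv_eq (V : E → F) (u : E) :
    normalDeriv g h ψ V x u = normalDerivL g h ψ V x u := norPart_eq g h ψ x _

theorem tension_eq_smul_meanCurv :
    tension g h ψ x = (Module.finrank ℝ E : ℝ) • meanCurv g h ψ x := by
  rw [tension, meanCurv, smul_smul]
  by_cases hd : Module.finrank ℝ E = 0
  · rw [trace_of_finrank_eq_zero hd, smul_zero]
  · rw [mul_one_div_cancel (by exact_mod_cast hd), one_smul]

end SecondFundamentalForm

section Isometric

variable {E : Type*} [NormedAddCommGroup E] [NormedSpace ℝ E]
  {F : Type*} [NormedAddCommGroup F] [NormedSpace ℝ F]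

/-- `ψ` is an isometric immersion of `(U, g)` in `(U', h)`. -/
structure IsIsometricOn (g : E → E →L[ℝ] E →L[ℝ] ℝ) (h : F → F →L[ℝ] F →L[ℝ] ℝ) (ψ : E → F)
    (U : Set E) (U' : Set F) : Prop where
  source : IsMetricOn g U
  target : IsMetricOn h U'
  smooth : ∀ x ∈ U, ContDiffAt ℝ ∞ ψ x
  mapsTo : ∀ x ∈ U, ψ x ∈ U'
  iso : ∀ x ∈ U, ∀ u v, g x u v = h (ψ x) (fderiv ℝ ψ x u) (fderiv ℝ ψ x v)

/-- `ν` is a smooth normal vector field along `ψ` on `U`. -/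
structure IsNormalOn (h : F → F →L[ℝ] F →L[ℝ] ℝ) (ψ ν : E → F) (U : Set E) : Prop where
  smooth : ∀ x ∈ U, ContDiffAt ℝ ∞ ν x
  normal : ∀ x ∈ U, ∀ w, h (ψ x) (ν x) (fderiv ℝ ψ x w) = 0

namespace IsIsometricOn

variable {g : E → E →L[ℝ] E →L[ℝ] ℝ} {h : F → F →L[ℝ] F →L[ℝ] ℝ} {ψ : E → F}
  {U : Set E} {U' : Set F} (S : IsIsometricOn g h ψ U U') {x : E} (hx : x ∈ U)

include S hx

theorem contDiffAt_metric_along : ContDiffAt ℝ ∞ (fun z => h (ψ z)) x :=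
  (S.target.smooth _ (S.mapsTo x hx)).comp x (S.smooth x hx)

variable [FiniteDimensional ℝ E]

theorem apply_tanPartL (V : F) (w : E) :
    g x (tanPartL g h ψ x V) w = h (ψ x) V (fderiv ℝ ψ x w) := by
  rw [← tanPart_eq]
  exact (S.source.inner x hx).apply_raise ((h (ψ x) V).comp (fderiv ℝ ψ x)) w

theorem tanPartL_eq_of_apply {V : F} {u : E} (hu : ∀ w, h (ψ x) V (fderiv ℝ ψ x w) = g x u w) :
    tanPartL g h ψ x V = u :=
  (S.source.inner x hx).ext fun w => by rw [S.apply_tanPartL hx, hu]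

theorem tanPartL_of_normal {V : F} (hV : ∀ w, h (ψ x) V (fderiv ℝ ψ x w) = 0) :
    tanPartL g h ψ x V = 0 :=
  S.tanPartL_eq_of_apply hx fun w => by rw [hV, map_zero, zero_apply]

theorem norPartL_of_normal {V : F} (hV : ∀ w, h (ψ x) V (fderiv ℝ ψ x w) = 0) :
    norPartL g h ψ x V = V := by
  rw [norPartL_apply, S.tanPartL_of_normal hx hV, map_zero, sub_zero]

theorem apply_norPartL (V : F) (w : E) : h (ψ x) (norPartL g h ψ x V) (fderiv ℝ ψ x w) = 0 := by
  rw [norPartL_apply, map_sub, sub_apply, ← S.iso x hx, S.apply_tanPartL hx, sub_self]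

theorem contDiffAt_norPart {V : E → F} (hV : ContDiffAt ℝ ∞ V x) :
    ContDiffAt ℝ ∞ (fun z => norPart g h ψ z (V z)) x :=
  hV.sub ((contDiffAt_fderiv (S.smooth x hx)).clm_apply
    (contDiffAt_raise (S.source.smooth x hx) (S.source.inner x hx) fun w =>
      ((S.contDiffAt_metric_along hx).clm_apply hV).clm_apply
        (contDiffAt_fderiv_apply (S.smooth x hx) w)))

variable [FiniteDimensional ℝ F]

theorem sff_eq (u v : E) : sff g h ψ x u v = sffL g h ψ x u v := by
  rw [sffL_apply, sff, covDerivAlong_eq, covDerivAlongL_apply, christoffel_eq,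
    fderiv_apply_const (differentiableAt_of_smooth (contDiffAt_fderiv (S.smooth x hx)))]

theorem sffL_symm (u v : E) : sffL g h ψ x u v = sffL g h ψ x v u := by
  rw [sffL_apply, sffL_apply, fderiv_fderiv_comm (S.smooth x hx),
    S.target.christoffelL_symm (S.mapsTo x hx), S.source.christoffelL_symm hx]

theorem gauss_formula {Y : E → E} (hY : DifferentiableAt ℝ Y x) (u : E) :
    covDerivAlong h ψ (fun z => fderiv ℝ ψ z (Y z)) x u
      = sffL g h ψ x u (Y x) + fderiv ℝ ψ x (fderiv ℝ Y x u + christoffelL g x u (Y x)) := by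
  rw [covDerivAlong_eq, covDerivAlongL_apply, sffL_apply, map_add,
    fderiv_apply_field (differentiableAt_of_smooth (contDiffAt_fderiv (S.smooth x hx))) hY]
  abel

theorem gauss_formula_const (u v : E) :
    covDerivAlong h ψ (fun z => fderiv ℝ ψ z v) x u
      = sffL g h ψ x u v + fderiv ℝ ψ x (christoffelL g x u v) := by
  simpa using S.gauss_formula hx (differentiableAt_const v) u

omit [FiniteDimensional ℝ E] in
theorem fderiv_source_metric (u v w : E) :
    fderiv ℝ g x u v w
      = h (ψ x) (covDerivAlong h ψ (fun z => fderiv ℝ ψ z v) x u) (fderiv ℝ ψ x w)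
        + h (ψ x) (fderiv ℝ ψ x v) (covDerivAlong h ψ (fun z => fderiv ℝ ψ z w) x u) := by
  have hψ := S.smooth x hx
  have iso : (fun z => g z v w) =ᶠ[nhds x]
      fun z => h (ψ z) (fderiv ℝ ψ z v) (fderiv ℝ ψ z w) := by
    filter_upwards [S.source.eventually_mem hx] with z hz
    exact S.iso z hz v w
  rw [← fderiv_apply_const₂ (differentiableAt_of_smooth (S.source.smooth x hx)), iso.fderiv_eq,
    fderiv_metric_along S.target (differentiableAt_of_smooth hψ) (S.mapsTo x hx)
      (differentiableAt_of_smooth (contDiffAt_fderiv_apply hψ v))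
      (differentiableAt_of_smooth (contDiffAt_fderiv_apply hψ w))]

/-- This is the Koszul formula: the tangential part of `∇_u (dψ v)` is the Levi-Civita connection of
the induced metric. -/
theorem sffL_normal (u v w : E) : h (ψ x) (sffL g h ψ x u v) (fderiv ℝ ψ x w) = 0 := by
  have hI := S.target.inner _ (S.mapsTo x hx)
  have symm : ∀ u v, covDerivAlong h ψ (fun z => fderiv ℝ ψ z v) x u
      = covDerivAlong h ψ (fun z => fderiv ℝ ψ z u) x v := fun u v => by
    rw [S.gauss_formula_const hx, S.gauss_formula_const hx, S.sffL_symm hx,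
      S.source.christoffelL_symm hx]
  rw [eq_sub_of_add_eq (S.gauss_formula_const hx u v).symm, map_sub, sub_apply, ← S.iso x hx,
    S.source.apply_christoffelL hx, S.fderiv_source_metric hx, S.fderiv_source_metric hx,
    S.fderiv_source_metric hx, symm v u, symm w v, symm w u,
    hI.symm _ (covDerivAlong h ψ (fun z => fderiv ℝ ψ z w) x u),
    hI.symm _ (covDerivAlong h ψ (fun z => fderiv ℝ ψ z w) x v)]
  ring

theorem contDiffAt_sffL : ContDiffAt ℝ ∞ (sffL g h ψ) x := by
  have hψ := S.smooth x hx
  refine contDiffAt_clm₂_of_apply fun u v => ?_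
  simp only [sffL_apply]
  exact ((contDiffAt_apply₂ (contDiffAt_fderiv (contDiffAt_fderiv hψ)) u v).add
    ((((S.target.contDiffAt_christoffelL (S.mapsTo x hx)).comp x hψ).clm_apply
      (contDiffAt_fderiv_apply hψ u)).clm_apply (contDiffAt_fderiv_apply hψ v))).sub
    ((contDiffAt_fderiv hψ).clm_apply
      (contDiffAt_apply₂ (S.source.contDiffAt_christoffelL hx) u v))

theorem shape_eq (ν : F) (u : E) : shape g h ψ x ν u = shapeL g h ψ x ν u := by
  simp only [shape, shapeL_eq_raise, S.sff_eq hx]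

theorem apply_shapeL (ν : F) (u w : E) :
    g x (shapeL g h ψ x ν u) w = h (ψ x) (sffL g h ψ x u w) ν := by
  rw [shapeL_eq_raise]
  exact (S.source.inner x hx).apply_raise (((h (ψ x)).flip ν).comp (sffL g h ψ x u)) w

theorem contDiffAt_shapeL : ContDiffAt ℝ ∞ (shapeL g h ψ) x := by
  refine contDiffAt_clm₂_of_apply fun ν u => ?_
  simp only [shapeL_eq_raise]
  exact contDiffAt_raise (S.source.smooth x hx) (S.source.inner x hx) fun w =>
    ((S.contDiffAt_metric_along hx).clm_apply
      (contDiffAt_apply₂ (S.contDiffAt_sffL hx) u w)).clm_apply contDiffAt_const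

omit hx in
theorem isNormalOn_normalDeriv {ν : E → F} (hν : IsNormalOn h ψ ν U) (u : E) :
    IsNormalOn h ψ (fun z => normalDeriv g h ψ ν z u) U where
  smooth x hx := S.contDiffAt_norPart hx
    (contDiffAt_covDerivAlong S.target (S.smooth x hx) (S.mapsTo x hx) (hν.smooth x hx) u)
  normal x hx w := by rw [normalDeriv_eq]; exact S.apply_norPartL hx _ w

theorem trace_sff_eventuallyEq :
    (fun z => trace (g z) (sff g h ψ z)) =ᶠ[nhds x]
      fun z => trace (g z) fun u v => sffL g h ψ z u v := by
  filter_upwards [S.source.eventually_mem hx] with z hz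
  simp only [trace, S.sff_eq hz]

omit hx in
theorem isNormalOn_meanCurv : IsNormalOn h ψ (meanCurv g h ψ) U where
  smooth x hx := contDiffAt_const.smul <|
    (contDiffAt_trace (S.source.smooth x hx) (S.source.inner x hx)
      (S.contDiffAt_sffL hx)).congr_of_eventuallyEq (S.trace_sff_eventuallyEq hx)
  normal x hx w := by
    simp only [meanCurv, trace, S.sff_eq hx, map_smul, map_sum, smul_apply, sum_apply,
      S.sffL_normal hx, Finset.sum_const_zero, smul_zero]

theorem weingarten_formula {ν : E → F} (hν : IsNormalOn h ψ ν U) (u : E) :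
    covDerivAlong h ψ ν x u
      = normalDeriv g h ψ ν x u - fderiv ℝ ψ x (shapeL g h ψ x (ν x) u) := by
  have hψ := S.smooth x hx
  have tangential : tanPartL g h ψ x (covDerivAlongL h ψ ν x u) = -shapeL g h ψ x (ν x) u := by
    refine S.tanPartL_eq_of_apply hx fun w => ?_
    have normal : (fun z => h (ψ z) (ν z) (fderiv ℝ ψ z w)) =ᶠ[nhds x] fun _ => 0 := by
      filter_upwards [S.source.eventually_mem hx] with z hz
      exact hν.normal z hz w
    have hderiv := fderiv_metric_along S.target (differentiableAt_of_smooth hψ) (S.mapsTo x hx)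
      (differentiableAt_of_smooth (hν.smooth x hx))
      (differentiableAt_of_smooth (contDiffAt_fderiv_apply hψ w)) u
    rw [normal.fderiv_eq, S.gauss_formula_const hx, covDerivAlong_eq] at hderiv
    simp only [fderiv_fun_const, Pi.zero_apply, zero_apply, map_add, hν.normal x hx] at hderiv
    rw [map_neg, neg_apply, S.apply_shapeL hx, (S.target.inner _ (S.mapsTo x hx)).symm _ (ν x)]
    linarith
  rw [normalDeriv_eq, normalDerivL, ContinuousLinearMap.comp_apply, norPartL_apply, tangential,
    covDerivAlong_eq]
  simp

theorem covDerivEndo_shapeL {ν : E → F} (hν : ContDiffAt ℝ ∞ ν x) (u v : E) :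
    covDerivEndo g (fun z => shapeL g h ψ z (ν z)) x u v
      = fderiv ℝ (fun z => shapeL g h ψ z (ν z) v) x u
        + christoffelL g x u (shapeL g h ψ x (ν x) v)
        - shapeL g h ψ x (ν x) (christoffelL g x u v) := by
  rw [covDerivEndo, fderiv_apply_const
    (differentiableAt_of_smooth ((S.contDiffAt_shapeL hx).clm_apply hν)), christoffel_eq,
    christoffel_eq]

theorem covDerivAlong_covDerivAlong_normal {ν : E → F} (hν : IsNormalOn h ψ ν U) (u v : E) :
    covDerivAlong h ψ (fun z => covDerivAlong h ψ ν z v) x u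
        - covDerivAlong h ψ ν x (christoffelL g x u v)
      = (normalDeriv g h ψ (fun z => normalDeriv g h ψ ν z v) x u
          - normalDeriv g h ψ ν x (christoffelL g x u v))
        - sffL g h ψ x u (shapeL g h ψ x (ν x) v)
        - fderiv ℝ ψ x (shapeL g h ψ x (normalDeriv g h ψ ν x v) u
            + covDerivEndo g (fun z => shapeL g h ψ z (ν z)) x u v) := by
  have weingarten : (fun z => covDerivAlong h ψ ν z v) =ᶠ[nhds x] fun z =>
      normalDeriv g h ψ ν z v - fderiv ℝ ψ z (shapeL g h ψ z (ν z) v) := by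
    filter_upwards [S.source.eventually_mem hx] with z hz
    exact S.weingarten_formula hz hν v
  have hN := S.isNormalOn_normalDeriv hν v
  have hA : ContDiffAt ℝ ∞ (fun z => shapeL g h ψ z (ν z) v) x :=
    ((S.contDiffAt_shapeL hx).clm_apply (hν.smooth x hx)).clm_apply contDiffAt_const
  rw [covDerivAlong_congr weingarten,
    covDerivAlong_sub (differentiableAt_of_smooth (hN.smooth x hx))
    (differentiableAt_of_smooth ((contDiffAt_fderiv (S.smooth x hx)).clm_apply hA)),
    S.gauss_formula hx (differentiableAt_of_smooth hA), S.weingarten_formula hx hν,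
    S.weingarten_formula hx hN, S.covDerivEndo_shapeL hx (hν.smooth x hx)]
  simp only [map_add, map_sub]
  abel

theorem apply_covDerivEndo_shapeL {ν : E → F} (hν : IsNormalOn h ψ ν U) (u v w : E) :
    g x (covDerivEndo g (fun z => shapeL g h ψ z (ν z)) x u v) w
      = h (ψ x) (covDerivBilin g h ψ (sffL g h ψ) x u v w) (ν x)
        + g x (shapeL g h ψ x (normalDeriv g h ψ ν x u) v) w := by
  have hν' := differentiableAt_of_smooth (hν.smooth x hx)
  have hA : DifferentiableAt ℝ (fun z => shapeL g h ψ z (ν z) v) x := differentiableAt_of_smooth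
    (((S.contDiffAt_shapeL hx).clm_apply (hν.smooth x hx)).clm_apply contDiffAt_const)
  have hB : DifferentiableAt ℝ (fun z => sffL g h ψ z v w) x :=
    differentiableAt_of_smooth (contDiffAt_apply₂ (S.contDiffAt_sffL hx) v w)
  have adjoint : (fun z => g z (shapeL g h ψ z (ν z) v) w) =ᶠ[nhds x]
      fun z => h (ψ z) (sffL g h ψ z v w) (ν z) := by
    filter_upwards [S.source.eventually_mem hx] with z hz
    exact S.apply_shapeL hz _ v w
  have hderiv := congrArg (fun L : E →L[ℝ] ℝ => L u) adjoint.fderiv_eq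
  rw [fderiv_metric_along S.target (differentiableAt_of_smooth (S.smooth x hx)) (S.mapsTo x hx)
    hB hν', fderiv_apply_field₂ (differentiableAt_of_smooth (S.source.smooth x hx)) hA
    (differentiableAt_const w), S.source.fderiv_eq_christoffelL hx,
    S.weingarten_formula hx hν] at hderiv
  simp only [fderiv_fun_const, Pi.zero_apply, zero_apply, map_sub, map_zero, S.sffL_normal hx,
    S.apply_shapeL hx] at hderiv
  simp only [S.covDerivEndo_shapeL hx (hν.smooth x hx), covDerivBilin, map_sub, map_add,
    sub_apply, add_apply, S.apply_shapeL hx]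
  linarith

theorem apply_covDerivAlong_sffL {ν : F} (hν : ∀ w, h (ψ x) ν (fderiv ℝ ψ x w) = 0) (u v w : E) :
    h (ψ x) (covDerivAlong h ψ (fun z => sffL g h ψ z v w) x u) ν
      = h (ψ x) (covDerivAlong h ψ
          (fun z => covDerivAlong h ψ (fun y => fderiv ℝ ψ y w) z v) x u) ν
        - h (ψ x) (sffL g h ψ x u (christoffelL g x v w)) ν := by
  have hψ := S.smooth x hx
  have hΓ := contDiffAt_apply₂ (S.source.contDiffAt_christoffelL hx) v w
  have hD := contDiffAt_covDerivAlong S.target hψ (S.mapsTo x hx) (contDiffAt_fderiv_apply hψ w) v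
  have gauss : (fun z => sffL g h ψ z v w) =ᶠ[nhds x] fun z =>
      covDerivAlong h ψ (fun y => fderiv ℝ ψ y w) z v - fderiv ℝ ψ z (christoffelL g z v w) := by
    filter_upwards [S.source.eventually_mem hx] with z hz
    exact eq_sub_of_add_eq (S.gauss_formula_const hz v w).symm
  have hν' : ∀ w, h (ψ x) (fderiv ℝ ψ x w) ν = 0 := fun w => by
    rw [(S.target.inner _ (S.mapsTo x hx)).symm, hν]
  rw [covDerivAlong_congr gauss, covDerivAlong_sub (differentiableAt_of_smooth hD)
    (differentiableAt_of_smooth ((contDiffAt_fderiv hψ).clm_apply hΓ)),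
    S.gauss_formula hx (differentiableAt_of_smooth hΓ)]
  simp only [map_sub, map_add (h (ψ x)), sub_apply, add_apply, hν', add_zero]

theorem codazzi {ν : F} (hν : ∀ w, h (ψ x) ν (fderiv ℝ ψ x w) = 0) (u v w : E) :
    h (ψ x) (covDerivBilin g h ψ (sffL g h ψ) x u v w) ν
      = h (ψ x) (covDerivBilin g h ψ (sffL g h ψ) x w u v) ν
        + h (ψ x) (curvatureL h (ψ x) (fderiv ℝ ψ x u) (fderiv ℝ ψ x w) (fderiv ℝ ψ x v)) ν := by
  have symm : (fun z => sffL g h ψ z v w) =ᶠ[nhds x] fun z => sffL g h ψ z w v := by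
    filter_upwards [S.source.eventually_mem hx] with z hz
    exact S.sffL_symm hz v w
  rw [covDerivBilin, covDerivBilin, covDerivAlong_congr symm, ← covDerivAlong_comm S.target
    (S.smooth x hx) (S.mapsTo x hx) (contDiffAt_fderiv_apply (S.smooth x hx) v) u w]
  simp only [map_sub, sub_apply, S.apply_covDerivAlong_sffL hx hν]
  rw [S.sffL_symm hx v (christoffelL g x u w), S.source.christoffelL_symm hx w u,
    S.source.christoffelL_symm hx w v, S.source.christoffelL_symm hx v w,
    S.sffL_symm hx (christoffelL g x u v) w]
  ring

theorem covDerivAlong_tension (w : E) :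
    covDerivAlong h ψ (tension g h ψ) x w
      = trace (g x) (covDerivBilin g h ψ (sffL g h ψ) x w) := by
  rw [← S.source.covDerivAlong_trace hx h ψ (S.contDiffAt_sffL hx)]
  exact covDerivAlong_congr (S.trace_sff_eventuallyEq hx) w

end IsIsometricOn

end Isometric

/-! ### The bitension field of an isometric immersion -/

section Bitension

variable {E : Type*} [NormedAddCommGroup E] [NormedSpace ℝ E] [FiniteDimensional ℝ E]
  {F : Type*} [NormedAddCommGroup F] [NormedSpace ℝ F] [FiniteDimensional ℝ F]

theorem laplacianAlong_const_smul (g : E → E →L[ℝ] E →L[ℝ] ℝ) (h : F → F →L[ℝ] F →L[ℝ] ℝ)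
    (ψ V : E → F) (r : ℝ) (x : E) :
    laplacianAlong g h ψ (fun z => r • V z) x = r • laplacianAlong g h ψ V x := by
  simp only [laplacianAlong, covDerivAlong_const_smul, ← smul_sub, trace_smul, smul_neg]

/-- The trace `trace R(dψ ·, ν) dψ ·` over the tangent space of the immersed manifold. -/
def traceCurvAlong (g : E → E →L[ℝ] E →L[ℝ] ℝ) (h : F → F →L[ℝ] F →L[ℝ] ℝ) (ψ : E → F) (x : E)
    (ν : F) : F :=
  trace (g x) fun u v => curvatureL h (ψ x) (fderiv ℝ ψ x u) ν (fderiv ℝ ψ x v)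

theorem traceCurvAlong_smul (g : E → E →L[ℝ] E →L[ℝ] ℝ) (h : F → F →L[ℝ] F →L[ℝ] ℝ) (ψ : E → F)
    (x : E) (r : ℝ) (ν : F) :
    traceCurvAlong g h ψ x (r • ν) = r • traceCurvAlong g h ψ x ν := by
  simp only [traceCurvAlong, map_smul, smul_apply, trace_smul]

theorem IsMetricOn.apply_grad {g : E → E →L[ℝ] E →L[ℝ] ℝ} {U : Set E} (hg : IsMetricOn g U)
    {x : E} (hx : x ∈ U) (a : E → ℝ) (w : E) : g x (grad g a x) w = fderiv ℝ a x w :=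
  (hg.inner x hx).apply_raise (fderiv ℝ a x) w

theorem IsMetricOn.contDiffAt_grad {g : E → E →L[ℝ] E →L[ℝ] ℝ} {U : Set E} (hg : IsMetricOn g U)
    {x : E} (hx : x ∈ U) {a : E → ℝ} (ha : ContDiffAt ℝ ∞ a x) : ContDiffAt ℝ ∞ (grad g a) x :=
  contDiffAt_raise (hg.smooth x hx) (hg.inner x hx) fun w => contDiffAt_fderiv_apply ha w

omit [FiniteDimensional ℝ F] in
theorem apply_trace {E' : Type*} [NormedAddCommGroup E'] [NormedSpace ℝ E']
    (L : F →L[ℝ] E' →L[ℝ] ℝ) (b : E →L[ℝ] E →L[ℝ] ℝ) (T : E → E → F) (w : E') :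
    L (trace b T) w = trace b fun u v => L (T u v) w :=
  map_trace (L.flip w) b T

namespace IsIsometricOn

variable {g : E → E →L[ℝ] E →L[ℝ] ℝ} {h : F → F →L[ℝ] F →L[ℝ] ℝ} {ψ : E → F}
  {U : Set E} {U' : Set F} (S : IsIsometricOn g h ψ U U') {x : E} (hx : x ∈ U)

include S hx

theorem apply_gradNormSq {V : E → F} (hV : DifferentiableAt ℝ V x) (w : E) :
    g x (gradNormSq g h ψ V x) w = 2 * h (ψ x) (covDerivAlong h ψ V x w) (V x) := by
  rw [gradNormSq, S.source.apply_grad hx, fderiv_metric_along S.target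
    (differentiableAt_of_smooth (S.smooth x hx)) (S.mapsTo x hx) hV hV,
    (S.target.inner _ (S.mapsTo x hx)).symm (V x)]
  ring

theorem apply_traceCurvAlong (ν : F) (w : E) :
    h (ψ x) (traceCurvAlong g h ψ x ν) (fderiv ℝ ψ x w)
      = trace (g x) fun u v =>
          h (ψ x) (curvatureL h (ψ x) (fderiv ℝ ψ x u) (fderiv ℝ ψ x w) (fderiv ℝ ψ x v)) ν := by
  have bilinear : IsBilinearMap ℝ fun u v =>
      curvatureL h (ψ x) (fderiv ℝ ψ x u) ν (fderiv ℝ ψ x v) := by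
    constructor <;> intros <;> simp
  rw [traceCurvAlong, (S.source.inner x hx).trace_comm bilinear, apply_trace]
  simp only [(S.target.isCurvatureForm (S.mapsTo x hx)).pair _ ν]

/-- By the Codazzi equation `div A_H` is, up to curvature, the trace of `A_{∇^⊥ H}` plus the
derivative of `trace B`, and the latter gives the gradient of `|H|²`. -/
theorem trace_covDerivEndo_shapeL_meanCurv :
    trace (g x) (covDerivEndo g (fun z => shapeL g h ψ z (meanCurv g h ψ z)) x)
      = ((Module.finrank ℝ E : ℝ) / 2) • gradNormSq g h ψ (meanCurv g h ψ) x
        + tanPartL g h ψ x (traceCurvAlong g h ψ x (meanCurv g h ψ x))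
        + traceShapeNormalDeriv g h ψ (meanCurv g h ψ) x := by
  have hH := S.isNormalOn_meanCurv
  have hdH : ∀ w, trace (g x) (covDerivBilin g h ψ (sffL g h ψ) x w)
      = (Module.finrank ℝ E : ℝ) • covDerivAlong h ψ (meanCurv g h ψ) x w := fun w => by
    rw [← S.covDerivAlong_tension hx, ← covDerivAlong_const_smul,
      ← funext (tension_eq_smul_meanCurv g h ψ)]
  refine (S.source.inner x hx).ext fun w => ?_
  calc g x (trace (g x) (covDerivEndo g (fun z => shapeL g h ψ z (meanCurv g h ψ z)) x)) w
      = trace (g x) fun u v =>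
          h (ψ x) (covDerivBilin g h ψ (sffL g h ψ) x w u v) (meanCurv g h ψ x)
          + h (ψ x) (curvatureL h (ψ x) (fderiv ℝ ψ x u) (fderiv ℝ ψ x w) (fderiv ℝ ψ x v))
              (meanCurv g h ψ x)
          + g x (shapeL g h ψ x (normalDeriv g h ψ (meanCurv g h ψ) x u) v) w := by
        rw [apply_trace]
        congr 1
        funext u v
        rw [S.apply_covDerivEndo_shapeL hx hH, S.codazzi hx (hH.normal x hx)]
    _ = (Module.finrank ℝ E : ℝ) *
            h (ψ x) (covDerivAlong h ψ (meanCurv g h ψ) x w) (meanCurv g h ψ x)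
          + h (ψ x) (traceCurvAlong g h ψ x (meanCurv g h ψ x)) (fderiv ℝ ψ x w)
          + g x (traceShapeNormalDeriv g h ψ (meanCurv g h ψ) x) w := by
        rw [trace_add, trace_add, ← S.apply_traceCurvAlong hx]
        simp only [← apply_trace, hdH, traceShapeNormalDeriv, S.shape_eq hx, map_smul,
          smul_apply, smul_eq_mul]
    _ = _ := by
        simp only [map_add, add_apply, map_smul, smul_apply, smul_eq_mul, S.apply_tanPartL hx,
          S.apply_gradNormSq hx (differentiableAt_of_smooth (hH.smooth x hx))]
        ring

theorem neg_laplacianAlong_meanCurv :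
    -laplacianAlong g h ψ (meanCurv g h ψ) x
      = normalLaplacian g h ψ (meanCurv g h ψ) x - traceSffShape g h ψ x (meanCurv g h ψ x)
        - fderiv ℝ ψ x ((2 : ℝ) • traceShapeNormalDeriv g h ψ (meanCurv g h ψ) x
          + ((Module.finrank ℝ E : ℝ) / 2) • gradNormSq g h ψ (meanCurv g h ψ) x
          + tanPartL g h ψ x (traceCurvAlong g h ψ x (meanCurv g h ψ x))) := by
  have bilinear : IsBilinearMap ℝ fun u v =>
      shapeL g h ψ x (normalDerivL g h ψ (meanCurv g h ψ) x v) u := by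
    constructor <;> intros <;> simp
  have trace_shape : trace (g x) (fun u v =>
      shapeL g h ψ x (normalDeriv g h ψ (meanCurv g h ψ) x v) u)
      = traceShapeNormalDeriv g h ψ (meanCurv g h ψ) x := by
    simp only [traceShapeNormalDeriv, S.shape_eq hx, normalDeriv_eq]
    exact (S.source.inner x hx).trace_comm bilinear
  simp only [laplacianAlong, neg_neg, christoffel_eq,
    S.covDerivAlong_covDerivAlong_normal hx S.isNormalOn_meanCurv]
  rw [trace_sub, trace_sub, ← map_trace (fderiv ℝ ψ x), trace_add, trace_shape,
    S.trace_covDerivEndo_shapeL_meanCurv hx]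
  simp only [normalLaplacian, traceSffShape, S.sff_eq hx, S.shape_eq hx, christoffel_eq]
  congr 2
  rw [two_smul]
  abel

theorem bitension_eq :
    bitension g h ψ x = (Module.finrank ℝ E : ℝ) •
      ((normalLaplacian g h ψ (meanCurv g h ψ) x - traceSffShape g h ψ x (meanCurv g h ψ x)
          - norPartL g h ψ x (traceCurvAlong g h ψ x (meanCurv g h ψ x)))
        + fderiv ℝ ψ x ((-2 : ℝ) • traceShapeNormalDeriv g h ψ (meanCurv g h ψ) x
          - ((Module.finrank ℝ E : ℝ) / 2) • gradNormSq g h ψ (meanCurv g h ψ) x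
          - (2 : ℝ) • tanPartL g h ψ x (traceCurvAlong g h ψ x (meanCurv g h ψ x)))) := by
  have curv : trace (g x) (fun u v =>
      curvature h (ψ x) (fderiv ℝ ψ x u) (tension g h ψ x) (fderiv ℝ ψ x v))
      = (Module.finrank ℝ E : ℝ) • traceCurvAlong g h ψ x (meanCurv g h ψ x) := by
    rw [← traceCurvAlong_smul, ← tension_eq_smul_meanCurv]
    simp only [S.target.curvature_eq (S.mapsTo x hx), traceCurvAlong]
  rw [bitension, curv, funext (tension_eq_smul_meanCurv g h ψ), laplacianAlong_const_smul,
    ← smul_neg, ← smul_sub, S.neg_laplacianAlong_meanCurv hx, norPartL_apply]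
  simp only [map_add, map_sub, map_smul]
  module

omit [FiniteDimensional ℝ E] [FiniteDimensional ℝ F] in
theorem add_fderiv_eq_zero_iff {V : F} (hV : ∀ w, h (ψ x) V (fderiv ℝ ψ x w) = 0) (t : E) :
    V + fderiv ℝ ψ x t = 0 ↔ V = 0 ∧ t = 0 := by
  refine ⟨fun h0 => ?_, fun ⟨hV0, ht⟩ => by rw [hV0, ht, map_zero, add_zero]⟩
  have ht : t = 0 := (S.source.inner x hx).ext fun w => by
    have hw := congrArg (fun Z => h (ψ x) Z (fderiv ℝ ψ x w)) h0
    simpa [hV, ← S.iso x hx] using hw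
  rw [ht, map_zero, add_zero] at h0
  exact ⟨h0, ht⟩

theorem apply_normalLaplacian {ν : E → F} (hν : IsNormalOn h ψ ν U) (w : E) :
    h (ψ x) (normalLaplacian g h ψ ν x) (fderiv ℝ ψ x w) = 0 := by
  simp only [normalLaplacian, trace, map_sum, sum_apply, map_sub, sub_apply,
    (S.isNormalOn_normalDeriv (S.isNormalOn_normalDeriv hν _) _).normal x hx,
    (S.isNormalOn_normalDeriv hν _).normal x hx, sub_zero, Finset.sum_const_zero]

theorem apply_traceSffShape (ν : F) (w : E) :
    h (ψ x) (traceSffShape g h ψ x ν) (fderiv ℝ ψ x w) = 0 := by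
  simp only [traceSffShape, trace, map_sum, sum_apply, S.sff_eq hx, S.sffL_normal hx,
    Finset.sum_const_zero]

theorem bitension_eq_zero_iff :
    bitension g h ψ x = 0 ↔
      normalLaplacian g h ψ (meanCurv g h ψ) x = traceSffShape g h ψ x (meanCurv g h ψ x)
          + norPart g h ψ x (traceCurvAlong g h ψ x (meanCurv g h ψ x)) ∧
      (-2 : ℝ) • traceShapeNormalDeriv g h ψ (meanCurv g h ψ) x
          - ((Module.finrank ℝ E : ℝ) / 2) • gradNormSq g h ψ (meanCurv g h ψ) x
          - (2 : ℝ) • tanPart g h ψ x (traceCurvAlong g h ψ x (meanCurv g h ψ x)) = 0 := by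
  rcases eq_or_ne (Module.finrank ℝ E) 0 with hd | hd
  · have := Module.finrank_zero_iff.1 hd
    refine iff_of_true (by rw [S.bitension_eq hx, hd, Nat.cast_zero, zero_smul])
      ⟨?_, Subsingleton.elim _ _⟩
    simp only [normalLaplacian, traceSffShape, traceCurvAlong, trace_of_finrank_eq_zero hd,
      norPart_eq, map_zero, add_zero]
  rw [S.bitension_eq hx, smul_eq_zero_iff_right (Nat.cast_ne_zero.2 hd),
    S.add_fderiv_eq_zero_iff hx fun w => by
      simp only [map_sub, sub_apply, S.apply_normalLaplacian hx S.isNormalOn_meanCurv,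
        S.apply_traceSffShape hx, S.apply_norPartL hx, sub_zero], sub_sub, sub_eq_zero,
    norPart_eq, tanPart_eq]

end IsIsometricOn

end Bitension

section Hypersurface

variable {E : Type*} [NormedAddCommGroup E] [NormedSpace ℝ E] [FiniteDimensional ℝ E]
  {F : Type*} [NormedAddCommGroup F] [NormedSpace ℝ F] [FiniteDimensional ℝ F]
  {b : E →L[ℝ] E →L[ℝ] ℝ} {b' : F →L[ℝ] F →L[ℝ] ℝ} {L : E →L[ℝ] F} {ν : F}

theorem IsInner.exists_eq_add_smul (hb : IsInner b) (hb' : IsInner b')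
    (iso : ∀ u v, b u v = b' (L u) (L v))
    (hdim : Module.finrank ℝ F = Module.finrank ℝ E + 1) (hν0 : ν ≠ 0)
    (hν : ∀ w, b' ν (L w) = 0) (V : F) : ∃ (u : E) (r : ℝ), V = L u + r • ν := by
  let K : (E × ℝ) →ₗ[ℝ] F := (L : E →ₗ[ℝ] F).coprod (LinearMap.toSpanSingleton ℝ F ν)
  have injective : Function.Injective K := by
    refine (injective_iff_map_eq_zero K).2 fun p hp => ?_
    replace hp : L p.1 + p.2 • ν = 0 := hp
    have hr : p.2 = 0 := by
      have hνp := congrArg (b' ν) hp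
      simpa [hν, (hb'.pos ν hν0).ne'] using hνp
    have hu : p.1 = 0 := hb.ext fun w => by
      rw [hr, zero_smul, add_zero] at hp
      rw [iso, hp, map_zero, map_zero, zero_apply, zero_apply]
    exact Prod.ext hu hr
  obtain ⟨p, hp⟩ :=
    (LinearMap.injective_iff_surjective_of_finrank_eq_finrank (by simp [hdim])).1 injective V
  exact ⟨p.1, p.2, hp.symm⟩

theorem IsInner.trace_eq_add_smul {G : Type*} [NormedAddCommGroup G] [NormedSpace ℝ G]
    (hb : IsInner b) (hb' : IsInner b') (iso : ∀ u v, b u v = b' (L u) (L v))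
    (hdim : Module.finrank ℝ F = Module.finrank ℝ E + 1) (hν0 : ν ≠ 0)
    (hν : ∀ w, b' ν (L w) = 0) {T : F → F → G} (hT : IsBilinearMap ℝ T) :
    trace b' T = (b' ν ν)⁻¹ • T ν ν + trace b fun u v => T (L u) (L v) := by
  let a : Option (Fin (Module.finrank ℝ E)) → F := fun o =>
    o.elim ν fun i => L (Module.finBasis ℝ E i)
  let c : Option (Fin (Module.finrank ℝ E)) → F := fun o =>
    o.elim ((b' ν ν)⁻¹ • ν) fun i => L (dualVec b i)
  have hac : ∀ V, ∑ i, b' V (a i) • c i = V := fun V => by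
    obtain ⟨u, r, rfl⟩ := hb.exists_eq_add_smul hb' iso hdim hν0 hν V
    have normal : b' (L u + r • ν) ν • (b' ν ν)⁻¹ • ν = r • ν := by
      rw [map_add, add_apply, map_smul, smul_apply, hb'.symm, hν, zero_add, smul_eq_mul,
        smul_smul, mul_assoc, mul_inv_cancel₀ (hb'.pos ν hν0).ne', mul_one]
    have tangential : ∑ i, b' (L u + r • ν) (L (Module.finBasis ℝ E i)) • L (dualVec b i)
        = L u := by
      conv_rhs => rw [← hb.sum_apply_smul_dualVec u]
      simp only [map_add, map_smul, add_apply, smul_apply, hν, ← iso, smul_zero, add_zero, map_sum]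
    rw [Fintype.sum_option]
    exact (congrArg₂ (· + ·) normal tangential).trans (add_comm _ _)
  rw [hb'.trace_eq_sum hac hT, Fintype.sum_option]
  exact congrArg (· + _) (hT.smul_right _ _ _)

/-- The trace `trace R(·, ν) ·` over the whole tangent space, i.e. minus the Ricci operator. -/
def traceCurv (h : F → F →L[ℝ] F →L[ℝ] ℝ) (y ν : F) : F :=
  trace (h y) fun u v => curvatureL h y u ν v

theorem IsIsometricOn.traceCurvAlong_eq_traceCurv {g : E → E →L[ℝ] E →L[ℝ] ℝ}
    {h : F → F →L[ℝ] F →L[ℝ] ℝ} {ψ : E → F} {U : Set E} {U' : Set F}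
    (S : IsIsometricOn g h ψ U U') {x : E} (hx : x ∈ U)
    (hdim : Module.finrank ℝ F = Module.finrank ℝ E + 1)
    (hν : ∀ w, h (ψ x) ν (fderiv ℝ ψ x w) = 0) :
    traceCurvAlong g h ψ x ν = traceCurv h (ψ x) ν := by
  obtain rfl | hν0 := eq_or_ne ν 0
  · simp [traceCurvAlong, traceCurv, trace]
  have bilinear : IsBilinearMap ℝ fun u v => curvatureL h (ψ x) u ν v := by
    constructor <;> intros <;> simp
  rw [traceCurv, (S.source.inner x hx).trace_eq_add_smul (S.target.inner _ (S.mapsTo x hx))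
    (S.iso x hx) hdim hν0 hν bilinear, curvatureL_self, smul_zero, zero_add, traceCurvAlong]

end Hypersurface

/-! ### Curvature of warped products -/

section WarpedProduct

variable {E₁ : Type*} [NormedAddCommGroup E₁] [NormedSpace ℝ E₁]
  {E₂ : Type*} [NormedAddCommGroup E₂] [NormedSpace ℝ E₂]

theorem fderiv_slice_fst {G : Type*} [NormedAddCommGroup G] [NormedSpace ℝ G] {φ : E₁ × E₂ → G}
    {y : E₁ × E₂} (hφ : DifferentiableAt ℝ φ y) (u : E₁) :
    fderiv ℝ φ y (u, 0) = fderiv ℝ (fun p => φ (p, y.2)) y.1 u := by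
  have slice : HasFDerivAt (fun p => φ (p, y.2))
      ((fderiv ℝ φ y).comp (ContinuousLinearMap.inl ℝ E₁ E₂)) y.1 :=
    HasFDerivAt.comp (g := φ) y.1 hφ.hasFDerivAt (hasFDerivAt_prodMk_left y.1 y.2)
  rw [slice.fderiv, ContinuousLinearMap.comp_apply, ContinuousLinearMap.inl_apply]

theorem fderiv_slice_snd {G : Type*} [NormedAddCommGroup G] [NormedSpace ℝ G] {φ : E₁ × E₂ → G}
    {y : E₁ × E₂} (hφ : DifferentiableAt ℝ φ y) (u : E₂) :
    fderiv ℝ φ y (0, u) = fderiv ℝ (fun q => φ (y.1, q)) y.2 u := by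
  have slice : HasFDerivAt (fun q => φ (y.1, q))
      ((fderiv ℝ φ y).comp (ContinuousLinearMap.inr ℝ E₁ E₂)) y.2 :=
    HasFDerivAt.comp (g := φ) y.2 hφ.hasFDerivAt (hasFDerivAt_prodMk_right y.1 y.2)
  rw [slice.fderiv, ContinuousLinearMap.comp_apply, ContinuousLinearMap.inr_apply]

/-- The warped product metric `g₁ + f² g₂` in coordinates. -/
def warp (g₁ : E₁ → E₁ →L[ℝ] E₁ →L[ℝ] ℝ) (g₂ : E₂ → E₂ →L[ℝ] E₂ →L[ℝ] ℝ) (f : E₁ → ℝ)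
    (y : E₁ × E₂) : (E₁ × E₂) →L[ℝ] (E₁ × E₂) →L[ℝ] ℝ :=
  (g₁ y.1).bilinearComp (ContinuousLinearMap.fst ℝ E₁ E₂) (ContinuousLinearMap.fst ℝ E₁ E₂)
    + f y.1 ^ 2 •
      (g₂ y.2).bilinearComp (ContinuousLinearMap.snd ℝ E₁ E₂) (ContinuousLinearMap.snd ℝ E₁ E₂)

theorem warp_apply (g₁ : E₁ → E₁ →L[ℝ] E₁ →L[ℝ] ℝ) (g₂ : E₂ → E₂ →L[ℝ] E₂ →L[ℝ] ℝ) (f : E₁ → ℝ)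
    (y a b : E₁ × E₂) :
    warp g₁ g₂ f y a b = g₁ y.1 a.1 b.1 + f y.1 ^ 2 * g₂ y.2 a.2 b.2 := rfl

/-- The data of a warped product metric on `U₁ × U₂`. -/
structure IsWarpedOn (g₁ : E₁ → E₁ →L[ℝ] E₁ →L[ℝ] ℝ) (g₂ : E₂ → E₂ →L[ℝ] E₂ →L[ℝ] ℝ)
    (f : E₁ → ℝ) (U₁ : Set E₁) (U₂ : Set E₂) : Prop where
  fst : IsMetricOn g₁ U₁
  snd : IsMetricOn g₂ U₂
  smooth : ∀ x ∈ U₁, ContDiffAt ℝ ∞ f x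
  pos : ∀ x ∈ U₁, 0 < f x

namespace IsWarpedOn

variable {g₁ : E₁ → E₁ →L[ℝ] E₁ →L[ℝ] ℝ} {g₂ : E₂ → E₂ →L[ℝ] E₂ →L[ℝ] ℝ} {f : E₁ → ℝ}
  {U₁ : Set E₁} {U₂ : Set E₂} (W : IsWarpedOn g₁ g₂ f U₁ U₂) {y : E₁ × E₂} (hy : y ∈ U₁ ×ˢ U₂)

include W hy

theorem isInner : IsInner (warp g₁ g₂ f y) where
  symm u v := by
    rw [warp_apply, warp_apply, (W.fst.inner _ hy.1).symm, (W.snd.inner _ hy.2).symm]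
  pos u hu := by
    have i₁ := W.fst.inner _ hy.1
    have i₂ := W.snd.inner _ hy.2
    have hf := W.pos _ hy.1
    have nonneg : 0 ≤ g₁ y.1 u.1 u.1 := by
      obtain h | h := eq_or_ne u.1 0
      · rw [h, map_zero]
      · exact (i₁.pos _ h).le
    rw [warp_apply]
    obtain h | h := eq_or_ne u.2 0
    · rw [h, map_zero, mul_zero, add_zero]
      exact i₁.pos _ fun h' => hu (Prod.ext h' h)
    · have := i₂.pos _ h
      positivity

variable [FiniteDimensional ℝ E₁] [FiniteDimensional ℝ E₂]

omit hy in
theorem isMetricOn : IsMetricOn (warp g₁ g₂ f) (U₁ ×ˢ U₂) where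
  isOpen := W.fst.isOpen.prod W.snd.isOpen
  smooth y hy := by
    have hg₁ : ContDiffAt ℝ ∞ (fun z : E₁ × E₂ => g₁ z.1) y :=
      (W.fst.smooth _ hy.1).comp y contDiffAt_fst
    have hg₂ : ContDiffAt ℝ ∞ (fun z : E₁ × E₂ => g₂ z.2) y :=
      (W.snd.smooth _ hy.2).comp y contDiffAt_snd
    have hf : ContDiffAt ℝ ∞ (fun z : E₁ × E₂ => f z.1) y :=
      (W.smooth _ hy.1).comp y contDiffAt_fst
    refine contDiffAt_clm₂_of_apply fun u v => ?_
    simp only [warp_apply]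
    exact (contDiffAt_apply₂ hg₁ _ _).add ((hf.pow 2).mul (contDiffAt_apply₂ hg₂ _ _))
  inner y hy := W.isInner hy

theorem fderiv_warp (a b c : E₁ × E₂) :
    fderiv ℝ (warp g₁ g₂ f) y a b c = fderiv ℝ g₁ y.1 a.1 b.1 c.1
      + 2 * f y.1 * fderiv ℝ f y.1 a.1 * g₂ y.2 b.2 c.2
      + f y.1 ^ 2 * fderiv ℝ g₂ y.2 a.2 b.2 c.2 := by
  have hw : DifferentiableAt ℝ (fun z => warp g₁ g₂ f z b c) y :=
    differentiableAt_of_smooth (contDiffAt_apply₂ (W.isMetricOn.smooth y hy) b c)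
  have hg₁ := differentiableAt_of_smooth (contDiffAt_apply₂ (W.fst.smooth _ hy.1) b.1 c.1)
  have hg₂ := differentiableAt_of_smooth (contDiffAt_apply₂ (W.snd.smooth _ hy.2) b.2 c.2)
  have hf := differentiableAt_of_smooth (W.smooth _ hy.1)
  have split : a = (a.1, 0) + (0, a.2) := by simp
  rw [← fderiv_apply_const₂ (differentiableAt_of_smooth (W.isMetricOn.smooth y hy)),
    ← fderiv_apply_const₂ (differentiableAt_of_smooth (W.fst.smooth _ hy.1)),
    ← fderiv_apply_const₂ (differentiableAt_of_smooth (W.snd.smooth _ hy.2)), split, map_add,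
    fderiv_slice_fst hw, fderiv_slice_snd hw]
  simp only [warp_apply]
  rw [fderiv_fun_add hg₁ ((hf.fun_pow 2).mul_const _), fderiv_mul_const (hf.fun_pow 2),
    fderiv_fun_pow _ hf, fderiv_const_add, fderiv_const_mul hg₂]
  simp only [add_apply, smul_apply, smul_eq_mul, Prod.fst_add, Prod.snd_add, add_zero, zero_add,
    nsmul_eq_mul]
  push_cast
  ring

theorem christoffelL_warp (a b : E₁ × E₂) :
    christoffelL (warp g₁ g₂ f) y a b
      = (christoffelL g₁ y.1 a.1 b.1 - (f y.1 * g₂ y.2 a.2 b.2) • grad g₁ f y.1,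
        christoffelL g₂ y.2 a.2 b.2
          + (f y.1)⁻¹ • (fderiv ℝ f y.1 a.1 • b.2 + fderiv ℝ f y.1 b.1 • a.2)) := by
  have hf := (W.pos _ hy.1).ne'
  refine (W.isInner hy).ext fun w => ?_
  rw [W.isMetricOn.apply_christoffelL hy, W.fderiv_warp hy, W.fderiv_warp hy, W.fderiv_warp hy,
    warp_apply]
  simp only [map_sub, map_add, map_smul, sub_apply, add_apply, smul_apply, smul_eq_mul,
    W.fst.apply_grad hy.1, W.fst.apply_christoffelL hy.1, W.snd.apply_christoffelL hy.2]
  field_simp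
  ring

theorem fderiv_christoffelL_warp_fst (u : E₁) (a b : E₁ × E₂) :
    fderiv ℝ (christoffelL (warp g₁ g₂ f)) y (u, 0) a b
      = fderiv ℝ (fun p => christoffelL (warp g₁ g₂ f) (p, y.2) a b) y.1 u := by
  have hΓ := W.isMetricOn.contDiffAt_christoffelL hy
  rw [← fderiv_apply_const₂ (differentiableAt_of_smooth hΓ),
    fderiv_slice_fst (differentiableAt_of_smooth (contDiffAt_apply₂ hΓ a b))]

theorem fderiv_christoffelL_warp_snd (u : E₂) (a b : E₁ × E₂) :
    fderiv ℝ (christoffelL (warp g₁ g₂ f)) y (0, u) a b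
      = fderiv ℝ (fun q => christoffelL (warp g₁ g₂ f) (y.1, q) a b) y.2 u := by
  have hΓ := W.isMetricOn.contDiffAt_christoffelL hy
  rw [← fderiv_apply_const₂ (differentiableAt_of_smooth hΓ),
    fderiv_slice_snd (differentiableAt_of_smooth (contDiffAt_apply₂ hΓ a b))]

theorem fderiv_christoffelL_warp_horizontal (u a b : E₁) :
    fderiv ℝ (christoffelL (warp g₁ g₂ f)) y (u, 0) (a, 0) (b, 0)
      = (fderiv ℝ (christoffelL g₁) y.1 u a b, 0) := by
  have hΓ := W.fst.contDiffAt_christoffelL hy.1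
  have horizontal : (fun p => christoffelL (warp g₁ g₂ f) (p, y.2) (a, 0) (b, 0)) =ᶠ[nhds y.1]
      fun p => (christoffelL g₁ p a b, 0) := by
    filter_upwards [W.fst.eventually_mem hy.1] with p hp
    simp [W.christoffelL_warp (y := (p, y.2)) ⟨hp, hy.2⟩]
  rw [W.fderiv_christoffelL_warp_fst hy, horizontal.fderiv_eq,
    (differentiableAt_of_smooth (contDiffAt_apply₂ hΓ a b)).fderiv_prodMk
      (differentiableAt_const 0), ContinuousLinearMap.prod_apply,
    fderiv_apply_const₂ (differentiableAt_of_smooth hΓ)]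
  simp

theorem fderiv_christoffelL_warp_mixed (a b : E₂) (X : E₁) :
    fderiv ℝ (christoffelL (warp g₁ g₂ f)) y (0, a) (X, 0) (0, b) = 0 := by
  have mixed : (fun q => christoffelL (warp g₁ g₂ f) (y.1, q) (X, 0) (0, b)) =ᶠ[nhds y.2]
      fun _ => (0, ((f y.1)⁻¹ * fderiv ℝ f y.1 X) • b) := by
    filter_upwards [W.snd.eventually_mem hy.2] with q hq
    simp [W.christoffelL_warp (y := (y.1, q)) ⟨hy.1, hq⟩, smul_smul]
  rw [W.fderiv_christoffelL_warp_snd hy, mixed.fderiv_eq, fderiv_fun_const, Pi.zero_apply,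
    zero_apply]

theorem fderiv_christoffelL_warp_vertical (X : E₁) (a b : E₂) :
    fderiv ℝ (christoffelL (warp g₁ g₂ f)) y (X, 0) (0, a) (0, b)
      = (-(g₂ y.2 a b • (f y.1 • fderiv ℝ (grad g₁ f) y.1 X
          + fderiv ℝ f y.1 X • grad g₁ f y.1)), 0) := by
  have hf := differentiableAt_of_smooth (W.smooth _ hy.1)
  have hgrad : DifferentiableAt ℝ (grad g₁ f) y.1 :=
    differentiableAt_of_smooth (W.fst.contDiffAt_grad hy.1 (W.smooth _ hy.1))
  have vertical : (fun p => christoffelL (warp g₁ g₂ f) (p, y.2) (0, a) (0, b)) =ᶠ[nhds y.1]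
      fun p => (-(g₂ y.2 a b • f p • grad g₁ f p), christoffelL g₂ y.2 a b) := by
    filter_upwards [W.fst.eventually_mem hy.1] with p hp
    simp [W.christoffelL_warp (y := (p, y.2)) ⟨hp, hy.2⟩, smul_smul, mul_comm]
  rw [W.fderiv_christoffelL_warp_fst hy, vertical.fderiv_eq,
    ((hf.fun_smul hgrad).fun_const_smul _).fun_neg.fderiv_prodMk (differentiableAt_const _),
    fderiv_fun_neg, fderiv_fun_const_smul (hf.fun_smul hgrad), fderiv_fun_smul hf hgrad]
  simp

theorem curvatureL_warp_horizontal (a X b : E₁) :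
    curvatureL (warp g₁ g₂ f) y (a, 0) (X, 0) (b, 0) = (curvatureL g₁ y.1 a X b, 0) := by
  simp only [curvatureL_apply, W.fderiv_christoffelL_warp_horizontal hy, W.christoffelL_warp hy,
    Prod.mk_add_mk, Prod.mk_sub_mk, map_zero, mul_zero, zero_smul, smul_zero, sub_zero,
    add_zero]

theorem curvatureL_warp_mixed (a b : E₂) (X : E₁) :
    curvatureL (warp g₁ g₂ f) y (0, a) (X, 0) (0, b)
      = ((f y.1 * g₂ y.2 a b) • covDerivGrad g₁ f y.1 X, 0) := by
  have cancel (t : ℝ) : f y.1 * ((f y.1)⁻¹ * t) = t := mul_inv_cancel_left₀ (W.pos _ hy.1).ne' t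
  rw [curvatureL_apply, W.fderiv_christoffelL_warp_mixed hy,
    W.fderiv_christoffelL_warp_vertical hy]
  simp only [W.christoffelL_warp hy, covDerivGrad, christoffel_eq]
  refine Prod.ext ?_ ?_
  · simp [smul_smul, mul_assoc, cancel]
    module
  · simp [smul_smul]

theorem grad_warp : grad (warp g₁ g₂ f) (fun z => f z.1) y = (grad g₁ f y.1, 0) := by
  have hf : fderiv ℝ (fun z : E₁ × E₂ => f z.1) y
      = (fderiv ℝ f y.1).comp (ContinuousLinearMap.fst ℝ E₁ E₂) :=
    ((differentiableAt_of_smooth (W.smooth _ hy.1)).hasFDerivAt.comp y hasFDerivAt_fst).fderiv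
  refine (W.isInner hy).ext fun w => ?_
  rw [W.isMetricOn.apply_grad hy, warp_apply, W.fst.apply_grad hy.1, hf]
  simp

theorem covDerivGrad_warp (X : E₁) :
    covDerivGrad (warp g₁ g₂ f) (fun z => f z.1) y (X, 0) = (covDerivGrad g₁ f y.1 X, 0) := by
  have hgrad : DifferentiableAt ℝ (grad g₁ f) y.1 :=
    differentiableAt_of_smooth (W.fst.contDiffAt_grad hy.1 (W.smooth _ hy.1))
  have hgradw : DifferentiableAt ℝ (grad (warp g₁ g₂ f) fun z => f z.1) y :=
    differentiableAt_of_smooth (W.isMetricOn.contDiffAt_grad hy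
      ((W.smooth _ hy.1).comp y contDiffAt_fst))
  have slice : (fun p => grad (warp g₁ g₂ f) (fun z => f z.1) (p, y.2)) =ᶠ[nhds y.1]
      fun p => (grad g₁ f p, 0) := by
    filter_upwards [W.fst.eventually_mem hy.1] with p hp
    exact W.grad_warp (y := (p, y.2)) ⟨hp, hy.2⟩
  rw [covDerivGrad, covDerivGrad, fderiv_slice_fst hgradw, slice.fderiv_eq,
    hgrad.fderiv_prodMk (differentiableAt_const 0), W.grad_warp hy, christoffel_eq,
    christoffel_eq, W.christoffelL_warp hy]
  simp

theorem trace_warp {G : Type*} [NormedAddCommGroup G] [NormedSpace ℝ G]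
    {T : E₁ × E₂ → E₁ × E₂ → G} (hT : IsBilinearMap ℝ T) :
    trace (warp g₁ g₂ f y) T = trace (g₁ y.1) (fun u v => T (u, 0) (v, 0))
      + (f y.1 ^ 2)⁻¹ • trace (g₂ y.2) fun u v => T (0, u) (0, v) := by
  have hf := (W.pos _ hy.1).ne'
  let a : Fin (Module.finrank ℝ E₁) ⊕ Fin (Module.finrank ℝ E₂) → E₁ × E₂ :=
    Sum.elim (fun i => (Module.finBasis ℝ E₁ i, 0)) (fun j => (0, Module.finBasis ℝ E₂ j))
  let c : Fin (Module.finrank ℝ E₁) ⊕ Fin (Module.finrank ℝ E₂) → E₁ × E₂ :=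
    Sum.elim (fun i => (dualVec (g₁ y.1) i, 0)) (fun j => (f y.1 ^ 2)⁻¹ • (0, dualVec (g₂ y.2) j))
  have hac : ∀ V, ∑ i, warp g₁ g₂ f y V (a i) • c i = V := fun V => by
    conv_rhs => rw [← Prod.mk.eta (p := V), ← (W.fst.inner _ hy.1).sum_apply_smul_dualVec V.1,
      ← (W.snd.inner _ hy.2).sum_apply_smul_dualVec V.2]
    rw [Fintype.sum_sum_type]
    refine Prod.ext ?_ ?_ <;>
      simp [a, c, warp_apply, Prod.fst_sum, Prod.snd_sum, smul_smul, mul_right_comm, hf]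
  rw [(W.isInner hy).trace_eq_sum hac hT, Fintype.sum_sum_type]
  simp only [a, c, Sum.elim_inl, Sum.elim_inr, hT.smul_right, ← Finset.smul_sum]
  rfl

theorem traceCurv_warp (X : E₁) :
    traceCurv (warp g₁ g₂ f) y (X, 0)
      = (traceCurv g₁ y.1 X, 0) + ((Module.finrank ℝ E₂ : ℝ) / f y.1) •
          covDerivGrad (warp g₁ g₂ f) (fun z => f z.1) y (X, 0) := by
  have hf := (W.pos _ hy.1).ne'
  have bilinear : IsBilinearMap ℝ fun u v => curvatureL (warp g₁ g₂ f) y u (X, 0) v := by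
    constructor <;> intros <;> simp
  have horizontal : trace (g₁ y.1) (fun u v => (curvatureL g₁ y.1 u X v, (0 : E₂)))
      = (traceCurv g₁ y.1 X, 0) :=
    (map_trace (ContinuousLinearMap.inl ℝ E₁ E₂) _ _).symm
  have vertical : trace (g₂ y.2)
      (fun u v => ((f y.1 * g₂ y.2 u v) • covDerivGrad g₁ f y.1 X, (0 : E₂)))
      = ((Module.finrank ℝ E₂ : ℝ) * f y.1) • (covDerivGrad g₁ f y.1 X, 0) := by
    have factor := map_trace ((ContinuousLinearMap.id ℝ ℝ).smulRight
      (f y.1 • (covDerivGrad g₁ f y.1 X, (0 : E₂)))) (g₂ y.2) fun u v => g₂ y.2 u v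
    rw [(W.snd.inner _ hy.2).trace_self] at factor
    simpa [smul_smul, mul_comm] using factor.symm
  rw [traceCurv, W.trace_warp hy bilinear]
  simp only [W.curvatureL_warp_horizontal hy, W.curvatureL_warp_mixed hy]
  rw [horizontal, vertical, W.covDerivGrad_warp hy, smul_smul]
  congr 2
  field_simp

end IsWarpedOn

end WarpedProduct

/-! ### Curvature of Sasakian space forms -/

section CurvatureForm

variable {V : Type*} [AddCommGroup V] [Module ℝ V] {K : V → V → V → V → ℝ}
  (hK : IsCurvatureForm K)

include hK

namespace IsCurvatureForm

theorem linear_second (u w z : V) : IsLinearMap ℝ fun v => K u v w z where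
  map_add v v' := by
    rw [hK.skew_left, hK.skew_left u v, hK.skew_left u v', (hK.linear u w z).map_add, neg_add]
  map_smul r v := by
    rw [hK.skew_left, hK.skew_left u v, (hK.linear u w z).map_smul, smul_neg]

theorem linear_third (u v z : V) : IsLinearMap ℝ fun w => K u v w z where
  map_add w w' := by simp only [hK.pair u v, (hK.linear z u v).map_add]
  map_smul r w := by simp only [hK.pair u v, (hK.linear z u v).map_smul]

theorem linear_fourth (u v w : V) : IsLinearMap ℝ fun z => K u v w z where
  map_add z z' := by simp only [hK.pair u v, (hK.linear_second w u v).map_add]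
  map_smul r z := by simp only [hK.pair u v, (hK.linear_second w u v).map_smul]

theorem eq_zero_of_sectional (hsec : ∀ u v, K u v v u = 0) (u v w z : V) : K u v w z = 0 := by
  have polar_outer (u z v : V) : K u v v z = 0 := by
    have h := hsec (u + z) v
    have symm : K z v v u = K u v v z := by rw [hK.pair, hK.skew_left, hK.skew_right, neg_neg]
    rw [(hK.linear v v (u + z)).map_add, (hK.linear_fourth u v v).map_add,
      (hK.linear_fourth z v v).map_add, hsec, hsec, symm] at h
    linarith
  have polar_inner (u v w z : V) : K u v w z = -K u w v z := by
    have h := polar_outer u z (v + w)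
    rw [(hK.linear_second u (v + w) z).map_add, (hK.linear_third u v z).map_add,
      (hK.linear_third u w z).map_add, polar_outer, polar_outer] at h
    linarith
  linarith [hK.bianchi u v w z, polar_inner u v w z, hK.skew_left u w v z,
    polar_inner v w u z, hK.skew_left v u w z]

variable {J : V →ₗ[ℝ] V}

theorem polarize_holomorphic (hJ : ∀ u, K u (J u) (J u) u = 0) (u v : V) :
    K v (J v) (J u) u + K v (J u) (J v) u + K v (J u) (J u) v + K u (J v) (J v) u
      + K u (J v) (J u) v + K u (J u) (J v) v = 0 := by
  have add := hJ (u + v)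
  have sub := hJ (u - v)
  simp only [map_add, map_sub, (hK.linear _ _ _).map_add, (hK.linear_second _ _ _).map_add,
    (hK.linear_third _ _ _).map_add, (hK.linear_fourth _ _ _).map_add, (hK.linear _ _ _).map_sub,
    (hK.linear_second _ _ _).map_sub, (hK.linear_third _ _ _).map_sub,
    (hK.linear_fourth _ _ _).map_sub] at add sub
  linarith [hJ u, hJ v]

variable (hskew : ∀ u v w z, K u v (J w) z = -K u v w (J z))
  (hsq : ∀ u v w z, K u v w (J (J z)) = -K u v w z)

include hskew hsq

theorem apply_holomorphic (u v w z : V) : K (J u) (J v) w z = K u v w z := by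
  rw [hK.pair, hskew, hsq, neg_neg, hK.pair w]

/-- The polarization of the holomorphic sectional curvature, rewritten with the symmetries, is one
linear relation between the sectional curvatures of the planes `u, v` and `u, Jv`; replacing `v` by
`Jv` gives a second, independent one. -/
theorem eq_zero_of_holomorphic_sectional (hJ : ∀ u, K u (J u) (J u) u = 0) (u v w z : V) :
    K u v w z = 0 := by
  have inv := hK.apply_holomorphic hskew hsq
  have relation (u v : V) : 6 * K u (J v) (J v) u + 2 * K u v v u = 0 := by
    have turn (w z : V) : K v (J u) w z = -K (J v) u w z := by
      rw [← inv v, hK.pair, hsq, hK.pair w]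
    have holomorphic : K u (J u) (J v) v = K u v v u + K u (J v) (J v) u := by
      linarith [hK.bianchi u (J u) (J v) v, inv u v u v, hK.skew_right u v u v,
        hskew (J v) u u v, hK.skew_left u (J v) u (J v), hK.skew_right u (J v) u (J v)]
    have swap : K v (J v) (J u) u = K u (J u) (J v) v := by
      rw [hK.pair, hK.skew_left, hK.skew_right, neg_neg]
    linarith [hK.polarize_holomorphic hJ u v, turn (J v) u, turn (J u) v, hskew (J v) u u v,
      hskew u (J v) u v, hK.skew_left u (J v) (J v) u, hK.skew_left u (J v) u (J v),
      hK.skew_right u (J v) u (J v)]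
  refine hK.eq_zero_of_sectional (fun u v => ?_) u v w z
  have double : K u (J (J v)) (J (J v)) u = K u v v u := by
    rw [hK.skew_right, hsq, neg_neg, hK.pair, hsq, ← hK.skew_right]
  linarith [relation u v, relation u (J v)]

end IsCurvatureForm

end CurvatureForm

variable {E : Type*} [NormedAddCommGroup E] [NormedSpace ℝ E] [FiniteDimensional ℝ E]

/-- The almost contact metric structure `(φ, ξ, g(ξ, ·), g)` on `U` satisfies
`(∇_X φ)Y = g(X, Y)ξ - η(Y)X`. -/
structure IsSasakianOn (g : E → E →L[ℝ] E →L[ℝ] ℝ) (φ : E → E →L[ℝ] E) (ξ : E → E)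
    (U : Set E) : Prop where
  metric : IsMetricOn g U
  smooth_phi : ∀ x ∈ U, ContDiffAt ℝ ∞ φ x
  smooth_xi : ∀ x ∈ U, ContDiffAt ℝ ∞ ξ x
  phi_sq : ∀ x ∈ U, ∀ v, φ x (φ x v) = -v + g x (ξ x) v • ξ x
  eta_xi : ∀ x ∈ U, g x (ξ x) (ξ x) = 1
  eta_phi : ∀ x ∈ U, ∀ v, g x (ξ x) (φ x v) = 0
  compatible : ∀ x ∈ U, ∀ u v,
    g x (φ x u) (φ x v) = g x u v - g x (ξ x) u * g x (ξ x) v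
  nabla_phi : ∀ x ∈ U, ∀ u v,
    covDerivEndo g φ x u v = g x u v • ξ x - g x (ξ x) v • u

/-- At `x` the `φ`-sectional curvature is the constant `c`. The denominator is cleared, so that the
condition is void for `X = 0`. -/
def HasPhiSectionalCurvature (g : E → E →L[ℝ] E →L[ℝ] ℝ) (φ : E → E →L[ℝ] E) (ξ : E → E) (c : ℝ)
    (x : E) : Prop :=
  ∀ X, g x (ξ x) X = 0 → g x (curvatureL g x X (φ x X) (φ x X)) X = c * g x X X ^ 2

/-- The curvature form of the Hermitian form `b - η ⊗ η`, where `η = b(ξ, ·)`, and the skew form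
`b(·, φ ·)`, normalized so as to have holomorphic sectional curvature `4`; it is degenerate along
`ξ`. -/
def transverseHolomorphicForm (b : E →L[ℝ] E →L[ℝ] ℝ) (φ : E →L[ℝ] E) (ξ : E) (u v w z : E) : ℝ :=
  (b v w - b ξ v * b ξ w) * (b u z - b ξ u * b ξ z)
    - (b u w - b ξ u * b ξ w) * (b v z - b ξ v * b ξ z)
    + b v (φ w) * b u (φ z) - b u (φ w) * b v (φ z) - 2 * (b u (φ v) * b w (φ z))

/-- The curvature form of `g` minus the one of a Sasakian space form. In the Sasakian case it is
degenerate along `ξ` and of Kähler type for `φ`, so that it is determined by its holomorphic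
sectional curvature. -/
def curvatureExcess (g : E → E →L[ℝ] E →L[ℝ] ℝ) (φ : E → E →L[ℝ] E) (ξ : E → E) (c : ℝ) (x : E)
    (u v w z : E) : ℝ :=
  g x (curvatureL g x u v w) z
    - (g x v w * g x u z - g x u w * g x v z
      + (c - 1) / 4 * transverseHolomorphicForm (g x) (φ x) (ξ x) u v w z)

namespace IsSasakianOn

variable {g : E → E →L[ℝ] E →L[ℝ] ℝ} {φ : E → E →L[ℝ] E} {ξ : E → E} {U : Set E}
  (S : IsSasakianOn g φ ξ U) {x : E} (hx : x ∈ U)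

include S hx

theorem phi_xi : φ x (ξ x) = 0 := by
  by_contra h
  have hpos := (S.metric.inner x hx).pos _ h
  rw [S.compatible x hx, S.eta_xi x hx] at hpos
  norm_num at hpos

theorem phi_skew (u v : E) : g x (φ x u) v = -g x u (φ x v) := by
  have h := S.compatible x hx u (φ x v)
  rw [S.phi_sq x hx, S.eta_phi x hx, map_add, map_neg, map_smul,
    (S.metric.inner x hx).symm _ (ξ x), S.eta_phi x hx, smul_zero, mul_zero, add_zero,
    sub_zero] at h
  linarith

theorem covDeriv_phi {W : E → E} (hW : DifferentiableAt ℝ W x) (u : E) :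
    covDerivAlong g id (fun z => φ z (W z)) x u
      = φ x (covDerivAlong g id W x u) + g x u (W x) • ξ x - g x (ξ x) (W x) • u := by
  rw [add_sub_assoc, ← S.nabla_phi x hx u (W x)]
  simp only [covDerivEndo, christoffel_eq, covDerivAlong_eq, covDerivAlongL_apply,
    fderiv_apply_field (differentiableAt_of_smooth (S.smooth_phi x hx)) hW, map_add, fderiv_id,
    ContinuousLinearMap.id_apply, id]
  abel

theorem covDeriv_xi (u : E) : covDerivAlong g id ξ x u = -φ x u := by
  have hξ := differentiableAt_of_smooth (S.smooth_xi x hx)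
  have horizontal : g x (ξ x) (covDerivAlong g id ξ x u) = 0 := by
    have unit : (fun z => g (id z) (ξ z) (ξ z)) =ᶠ[nhds x] fun _ => 1 := by
      filter_upwards [S.metric.eventually_mem hx] with z hz
      exact S.eta_xi z hz
    have metric := fderiv_metric_along S.metric (ψ := id) differentiableAt_id hx hξ hξ u
    rw [unit.fderiv_eq, fderiv_fun_const, Pi.zero_apply, zero_apply] at metric
    simp only [id] at metric
    linarith [(S.metric.inner x hx).symm (covDerivAlong g id ξ x u) (ξ x)]
  have kernel : (fun z => φ z (ξ z)) =ᶠ[nhds x] fun _ => 0 := by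
    filter_upwards [S.metric.eventually_mem hx] with z hz
    exact S.phi_xi hz
  have parallel := S.covDeriv_phi hx hξ u
  rw [covDerivAlong_congr kernel, S.eta_xi x hx, covDerivAlong_eq, covDerivAlongL_apply,
    fderiv_fun_const, Pi.zero_apply, zero_apply, map_zero, add_zero, one_smul] at parallel
  have applied := congrArg (φ x) parallel
  rw [map_zero, map_sub, map_add, map_smul, S.phi_xi hx, S.phi_sq x hx, horizontal, zero_smul,
    smul_zero, add_zero, add_zero] at applied
  rw [← neg_eq_iff_eq_neg, ← sub_eq_zero, ← applied]

theorem fderiv_eta (u w : E) : fderiv ℝ (fun z => g z (ξ z) w) x u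
    = g x (ξ x) (christoffelL g x u w) - g x (φ x u) w := by
  have metric := fderiv_metric_along S.metric (ψ := id) differentiableAt_id hx
    (differentiableAt_of_smooth (S.smooth_xi x hx)) (differentiableAt_const w) u
  rw [S.covDeriv_xi hx] at metric
  simpa [covDerivAlong_eq, covDerivAlongL_apply, neg_add_eq_sub] using metric

theorem curvatureL_xi (u v : E) :
    curvatureL g x u v (ξ x) = g x (ξ x) v • u - g x (ξ x) u • v := by
  have second (u v : E) : covDerivAlong g id (fun z => covDerivAlong g id ξ z v) x u
      = -(φ x (christoffelL g x u v) + g x u v • ξ x - g x (ξ x) v • u) := by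
    have first : (fun z => covDerivAlong g id ξ z v) =ᶠ[nhds x] fun z => (-1 : ℝ) • φ z v := by
      filter_upwards [S.metric.eventually_mem hx] with z hz
      rw [S.covDeriv_xi hz, neg_one_smul]
    rw [covDerivAlong_congr first, covDerivAlong_const_smul,
      S.covDeriv_phi hx (differentiableAt_const v), neg_one_smul, covDerivAlong_eq,
      covDerivAlongL_apply]
    simp
  have comm := covDerivAlong_comm S.metric (ψ := id) contDiffAt_id hx (S.smooth_xi x hx) u v
  simp only [fderiv_id, ContinuousLinearMap.id_apply, id] at comm
  rw [← comm, second, second, S.metric.christoffelL_symm hx v u,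
    (S.metric.inner x hx).symm v u]
  abel

theorem covDeriv_covDeriv_phi (u v w : E) :
    covDerivAlong g id (fun z => covDerivAlong g id (fun z => φ z w) z v) x u
      = φ x (covDerivAlong g id (fun z => covDerivAlong g id (fun _ => w) z v) x u)
        + g x u (christoffelL g x v w) • ξ x - g x (ξ x) (christoffelL g x v w) • u
        + ((g x (christoffelL g x u v) w + g x v (christoffelL g x u w)) • ξ x
          - g x v w • φ x u)
        - ((g x (ξ x) (christoffelL g x u w) - g x (φ x u) w) • v
          + g x (ξ x) w • christoffelL g x u v) := by
  have const (z a b : E) : covDerivAlong g id (fun _ => b) z a = christoffelL g z a b := by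
    simp [covDerivAlong_eq, covDerivAlongL_apply]
  have first : (fun z => covDerivAlong g id (fun z => φ z w) z v) =ᶠ[nhds x] fun z =>
      φ z (christoffelL g z v w) + g z v w • ξ z - g z (ξ z) w • v := by
    filter_upwards [S.metric.eventually_mem hx] with z hz
    rw [S.covDeriv_phi hz (differentiableAt_const w), const]
  have hg := S.metric.smooth x hx
  have hΓ := contDiffAt_apply₂ (S.metric.contDiffAt_christoffelL hx) v w
  have hξ := differentiableAt_of_smooth (S.smooth_xi x hx)
  have hφΓ : DifferentiableAt ℝ (fun z => φ z (christoffelL g z v w)) x :=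
    differentiableAt_of_smooth ((S.smooth_phi x hx).clm_apply hΓ)
  have hgvw : DifferentiableAt ℝ (fun z => g z v w) x :=
    differentiableAt_of_smooth (contDiffAt_apply₂ hg v w)
  have hη : DifferentiableAt ℝ (fun z => g z (ξ z) w) x :=
    differentiableAt_of_smooth ((hg.clm_apply (S.smooth_xi x hx)).clm_apply contDiffAt_const)
  simp only [const]
  rw [covDerivAlong_congr first, covDerivAlong_sub (hφΓ.fun_add (hgvw.fun_smul hξ))
    (hη.fun_smul (differentiableAt_const v)), covDerivAlong_add hφΓ (hgvw.fun_smul hξ),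
    S.covDeriv_phi hx (differentiableAt_of_smooth hΓ), covDerivAlong_smul hgvw hξ,
    covDerivAlong_smul hη (differentiableAt_const v), S.covDeriv_xi hx, const, S.fderiv_eta hx,
    fderiv_apply_const₂ (differentiableAt_of_smooth hg), S.metric.fderiv_eq_christoffelL hx,
    smul_neg, ← sub_eq_add_neg]

theorem curvatureL_phi (u v w : E) :
    curvatureL g x u v (φ x w) = φ x (curvatureL g x u v w)
      - g x v w • φ x u + g x (φ x u) w • v + g x u w • φ x v - g x (φ x v) w • u := by
  have hφ : ContDiffAt ℝ ∞ (fun z => φ z w) x := (S.smooth_phi x hx).clm_apply contDiffAt_const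
  have comm_phi := covDerivAlong_comm S.metric (ψ := id) contDiffAt_id hx hφ u v
  have comm_const := covDerivAlong_comm S.metric (ψ := id) contDiffAt_id hx
    (contDiffAt_const (c := w)) u v
  simp only [fderiv_id, ContinuousLinearMap.id_apply, id] at comm_phi comm_const
  rw [← comm_phi, ← comm_const, S.covDeriv_covDeriv_phi hx, S.covDeriv_covDeriv_phi hx,
    S.metric.christoffelL_symm hx v u, map_sub]
  module

theorem apply_phi_right (u v : E) : g x u (φ x v) = -g x v (φ x u) := by
  rw [(S.metric.inner x hx).symm, S.phi_skew hx]

theorem apply_phi_phi (u v : E) :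
    g x u (φ x (φ x v)) = -(g x u v - g x (ξ x) u * g x (ξ x) v) := by
  rw [← S.compatible x hx, S.phi_skew hx, neg_neg]

theorem apply_xi_right (u : E) : g x u (ξ x) = g x (ξ x) u :=
  (S.metric.inner x hx).symm u (ξ x)

theorem isCurvatureForm_excess (c : ℝ) :
    IsCurvatureForm (curvatureExcess g φ ξ c x) where
  linear v w z := by
    constructor <;> intros <;> simp only [curvatureExcess, transverseHolomorphicForm,
      map_add, map_smul, add_apply, smul_apply, smul_eq_mul] <;> ring
  skew_left u v w z := by
    simp only [curvatureExcess, transverseHolomorphicForm]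
    rw [(S.metric.isCurvatureForm hx).skew_left, S.apply_phi_right hx v u]
    ring
  skew_right u v w z := by
    simp only [curvatureExcess, transverseHolomorphicForm]
    rw [(S.metric.isCurvatureForm hx).skew_right, S.apply_phi_right hx z w]
    ring
  bianchi u v w z := by
    have i := S.metric.inner x hx
    have bianchi := (S.metric.isCurvatureForm hx).bianchi u v w z
    simp only [curvatureExcess, transverseHolomorphicForm]
    rw [i.symm w v, i.symm w u, i.symm v u, S.apply_phi_right hx w v, S.apply_phi_right hx w u,
      S.apply_phi_right hx v u]
    linear_combination bianchi

theorem curvatureExcess_phi (c : ℝ) (u v w z : E) :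
    curvatureExcess g φ ξ c x u v (φ x w) z = -curvatureExcess g φ ξ c x u v w (φ x z) := by
  simp only [curvatureExcess, transverseHolomorphicForm, S.curvatureL_phi hx, map_add, map_sub,
    map_smul, add_apply, sub_apply, smul_apply, smul_eq_mul, S.phi_skew hx, S.eta_phi x hx,
    S.apply_phi_phi hx]
  ring

theorem curvatureExcess_xi (c : ℝ) (u v w : E) : curvatureExcess g φ ξ c x u v w (ξ x) = 0 := by
  have curvature_xi : g x (curvatureL g x u v w) (ξ x)
      = -(g x (ξ x) v * g x u w - g x (ξ x) u * g x v w) := by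
    rw [S.metric.curvatureL_skew hx, S.curvatureL_xi hx]
    simp
  rw [curvatureExcess, transverseHolomorphicForm, curvature_xi]
  simp only [S.phi_xi hx, S.eta_xi x hx, S.apply_xi_right hx, map_zero]
  ring

theorem curvatureExcess_phi_phi (c : ℝ) (u v w z : E) :
    curvatureExcess g φ ξ c x u v w (φ x (φ x z)) = -curvatureExcess g φ ξ c x u v w z := by
  have linear := (S.isCurvatureForm_excess hx c).linear_fourth u v w
  rw [S.phi_sq x hx, linear.map_add, linear.map_neg, linear.map_smul, S.curvatureExcess_xi hx,
    smul_zero, add_zero]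

theorem curvatureExcess_holomorphic {c : ℝ} (hc : HasPhiSectionalCurvature g φ ξ c x) (u : E) :
    curvatureExcess g φ ξ c x u (φ x u) (φ x u) u = 0 := by
  have excess := S.isCurvatureForm_excess hx c
  have horizontal (X : E) (hX : g x (ξ x) X = 0) :
      curvatureExcess g φ ξ c x X (φ x X) (φ x X) X = 0 := by
    simp only [curvatureExcess, transverseHolomorphicForm, hc X hX, S.phi_skew hx,
      S.apply_phi_phi hx, S.eta_phi x hx, hX]
    have self : g x X (φ x X) = 0 := by linarith [S.apply_phi_right hx X X]
    rw [self]
    ring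
  have eta : g x (ξ x) (u - g x (ξ x) u • ξ x) = 0 := by simp [S.eta_xi x hx]
  have phi : φ x (u - g x (ξ x) u • ξ x) = φ x u := by simp [S.phi_xi hx]
  have key := horizontal _ eta
  rwa [phi, (excess.linear_fourth _ _ _).map_sub, (excess.linear_fourth _ _ _).map_smul,
    S.curvatureExcess_xi hx, smul_zero, sub_zero, excess.pair, excess.skew_left,
    excess.skew_right, neg_neg, (excess.linear_fourth _ _ _).map_sub,
    (excess.linear_fourth _ _ _).map_smul, S.curvatureExcess_xi hx, smul_zero, sub_zero] at key

theorem apply_curvatureL {c : ℝ} (hc : HasPhiSectionalCurvature g φ ξ c x) (u v w z : E) :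
    g x (curvatureL g x u v w) z
      = g x v w * g x u z - g x u w * g x v z
        + (c - 1) / 4 * transverseHolomorphicForm (g x) (φ x) (ξ x) u v w z := by
  have vanishes := (S.isCurvatureForm_excess hx c).eq_zero_of_holomorphic_sectional
    (J := (φ x : E →ₗ[ℝ] E)) (S.curvatureExcess_phi hx c) (S.curvatureExcess_phi_phi hx c)
    (S.curvatureExcess_holomorphic hx hc) u v w z
  rw [curvatureExcess] at vanishes
  linarith

theorem trace_apply_phi : trace (g x) (fun u v => g x u (φ x v)) = 0 := by
  have bilinear : IsBilinearMap ℝ fun u v => g x u (φ x v) := by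
    constructor <;> intros <;> simp
  have skew : trace (g x) (fun u v => g x v (φ x u))
      = -trace (g x) fun u v => g x u (φ x v) := by
    rw [← neg_one_smul ℝ (trace _ _), ← trace_smul]
    congr 1
    funext u v
    rw [(S.metric.inner x hx).symm, S.phi_skew hx, neg_one_smul]
  linarith [(S.metric.inner x hx).trace_comm bilinear]

theorem traceCurv_eq {c : ℝ} (hc : HasPhiSectionalCurvature g φ ξ c x) {X : E}
    (hX : g x (ξ x) X = 0) :
    traceCurv g x X = -((Module.finrank ℝ E - 1 : ℝ)
      + (c - 1) / 4 * (Module.finrank ℝ E + 1)) • X := by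
  have i := S.metric.inner x hx
  refine i.ext fun W => ?_
  have expand : (fun u v => g x (curvatureL g x u X v) W) = fun u v =>
      (-(1 + (c - 1) / 4) * g x X W) • g x u v
        + (1 + (c - 1) / 4) • (g x W u * g x X v)
        - ((c - 1) / 4 * g x (ξ x) W) • (g x (ξ x) u * g x X v)
        + ((c - 1) / 4 * g x X W) • (g x (ξ x) u * g x (ξ x) v)
        - ((c - 1) / 4) • (g x (φ x W) u * g x (φ x X) v)
        - ((c - 1) / 4 * g x X (φ x W)) • g x u (φ x v)
        - ((c - 1) / 2) • (g x (φ x X) u * g x (φ x W) v) := by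
    funext u v
    rw [S.apply_curvatureL hx hc, transverseHolomorphicForm, hX, i.symm u W,
      i.symm u (φ x W), i.symm v (φ x W), i.symm u (φ x X), S.apply_phi_right hx X v,
      i.symm v (φ x X)]
    simp only [smul_eq_mul]
    ring
  rw [traceCurv, apply_trace, expand]
  simp only [trace_add, trace_sub, trace_smul, i.trace_mul, i.trace_self, S.trace_apply_phi hx,
    S.compatible x hx]
  simp only [hX, i.symm W X, S.eta_xi x hx, S.apply_xi_right hx X, map_smul, smul_apply,
    smul_eq_mul]
  ring

end IsSasakianOn

section Locality

open Filter Topology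

variable {E : Type*} [NormedAddCommGroup E] [NormedSpace ℝ E] [FiniteDimensional ℝ E]
  {g g' : E → E →L[ℝ] E →L[ℝ] ℝ} {y : E}

omit [FiniteDimensional ℝ E] in
theorem IsMetricOn.congr {U : Set E} (hg : IsMetricOn g U) (h : Set.EqOn g' g U) :
    IsMetricOn g' U where
  isOpen := hg.isOpen
  smooth x hx := (hg.smooth x hx).congr_of_eventuallyEq
    (eventuallyEq_of_mem (hg.isOpen.mem_nhds hx) h)
  inner x hx := by
    rw [h hx]
    exact hg.inner x hx

theorem christoffelL_congr (h : g =ᶠ[𝓝 y] g') : christoffelL g =ᶠ[𝓝 y] christoffelL g' := by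
  filter_upwards [h, h.fderiv (𝕜 := ℝ)] with z hz hz'
  ext u v
  simp only [← christoffel_eq, christoffel, hz, hz']

theorem curvatureL_congr (h : g =ᶠ[𝓝 y] g') : curvatureL g y = curvatureL g' y := by
  ext u v w
  simp only [curvatureL_apply, (christoffelL_congr h).fderiv_eq, (christoffelL_congr h).eq_of_nhds]

theorem traceCurv_congr (h : g =ᶠ[𝓝 y] g') (ν : E) : traceCurv g y ν = traceCurv g' y ν := by
  simp only [traceCurv, curvatureL_congr h, h.eq_of_nhds]

theorem covDerivGrad_congr (h : g =ᶠ[𝓝 y] g') (a : E → ℝ) (u : E) :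
    covDerivGrad g a y u = covDerivGrad g' a y u := by
  have hgrad : grad g a =ᶠ[𝓝 y] grad g' a := h.mono fun z hz => by simp only [grad, hz]
  simp only [covDerivGrad, hgrad.fderiv_eq, hgrad.eq_of_nhds, christoffel_eq,
    (christoffelL_congr h).eq_of_nhds]

end Locality

section WarpedHypersurface

variable {E : Type*} [NormedAddCommGroup E] [NormedSpace ℝ E] [FiniteDimensional ℝ E]
  {E₁ : Type*} [NormedAddCommGroup E₁] [NormedSpace ℝ E₁] [FiniteDimensional ℝ E₁]
  {E₂ : Type*} [NormedAddCommGroup E₂] [NormedSpace ℝ E₂] [FiniteDimensional ℝ E₂]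
  {g : E → E →L[ℝ] E →L[ℝ] ℝ} {h : E₁ × E₂ → E₁ × E₂ →L[ℝ] E₁ × E₂ →L[ℝ] ℝ}
  {ψ : E → E₁ × E₂} {U : Set E} {U₁ : Set E₁} {U₂ : Set E₂}
  {g₁ : E₁ → E₁ →L[ℝ] E₁ →L[ℝ] ℝ} {g₂ : E₂ → E₂ →L[ℝ] E₂ →L[ℝ] ℝ} {f : E₁ → ℝ}
  {φ : E₁ → E₁ →L[ℝ] E₁} {ξ : E₁ → E₁} {c : ℝ}

theorem IsWarpedOn.traceCurv_warp_of_isSasakianOn (W : IsWarpedOn g₁ g₂ f U₁ U₂)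
    (K : IsSasakianOn g₁ φ ξ U₁) {y : E₁ × E₂} (hy : y ∈ U₁ ×ˢ U₂)
    (hc : HasPhiSectionalCurvature g₁ φ ξ c y.1) {X : E₁} (hX : g₁ y.1 (ξ y.1) X = 0) :
    traceCurv (warp g₁ g₂ f) y (X, 0)
      = ((Module.finrank ℝ E₂ : ℝ) / f y.1) •
          covDerivGrad (warp g₁ g₂ f) (fun z => f z.1) y (X, 0)
        - ((Module.finrank ℝ E₁ - 1 : ℝ) + (c - 1) / 4 * (Module.finrank ℝ E₁ + 1)) • (X, 0) := by
  rw [W.traceCurv_warp hy, K.traceCurv_eq hy.1 hc hX, sub_eq_neg_add (_ • _), ← neg_smul,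
    Prod.smul_mk _ X, smul_zero]

namespace IsIsometricOn

variable (S : IsIsometricOn g h ψ U (U₁ ×ˢ U₂)) (W : IsWarpedOn g₁ g₂ f U₁ U₂)
  (K : IsSasakianOn g₁ φ ξ U₁) (hh : Set.EqOn h (warp g₁ g₂ f) (U₁ ×ˢ U₂)) {x : E} (hx : x ∈ U)
  (hdim : Module.finrank ℝ E₁ + Module.finrank ℝ E₂ = Module.finrank ℝ E + 1)
  (hc : HasPhiSectionalCurvature g₁ φ ξ c (ψ x).1) {w : E} (hw : fderiv ℝ ψ x w = (ξ (ψ x).1, 0))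

include S W K hh hx hdim hc hw

theorem traceCurvAlong_of_warp {ν : E₁ × E₂} (hν : ∀ u, h (ψ x) ν (fderiv ℝ ψ x u) = 0)
    (hν₂ : ν.2 = 0) :
    traceCurvAlong g h ψ x ν
      = ((Module.finrank ℝ E₂ : ℝ) / f (ψ x).1) • covDerivGrad h (fun z => f z.1) (ψ x) ν
        - ((Module.finrank ℝ E₁ - 1 : ℝ) + (c - 1) / 4 * (Module.finrank ℝ E₁ + 1)) • ν := by
  have hy := S.mapsTo x hx
  obtain ⟨X, _⟩ := ν
  obtain rfl : _ = 0 := hν₂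
  have hX : g₁ (ψ x).1 (ξ (ψ x).1) X = 0 := by
    have h0 := hν w
    rw [hw, hh hy, warp_apply, map_zero, mul_zero, add_zero] at h0
    rw [(W.fst.inner _ hy.1).symm, h0]
  have e : h =ᶠ[nhds (ψ x)] warp g₁ g₂ f := hh.eventuallyEq_of_mem (S.target.isOpen.mem_nhds hy)
  rw [S.traceCurvAlong_eq_traceCurv hx (by rw [Module.finrank_prod, hdim]) hν, traceCurv_congr e,
    covDerivGrad_congr e, W.traceCurv_warp_of_isSasakianOn K hy hc hX]

theorem bitension_eq_zero_iff_of_warp (hH : (meanCurv g h ψ x).2 = 0) :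
    bitension g h ψ x = 0 ↔
      normalLaplacian g h ψ (meanCurv g h ψ) x
          = traceSffShape g h ψ x (meanCurv g h ψ x)
            - ((Module.finrank ℝ E₁ - 1 : ℝ) + (c - 1) / 4 * (Module.finrank ℝ E₁ + 1)) •
              meanCurv g h ψ x
            + ((Module.finrank ℝ E₂ : ℝ) / f (ψ x).1) • norPart g h ψ x
              (covDerivGrad h (fun z => f z.1) (ψ x) (meanCurv g h ψ x)) ∧
        (-2 : ℝ) • traceShapeNormalDeriv g h ψ (meanCurv g h ψ) x
            - ((Module.finrank ℝ E : ℝ) / 2) • gradNormSq g h ψ (meanCurv g h ψ) x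
            - (2 * (Module.finrank ℝ E₂ : ℝ) / f (ψ x).1) • tanPart g h ψ x
              (covDerivGrad h (fun z => f z.1) (ψ x) (meanCurv g h ψ x)) = 0 := by
  have hH' := S.isNormalOn_meanCurv.normal x hx
  rw [S.bitension_eq_zero_iff hx, S.traceCurvAlong_of_warp W K hh hx hdim hc hw hH' hH]
  simp only [norPart_eq, tanPart_eq, map_sub, map_smul, S.norPartL_of_normal hx hH',
    S.tanPartL_of_normal hx hH', smul_zero, sub_zero, smul_smul, mul_div_assoc, sub_add_eq_add_sub,
    add_sub_assoc]

end IsIsometricOn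

end WarpedHypersurface

end Coord

namespace RiemGeom

/-! ### Reading tensors in charts -/

section Charts

variable {E : Type*} [NormedAddCommGroup E] [NormedSpace ℝ E]
  {H : Type*} [TopologicalSpace H] {I : ModelWithCorners ℝ E H}
  {M : Type*} [TopologicalSpace M] [ChartedSpace H M]

theorem contMDiffAt_tangentMap [IsManifold I ∞ M]
    {E' : Type*} [NormedAddCommGroup E'] [NormedSpace ℝ E']
    {H' : Type*} [TopologicalSpace H'] {I' : ModelWithCorners ℝ E' H'}
    {N : Type*} [TopologicalSpace N] [ChartedSpace H' N] [IsManifold I' ∞ N]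
    {ψ : M → N} {s : Set M} (hs : IsOpen s) (hψ : ContMDiffOn I I' ∞ ψ s)
    {v : TangentBundle I M} (hv : v.proj ∈ s) :
    ContMDiffAt I.tangent I'.tangent ∞ (tangentMap I I' ψ) v := by
  have ho := hs.preimage (FiberBundle.continuous_proj E (TangentSpace I : M → Type _))
  refine ((hψ.contMDiffOn_tangentMapWithin (m := ∞) (by simp) hs.uniqueMDiffOn).contMDiffAt
    (ho.mem_nhds hv)).congr_of_eventuallyEq ?_
  filter_upwards [ho.mem_nhds hv] with w hw
  rw [tangentMap, tangentMapWithin, mfderivWithin_of_isOpen hs hw]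

theorem bilinField_congr (b : BilinField I M) {p q : M} (h : p = q) (u v : E) :
    (b p : E →L[ℝ] E →L[ℝ] ℝ) u v = (b q : E →L[ℝ] E →L[ℝ] ℝ) u v := by
  rw [h]

theorem inChartBilin_apply (b : BilinField I M) (p : M) (y u v : E) :
    inChartBilin b p y u v
      = b ((extChartAt I p).symm y) (chartInvDeriv I p y u) (chartInvDeriv I p y v) := rfl

theorem inChartEndo_apply (T : EndoField I M) (p : M) (y u : E) :
    inChartEndo T p y u
      = chartDeriv I p y (T ((extChartAt I p).symm y) (chartInvDeriv I p y u)) := rfl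

variable [I.Boundaryless]

theorem chartInvDeriv_eq (p : M) (y : E) :
    chartInvDeriv I p y = mfderivWithin 𝓘(ℝ, E) I (extChartAt I p).symm (Set.range I) y := by
  rw [I.range_eq_univ, mfderivWithin_univ]
  rfl

variable [IsManifold I ∞ M]

theorem chartDeriv_chartInvDeriv {p : M} {y : E} (hy : y ∈ (extChartAt I p).target) (v : E) :
    chartDeriv I p y (chartInvDeriv I p y v) = v := by
  have h := mfderiv_extChartAt_comp_mfderivWithin_extChartAt_symm (I := I) hy
  rw [← chartInvDeriv_eq] at h
  exact congrArg (fun L : E →L[ℝ] E => L v) h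

theorem chartInvDeriv_chartDeriv {p : M} {y : E} (hy : y ∈ (extChartAt I p).target)
    (v : TangentSpace I ((extChartAt I p).symm y)) :
    chartInvDeriv I p y (chartDeriv I p y v) = v := by
  have h := mfderivWithin_extChartAt_symm_comp_mfderiv_extChartAt (I := I) hy
  rw [← chartInvDeriv_eq] at h
  exact congrArg (fun L : E →L[ℝ] E => L v) h

theorem chartInvDeriv_ne_zero {p : M} {y : E} (hy : y ∈ (extChartAt I p).target) {u : E}
    (hu : u ≠ 0) : chartInvDeriv I p y u ≠ 0 := fun h => hu <| by
  rw [← chartDeriv_chartInvDeriv (I := I) hy u, h, map_zero]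

theorem chartInvDeriv_self (p : M) :
    (chartInvDeriv I p (extChartAt I p p) : E →L[ℝ] E) = .id ℝ E :=
  (chartInvDeriv_eq p _).trans mfderivWithin_range_extChartAt_symm

theorem chartDeriv_self (p : M) :
    (chartDeriv I p (extChartAt I p p) : E →L[ℝ] E) = .id ℝ E := by
  ext v
  have h := chartDeriv_chartInvDeriv (I := I) (mem_extChartAt_target p) v
  rwa [show chartInvDeriv I p (extChartAt I p p) v = v from
    congrArg (fun L : E →L[ℝ] E => L v) (chartInvDeriv_self p)] at h

theorem inChartBilin_self (b : BilinField I M) (p : M) :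
    inChartBilin b p (extChartAt I p p) = (b p : E →L[ℝ] E →L[ℝ] ℝ) := by
  ext u v
  exact (congrArg (fun L : E →L[ℝ] E =>
    (b ((extChartAt I p).symm (extChartAt I p p)) : E →L[ℝ] E →L[ℝ] ℝ) (L u) (L v))
    (chartInvDeriv_self p)).trans (bilinField_congr b (extChartAt_to_inv p) u v)

theorem inChartVec_self (X : ∀ x : M, TangentSpace I x) (p : M) :
    inChartVec X p (extChartAt I p p) = (X p : E) :=
  (congrArg (fun L : E →L[ℝ] E => L (X ((extChartAt I p).symm (extChartAt I p p))))
    (chartDeriv_self p)).trans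
    (congrArg (fun q => (X q : E)) (extChartAt_to_inv (I := I) p))

theorem inChartEndo_self (T : EndoField I M) (p : M) :
    inChartEndo T p (extChartAt I p p) = (T p : E →L[ℝ] E) := by
  ext u
  exact ((congrArg₂ (fun L L' : E →L[ℝ] E =>
    L ((T ((extChartAt I p).symm (extChartAt I p p)) : E →L[ℝ] E) (L' u)))
    (chartDeriv_self p) (chartInvDeriv_self p))).trans
    (congrArg (fun q => (T q : E →L[ℝ] E) u) (extChartAt_to_inv (I := I) p))

theorem contMDiffAt_symm {p : M} {y : E} (hy : y ∈ (extChartAt I p).target) :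
    ContMDiffAt 𝓘(ℝ, E) I ∞ (extChartAt I p).symm y :=
  (contMDiffOn_extChartAt_symm p).contMDiffAt ((isOpen_extChartAt_target p).mem_nhds hy)

theorem contMDiffAt_chartInvDeriv {p : M} {y : E} (hy : y ∈ (extChartAt I p).target) (v : E) :
    ContMDiffAt 𝓘(ℝ, E) I.tangent ∞ (fun z => (⟨(extChartAt I p).symm z, chartInvDeriv I p z v⟩ :
      TangentBundle I M)) y :=
  (contMDiffAt_tangentMap (v := ⟨y, v⟩) (isOpen_extChartAt_target p)
    (contMDiffOn_extChartAt_symm p) hy).comp y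
    (contMDiffAt_vectorSpace_iff_contDiffAt.2 contDiffAt_const)

omit [I.Boundaryless] in
theorem contDiffAt_chartDeriv {p : M} {y : E} (hy : y ∈ (extChartAt I p).target)
    {X : ∀ z : E, TangentSpace I ((extChartAt I p).symm z)}
    (hX : ContMDiffAt 𝓘(ℝ, E) I.tangent ∞ (fun z => (⟨(extChartAt I p).symm z, X z⟩ :
      TangentBundle I M)) y) :
    ContDiffAt ℝ ∞ (fun z => (chartDeriv I p z (X z) : E)) y := by
  have hsource : (extChartAt I p).symm y ∈ (chartAt H p).source := by
    rw [← extChartAt_source (I := I)]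
    exact (extChartAt I p).map_target hy
  have htangent := (contMDiffAt_tangentMap (v := ⟨(extChartAt I p).symm y, X y⟩)
    (chartAt H p).open_source (contMDiffOn_extChartAt (I := I) (x := p)) hsource).comp y hX
  exact ((contMDiff_snd_tangentBundle_modelSpace (n := ∞) E 𝓘(ℝ, E)).contMDiffAt.comp y
    htangent).contDiffAt

theorem contDiffAt_inChartVec {X : ∀ x : M, TangentSpace I x}
    (hX : ContMDiff I I.tangent ∞ (fun x => (⟨x, X x⟩ : TangentBundle I M)))
    {p : M} {y : E} (hy : y ∈ (extChartAt I p).target) :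
    ContDiffAt ℝ ∞ (inChartVec X p) y :=
  contDiffAt_chartDeriv hy (hX.contMDiffAt.comp y (contMDiffAt_symm hy))

variable [FiniteDimensional ℝ E]

theorem contDiffAt_inChartBilin {b : BilinField I M}
    (hb : ContMDiff I (I.prod 𝓘(ℝ, E →L[ℝ] E →L[ℝ] ℝ)) ∞
      (fun x => Bundle.TotalSpace.mk' (E →L[ℝ] E →L[ℝ] ℝ)
        (E := fun x : M => TangentSpace I x →L[ℝ] TangentSpace I x →L[ℝ] ℝ) x (b x)))
    {p : M} {y : E} (hy : y ∈ (extChartAt I p).target) :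
    ContDiffAt ℝ ∞ (inChartBilin b p) y := by
  refine Coord.contDiffAt_clm₂_of_apply fun u v => ?_
  have h : ContMDiffAt 𝓘(ℝ, E) (I.prod 𝓘(ℝ)) ∞
      (fun z => Bundle.TotalSpace.mk' ℝ (E := Bundle.Trivial M ℝ) ((extChartAt I p).symm z)
        (b ((extChartAt I p).symm z) (chartInvDeriv I p z u) (chartInvDeriv I p z v))) y :=
    ContMDiffAt.clm_bundle_apply₂ (F₁ := E) (F₂ := E)
      (hb.contMDiffAt.comp y (contMDiffAt_symm hy))
      (contMDiffAt_chartInvDeriv hy u) (contMDiffAt_chartInvDeriv hy v)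
  exact (Bundle.contMDiffAt_totalSpace.1 h).2.contDiffAt

theorem contDiffAt_inChartEndo {T : EndoField I M}
    (hT : ContMDiff I (I.prod 𝓘(ℝ, E →L[ℝ] E)) ∞
      (fun x => Bundle.TotalSpace.mk' (E →L[ℝ] E)
        (E := fun x : M => TangentSpace I x →L[ℝ] TangentSpace I x) x (T x)))
    {p : M} {y : E} (hy : y ∈ (extChartAt I p).target) :
    ContDiffAt ℝ ∞ (inChartEndo T p) y :=
  Coord.contDiffAt_clm_of_apply fun u => contDiffAt_chartDeriv hy <|
    ContMDiffAt.clm_bundle_apply (hT.contMDiffAt.comp y (contMDiffAt_symm hy))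
      (contMDiffAt_chartInvDeriv hy u)

theorem isMetricOn_inChartBilin {b : BilinField I M}
    (hb : ContMDiff I (I.prod 𝓘(ℝ, E →L[ℝ] E →L[ℝ] ℝ)) ∞
      (fun x => Bundle.TotalSpace.mk' (E →L[ℝ] E →L[ℝ] ℝ)
        (E := fun x : M => TangentSpace I x →L[ℝ] TangentSpace I x →L[ℝ] ℝ) x (b x)))
    (hsymm : ∀ x u v, b x u v = b x v u) (hpos : ∀ x u, u ≠ 0 → 0 < b x u u) (p : M) :
    Coord.IsMetricOn (inChartBilin b p) (extChartAt I p).target where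
  isOpen := isOpen_extChartAt_target p
  smooth _ hy := contDiffAt_inChartBilin hb hy
  inner _ hy := ⟨fun _ _ => hsymm _ _ _, fun _ hu => hpos _ _ (chartInvDeriv_ne_zero hy hu)⟩

theorem sectionalCurvature_eq (g : BilinField I M) (p : M) (u v : E) :
    sectionalCurvature g p u v
      = inChartBilin g p (extChartAt I p p)
          (Coord.curvature (inChartBilin g p) (extChartAt I p p) u v v) u
        / (inChartBilin g p (extChartAt I p p) u u * inChartBilin g p (extChartAt I p p) v v
          - inChartBilin g p (extChartAt I p p) u v ^ 2) := by
  rw [inChartBilin_self]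
  rfl

end Charts

section Maps

variable {E : Type*} [NormedAddCommGroup E] [NormedSpace ℝ E]
  {H : Type*} [TopologicalSpace H] {I : ModelWithCorners ℝ E H}
  {M : Type*} [TopologicalSpace M] [ChartedSpace H M]
  {E' : Type*} [NormedAddCommGroup E'] [NormedSpace ℝ E']
  {H' : Type*} [TopologicalSpace H'] {I' : ModelWithCorners ℝ E' H'}
  {N : Type*} [TopologicalSpace N] [ChartedSpace H' N]

/-- The domain of the coordinate expression of `ψ` in the charts at `p` and at `ψ p`. -/
def chartDomain (I : ModelWithCorners ℝ E H) (I' : ModelWithCorners ℝ E' H') (ψ : M → N) (p : M) :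
    Set E :=
  (extChartAt I p).target ∩ (extChartAt I p).symm ⁻¹' (ψ ⁻¹' (extChartAt I' (ψ p)).source)

theorem mem_chartDomain (ψ : M → N) (p : M) : extChartAt I p p ∈ chartDomain I I' ψ p := by
  refine ⟨mem_extChartAt_target p, ?_⟩
  simp only [Set.mem_preimage, extChartAt_to_inv]
  exact mem_extChartAt_source (ψ p)

variable [I.Boundaryless]

theorem isOpen_chartDomain {ψ : M → N} (hψ : Continuous ψ) (p : M) :
    IsOpen (chartDomain I I' ψ p) :=
  (continuousOn_extChartAt_symm p).isOpen_inter_preimage (isOpen_extChartAt_target p)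
    ((isOpen_extChartAt_source (ψ p)).preimage hψ)

theorem fderiv_writtenInExtChartAt_self {ψ : M → N} {p : M} (hψ : MDifferentiableAt I I' ψ p) :
    fderiv ℝ (writtenInExtChartAt I I' p ψ) (extChartAt I p p)
      = (mfderiv I I' ψ p : E →L[ℝ] E') := by
  rw [← fderivWithin_univ, ← I.range_eq_univ]
  exact hψ.mfderiv.symm

variable [IsManifold I ∞ M] [IsManifold I' ∞ N]

theorem contDiffAt_writtenInExtChartAt {ψ : M → N} (hψ : ContMDiff I I' ∞ ψ) {p : M} {x : E}
    (hx : x ∈ chartDomain I I' ψ p) : ContDiffAt ℝ ∞ (writtenInExtChartAt I I' p ψ) x :=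
  ((contMDiffAt_extChartAt' (by rw [← extChartAt_source (I := I')]; exact hx.2)).comp x
    (hψ.contMDiffAt.comp x (contMDiffAt_symm hx.1))).contDiffAt

variable [I'.Boundaryless]

theorem mfderiv_chartInvDeriv {ψ : M → N} {Ψ : E → E'} {p : M} {q : N} {x : E}
    (hx : x ∈ (extChartAt I p).target) (hΨx : Ψ x ∈ (extChartAt I' q).target)
    (hψ : MDifferentiableAt I I' ψ ((extChartAt I p).symm x)) (hΨ : DifferentiableAt ℝ Ψ x)
    (h : ψ ∘ (extChartAt I p).symm =ᶠ[nhds x] (extChartAt I' q).symm ∘ Ψ) (u : E) :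
    (mfderiv I I' ψ ((extChartAt I p).symm x) (chartInvDeriv I p x u) : E')
      = chartInvDeriv I' q (Ψ x) (fderiv ℝ Ψ x u) := by
  have chain := mfderiv_comp x hψ ((contMDiffAt_symm hx).mdifferentiableAt (by simp))
  have chain' := mfderiv_comp x ((contMDiffAt_symm hΨx).mdifferentiableAt (by simp))
    hΨ.mdifferentiableAt
  rw [mfderiv_eq_fderiv] at chain'
  exact congrArg (fun L : E →L[ℝ] E' => L u) ((chain.symm.trans h.mfderiv_eq).trans chain')

theorem apply_mfderiv_chartInvDeriv (b : BilinField I' N) {ψ : M → N} {Ψ : E → E'} {p : M} {q : N}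
    {x : E} (hx : x ∈ (extChartAt I p).target) (hΨx : Ψ x ∈ (extChartAt I' q).target)
    (hψ : MDifferentiableAt I I' ψ ((extChartAt I p).symm x)) (hΨ : DifferentiableAt ℝ Ψ x)
    (h : ψ ∘ (extChartAt I p).symm =ᶠ[nhds x] (extChartAt I' q).symm ∘ Ψ) (u v : E) :
    b (ψ ((extChartAt I p).symm x))
        (mfderiv I I' ψ ((extChartAt I p).symm x) (chartInvDeriv I p x u))
        (mfderiv I I' ψ ((extChartAt I p).symm x) (chartInvDeriv I p x v))
      = inChartBilin b q (Ψ x) (fderiv ℝ Ψ x u) (fderiv ℝ Ψ x v) :=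
  (bilinField_congr b h.eq_of_nhds _ _).trans <| congrArg₂
    (fun a c : E' => (b ((extChartAt I' q).symm (Ψ x)) : E' →L[ℝ] E' →L[ℝ] ℝ) a c)
    (mfderiv_chartInvDeriv hx hΨx hψ hΨ h u) (mfderiv_chartInvDeriv hx hΨx hψ hΨ h v)

theorem isIsometricOn_writtenInExtChartAt {g : BilinField I M} {h : BilinField I' N} {ψ : M → N}
    (hψ : ContMDiff I I' ∞ ψ) (hiso : IsIsometric g h ψ) (p : M)
    (hg : Coord.IsMetricOn (inChartBilin g p) (extChartAt I p).target)
    (hh : Coord.IsMetricOn (inChartBilin h (ψ p)) (extChartAt I' (ψ p)).target) :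
    Coord.IsIsometricOn (inChartBilin g p) (inChartBilin h (ψ p))
      (writtenInExtChartAt I I' p ψ) (chartDomain I I' ψ p) (extChartAt I' (ψ p)).target where
  source := ⟨isOpen_chartDomain hψ.continuous p, fun x hx => hg.smooth x hx.1,
    fun x hx => hg.inner x hx.1⟩
  target := hh
  smooth _ hx := contDiffAt_writtenInExtChartAt hψ hx
  mapsTo _ hx := (extChartAt I' (ψ p)).map_source hx.2
  iso x hx u v := by
    rw [inChartBilin_apply, hiso]
    refine apply_mfderiv_chartInvDeriv h hx.1 ((extChartAt I' (ψ p)).map_source hx.2)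
      (hψ.mdifferentiableAt (by simp))
      ((contDiffAt_writtenInExtChartAt hψ hx).differentiableAt (by simp)) ?_ u v
    filter_upwards [(isOpen_chartDomain hψ.continuous p).mem_nhds hx] with z hz
    exact ((extChartAt I' (ψ p)).left_inv hz.2).symm

end Maps

section Warped

theorem isMetricOn_inChart {d : ℕ} {M : Type*} [TopologicalSpace M]
    [ChartedSpace (EuclideanSpace ℝ (Fin d)) M] [IsManifold (𝓡 d) ∞ M]
    (g : RiemannianMetric d M) (p : M) :
    Coord.IsMetricOn (inChartBilin g.inner p) (extChartAt (𝓡 d) p).target :=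
  isMetricOn_inChartBilin g.contMDiff g.symm g.pos p

variable {d₁ d₂ : ℕ}
  {M₁ : Type*} [TopologicalSpace M₁] [ChartedSpace (EuclideanSpace ℝ (Fin d₁)) M₁]
  [IsManifold (𝓡 d₁) ∞ M₁]
  {M₂ : Type*} [TopologicalSpace M₂] [ChartedSpace (EuclideanSpace ℝ (Fin d₂)) M₂]
  [IsManifold (𝓡 d₂) ∞ M₂]

theorem inChartBilin_warpedMetric (g₁ : BilinField (𝓡 d₁) M₁) (g₂ : BilinField (𝓡 d₂) M₂)
    (f : M₁ → ℝ) (q : M₁ × M₂) :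
    Set.EqOn (inChartBilin (warpedMetric g₁ g₂ f) q)
      (Coord.warp (inChartBilin g₁ q.1) (inChartBilin g₂ q.2) (f ∘ (extChartAt (𝓡 d₁) q.1).symm))
      (extChartAt ((𝓡 d₁).prod (𝓡 d₂)) q).target := by
  intro y hy
  have hy' : y ∈ (extChartAt (𝓡 d₁) q.1).target ×ˢ (extChartAt (𝓡 d₂) q.2).target := by
    rwa [extChartAt_prod] at hy
  have symm_eq : ⇑(extChartAt ((𝓡 d₁).prod (𝓡 d₂)) q).symm
      = Prod.map (extChartAt (𝓡 d₁) q.1).symm (extChartAt (𝓡 d₂) q.2).symm := by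
    rw [extChartAt_prod]
    rfl
  refine ContinuousLinearMap.ext fun u => ContinuousLinearMap.ext fun v => ?_
  have horizontal := apply_mfderiv_chartInvDeriv g₁ (ψ := Prod.fst) (Ψ := Prod.fst) hy hy'.1
    mdifferentiableAt_fst differentiableAt_fst
    (Filter.Eventually.of_forall fun z => by rw [Function.comp_apply, symm_eq]; rfl) u v
  have vertical := apply_mfderiv_chartInvDeriv g₂ (ψ := Prod.snd) (Ψ := Prod.snd) hy hy'.2
    mdifferentiableAt_snd differentiableAt_snd
    (Filter.Eventually.of_forall fun z => by rw [Function.comp_apply, symm_eq]; rfl) u v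
  rw [fderiv_fst] at horizontal
  rw [fderiv_snd] at vertical
  have factor : f ((extChartAt ((𝓡 d₁).prod (𝓡 d₂)) q).symm y).1
      = f ((extChartAt (𝓡 d₁) q.1).symm y.1) := by
    rw [symm_eq]
    rfl
  exact congrArg₂ (· + ·) horizontal (congrArg₂ (fun a c : ℝ => a ^ 2 * c) factor vertical)

theorem isWarpedOn_inChart (g₁ : RiemannianMetric d₁ M₁) (g₂ : RiemannianMetric d₂ M₂) {f : M₁ → ℝ}
    (hf : ContMDiff (𝓡 d₁) 𝓘(ℝ, ℝ) ∞ f) (hf_pos : ∀ x, 0 < f x) (q : M₁ × M₂) :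
    Coord.IsWarpedOn (inChartBilin g₁.inner q.1) (inChartBilin g₂.inner q.2)
      (f ∘ (extChartAt (𝓡 d₁) q.1).symm) (extChartAt (𝓡 d₁) q.1).target
      (extChartAt (𝓡 d₂) q.2).target where
  fst := isMetricOn_inChart g₁ q.1
  snd := isMetricOn_inChart g₂ q.2
  smooth x hx := (hf.contMDiffAt.comp x (contMDiffAt_symm hx)).contDiffAt
  pos _ _ := hf_pos _

end Warped

section Sasakian

variable {d : ℕ} {M : Type*} [TopologicalSpace M]
  [ChartedSpace (EuclideanSpace ℝ (Fin d)) M] [IsManifold (𝓡 d) ∞ M]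
  {g : RiemannianMetric d M} {φ : SmoothEndoField d M} {ξ : SmoothVectorField d M}
  {η : ∀ x : M, TangentSpace (𝓡 d) x →L[ℝ] ℝ}

theorem IsAlmostContactMetric.apply_inChartVec (S : IsAlmostContactMetric g φ ξ η) {p : M}
    {y : EuclideanSpace ℝ (Fin d)} (hy : y ∈ (extChartAt (𝓡 d) p).target)
    (v : EuclideanSpace ℝ (Fin d)) :
    inChartBilin g.inner p y (inChartVec (fun x => ξ x) p y) v = inChartForm η p y v := by
  rw [inChartBilin_apply, inChartVec, chartInvDeriv_chartDeriv hy, ← S.eta_eq]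
  rfl

theorem IsSasakian.isSasakianOn (S : IsSasakian g φ ξ η) (p : M) :
    Coord.IsSasakianOn (inChartBilin g.inner p) (inChartEndo (fun x => φ x) p)
      (inChartVec (fun x => ξ x) p) (extChartAt (𝓡 d) p).target where
  metric := isMetricOn_inChart g p
  smooth_phi _ hy := contDiffAt_inChartEndo φ.contMDiff hy
  smooth_xi _ hy := contDiffAt_inChartVec ξ.contMDiff hy
  phi_sq y hy v := by
    rw [S.apply_inChartVec hy, inChartEndo_apply, inChartEndo_apply, chartInvDeriv_chartDeriv hy,
      S.phi_sq, map_add, map_neg, map_smul, chartDeriv_chartInvDeriv hy]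
    rfl
  eta_xi y hy := by
    rw [inChartBilin_apply, inChartVec, chartInvDeriv_chartDeriv hy, ← S.eta_eq, S.eta_xi]
  eta_phi y hy v := by
    rw [inChartBilin_apply, inChartVec, inChartEndo_apply, chartInvDeriv_chartDeriv hy,
      chartInvDeriv_chartDeriv hy, ← S.eta_eq, S.eta_phi]
  compatible y hy u v := by
    rw [S.apply_inChartVec hy, S.apply_inChartVec hy, inChartBilin_apply, inChartEndo_apply,
      inChartEndo_apply, chartInvDeriv_chartDeriv hy, chartInvDeriv_chartDeriv hy, S.compatible]
    rfl
  nabla_phi y hy u v := by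
    rw [S.apply_inChartVec hy, S.nabla_phi p y hy]

theorem IsSasakianSpaceForm.hasPhiSectionalCurvature {c : ℝ} (S : IsSasakianSpaceForm g φ ξ η c)
    (p : M) :
    Coord.HasPhiSectionalCurvature (inChartBilin g.inner p) (inChartEndo (fun x => φ x) p)
      (inChartVec (fun x => ξ x) p) c (extChartAt (𝓡 d) p p) := by
  intro X hX
  obtain rfl | hX0 := eq_or_ne X 0
  · simp
  have hp := mem_extChartAt_target (I := 𝓡 d) p
  have K := S.toIsSasakian.isSasakianOn p
  have hη : η p X = 0 := by
    rw [inChartBilin_self, inChartVec_self] at hX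
    exact (S.eta_eq p X).trans hX
  have sectional : sectionalCurvature g.inner p X
      (inChartEndo (fun x => φ x) p (extChartAt (𝓡 d) p p) X) = c := by
    rw [inChartEndo_self]
    exact S.phi_sectional p X hX0 hη
  have orthogonal := K.apply_phi_right hp X X
  rw [self_eq_neg] at orthogonal
  have hpos := (K.metric.inner _ hp).pos X hX0
  rw [sectionalCurvature_eq, K.metric.curvature_eq hp, orthogonal, K.compatible _ hp, hX,
    div_eq_iff (by simpa using hpos.ne')] at sectional
  rw [sectional]
  ring

end Sasakian

section ProductTarget

variable {E : Type*} [NormedAddCommGroup E] [NormedSpace ℝ E]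
  {H : Type*} [TopologicalSpace H] {I : ModelWithCorners ℝ E H}
  {M : Type*} [TopologicalSpace M] [ChartedSpace H M]
  {E₁ : Type*} [NormedAddCommGroup E₁] [NormedSpace ℝ E₁]
  {H₁ : Type*} [TopologicalSpace H₁] {I₁ : ModelWithCorners ℝ E₁ H₁}
  {M₁ : Type*} [TopologicalSpace M₁] [ChartedSpace H₁ M₁]
  {E₂ : Type*} [NormedAddCommGroup E₂] [NormedSpace ℝ E₂]
  {H₂ : Type*} [TopologicalSpace H₂] {I₂ : ModelWithCorners ℝ E₂ H₂}
  {M₂ : Type*} [TopologicalSpace M₂] [ChartedSpace H₂ M₂]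

theorem extChartAt_prod_target (q : M₁ × M₂) :
    (extChartAt (I₁.prod I₂) q).target
      = (extChartAt I₁ q.1).target ×ˢ (extChartAt I₂ q.2).target := by
  rw [extChartAt_prod]
  rfl

theorem extChartAt_prod_self (q : M₁ × M₂) :
    extChartAt (I₁.prod I₂) q q = (extChartAt I₁ q.1 q.1, extChartAt I₂ q.2 q.2) := by
  rw [extChartAt_prod]
  rfl

theorem writtenInExtChartAt_prod_self (ψ : M → M₁ × M₂) (p : M) :
    writtenInExtChartAt I (I₁.prod I₂) p ψ (extChartAt I p p)
      = (extChartAt I₁ (ψ p).1 (ψ p).1, extChartAt I₂ (ψ p).2 (ψ p).2) := by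
  rw [← extChartAt_prod_self, writtenInExtChartAt, Function.comp_apply, Function.comp_apply,
    extChartAt_to_inv]

theorem covDerivGrad_comp_fst [FiniteDimensional ℝ E₁] [FiniteDimensional ℝ E₂]
    (b : BilinField (I₁.prod I₂) (M₁ × M₂)) (f : M₁ → ℝ) (q : M₁ × M₂)
    (X : TangentSpace (I₁.prod I₂) q) :
    covDerivGrad b (fun x => f x.1) q X
      = Coord.covDerivGrad (inChartBilin b q) (fun z => (f ∘ (extChartAt I₁ q.1).symm) z.1)
          (extChartAt I₁ q.1 q.1, extChartAt I₂ q.2 q.2) X := by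
  have symm_eq : (fun x : M₁ × M₂ => f x.1) ∘ (extChartAt (I₁.prod I₂) q).symm
      = fun z => (f ∘ (extChartAt I₁ q.1).symm) z.1 := by
    rw [extChartAt_prod]
    rfl
  rw [← symm_eq, ← extChartAt_prod_self]
  rfl

theorem fderiv_writtenInExtChartAt_eq_horizontal [I.Boundaryless] [I₁.Boundaryless]
    [IsManifold I ∞ M] [IsManifold I₁ ∞ M₁] {ψ : M → M₁ × M₂} {p : M}
    (hψ : MDifferentiableAt I (I₁.prod I₂) ψ p) {ξ : ∀ x : M₁, TangentSpace I₁ x}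
    {w : TangentSpace I p}
    (hw₁ : mfderiv (I₁.prod I₂) I₁ Prod.fst (ψ p) (mfderiv I (I₁.prod I₂) ψ p w) = ξ (ψ p).1)
    (hw₂ : mfderiv (I₁.prod I₂) I₂ Prod.snd (ψ p) (mfderiv I (I₁.prod I₂) ψ p w) = 0) :
    fderiv ℝ (writtenInExtChartAt I (I₁.prod I₂) p ψ) (extChartAt I p p) w
      = (inChartVec ξ (ψ p).1 (extChartAt I₁ (ψ p).1 (ψ p).1), 0) := by
  rw [mfderiv_fst] at hw₁
  rw [mfderiv_snd] at hw₂
  rw [fderiv_writtenInExtChartAt_self hψ, inChartVec_self]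
  exact Prod.ext hw₁ hw₂

end ProductTarget

section WarpedProduct

variable {d d₁ d₂ : ℕ}
  {M : Type*} [TopologicalSpace M] [ChartedSpace (EuclideanSpace ℝ (Fin d)) M]
  [IsManifold (𝓡 d) ∞ M]
  {M₁ : Type*} [TopologicalSpace M₁] [ChartedSpace (EuclideanSpace ℝ (Fin d₁)) M₁]
  [IsManifold (𝓡 d₁) ∞ M₁]
  {M₂ : Type*} [TopologicalSpace M₂] [ChartedSpace (EuclideanSpace ℝ (Fin d₂)) M₂]
  [IsManifold (𝓡 d₂) ∞ M₂]

theorem isIsometricOn_writtenInExtChartAt_warpedMetric (g : RiemannianMetric d M)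
    (g₁ : RiemannianMetric d₁ M₁) (g₂ : RiemannianMetric d₂ M₂) {f : M₁ → ℝ}
    (hf : ContMDiff (𝓡 d₁) 𝓘(ℝ, ℝ) ∞ f) (hf_pos : ∀ x, 0 < f x) {ψ : M → M₁ × M₂}
    (hψ : ContMDiff (𝓡 d) ((𝓡 d₁).prod (𝓡 d₂)) ∞ ψ)
    (hψ_iso : IsIsometric g.inner (warpedMetric g₁.inner g₂.inner f) ψ) (p : M) :
    Coord.IsIsometricOn (inChartBilin g.inner p)
      (inChartBilin (warpedMetric g₁.inner g₂.inner f) (ψ p))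
      (writtenInExtChartAt (𝓡 d) ((𝓡 d₁).prod (𝓡 d₂)) p ψ)
      (chartDomain (𝓡 d) ((𝓡 d₁).prod (𝓡 d₂)) ψ p)
      ((extChartAt (𝓡 d₁) (ψ p).1).target ×ˢ (extChartAt (𝓡 d₂) (ψ p).2).target) := by
  have target_eq := extChartAt_prod_target (I₁ := 𝓡 d₁) (I₂ := 𝓡 d₂) (ψ p)
  have warp_eq := inChartBilin_warpedMetric g₁.inner g₂.inner f (ψ p)
  rw [target_eq] at warp_eq
  have target_metric := (isWarpedOn_inChart g₁ g₂ hf hf_pos (ψ p)).isMetricOn.congr warp_eq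
  rw [← target_eq] at target_metric ⊢
  exact isIsometricOn_writtenInExtChartAt hψ hψ_iso p (isMetricOn_inChart g p) target_metric

end WarpedProduct

end RiemGeom

theorem theorem3p1_general (m : ℕ) {d d₂ : ℕ} (hd : d = 2 * m + d₂) {c : ℝ}
    {M₁ : Type*} [TopologicalSpace M₁] [ChartedSpace (EuclideanSpace ℝ (Fin (2 * m + 1))) M₁]
    [IsManifold (𝓡 (2 * m + 1)) ∞ M₁]
    {M₂ : Type*} [TopologicalSpace M₂] [ChartedSpace (EuclideanSpace ℝ (Fin d₂)) M₂]
    [IsManifold (𝓡 d₂) ∞ M₂]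
    {M : Type*} [TopologicalSpace M] [ChartedSpace (EuclideanSpace ℝ (Fin d)) M]
    [IsManifold (𝓡 d) ∞ M]
    {g₁ : RiemGeom.RiemannianMetric (2 * m + 1) M₁}
    {φ : RiemGeom.SmoothEndoField (2 * m + 1) M₁} {ξ : RiemGeom.SmoothVectorField (2 * m + 1) M₁}
    {η : ∀ x : M₁, TangentSpace (𝓡 (2 * m + 1)) x →L[ℝ] ℝ}
    (hM₁ : RiemGeom.IsSasakianSpaceForm g₁ φ ξ η c) (g₂ : RiemGeom.RiemannianMetric d₂ M₂)
    {f : M₁ → ℝ} (hf : ContMDiff (𝓡 (2 * m + 1)) 𝓘(ℝ, ℝ) ∞ f) (hf_pos : ∀ x, 0 < f x)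
    {gf : RiemGeom.BilinField ((𝓡 (2 * m + 1)).prod (𝓡 d₂)) (M₁ × M₂)}
    (hgf : gf = RiemGeom.warpedMetric g₁.inner g₂.inner f)
    (g : RiemGeom.RiemannianMetric d M) {ψ : M → M₁ × M₂}
    (hψ : ContMDiff (𝓡 d) ((𝓡 (2 * m + 1)).prod (𝓡 d₂)) ∞ ψ)
    (hψ_iso : RiemGeom.IsIsometric g.inner gf ψ)
    (hξ : ∀ p : M, ∃ w : TangentSpace (𝓡 d) p,
      mfderiv ((𝓡 (2 * m + 1)).prod (𝓡 d₂)) (𝓡 (2 * m + 1)) Prod.fst (ψ p)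
          (mfderiv (𝓡 d) ((𝓡 (2 * m + 1)).prod (𝓡 d₂)) ψ p w) = ξ (ψ p).1 ∧
        mfderiv ((𝓡 (2 * m + 1)).prod (𝓡 d₂)) (𝓡 d₂) Prod.snd (ψ p)
          (mfderiv (𝓡 d) ((𝓡 (2 * m + 1)).prod (𝓡 d₂)) ψ p w) = 0)
    (hH : ∀ p : M, mfderiv ((𝓡 (2 * m + 1)).prod (𝓡 d₂)) (𝓡 d₂) Prod.snd (ψ p)
      (RiemGeom.meanCurvature g.inner gf ψ p) = 0) :
    RiemGeom.IsBiharmonic g.inner gf ψ ↔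
      ∀ p : M,
        RiemGeom.normalLaplacianH g.inner gf ψ p
            = RiemGeom.traceSffShapeH g.inner gf ψ p
              - ((c * (m + 1) + 3 * m - 1) / 2 : ℝ) • RiemGeom.meanCurvature g.inner gf ψ p
              + (d₂ / f (ψ p).1 : ℝ) • RiemGeom.normalPart g.inner gf ψ p
                  (RiemGeom.covDerivGrad gf (fun x => f x.1) (ψ p)
                    (RiemGeom.meanCurvature g.inner gf ψ p)) ∧
          (-2 : ℝ) • RiemGeom.traceShapeNormalDerivH g.inner gf ψ p
              - (d / 2 : ℝ) • RiemGeom.gradNormSqH g.inner gf ψ p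
              - (2 * d₂ / f (ψ p).1 : ℝ) • RiemGeom.tangentialPart g.inner gf ψ p
                  (RiemGeom.covDerivGrad gf (fun x => f x.1) (ψ p)
                    (RiemGeom.meanCurvature g.inner gf ψ p)) = 0 := by
  subst hgf
  refine forall_congr' fun p => ?_
  obtain ⟨w, hw₁, hw₂⟩ := hξ p
  have warp_eq := RiemGeom.inChartBilin_warpedMetric g₁.inner g₂.inner f (ψ p)
  have base_eq :=
    RiemGeom.writtenInExtChartAt_prod_self (I := 𝓡 d) (I₁ := 𝓡 (2 * m + 1)) (I₂ := 𝓡 d₂) ψ p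
  have H_horizontal := hH p
  rw [RiemGeom.extChartAt_prod_target] at warp_eq
  rw [mfderiv_snd] at H_horizontal
  have chart_iff :=
    (RiemGeom.isIsometricOn_writtenInExtChartAt_warpedMetric g g₁ g₂ hf hf_pos hψ hψ_iso
      p).bitension_eq_zero_iff_of_warp (RiemGeom.isWarpedOn_inChart g₁ g₂ hf hf_pos (ψ p))
      (hM₁.toIsSasakian.isSasakianOn (ψ p).1) warp_eq (RiemGeom.mem_chartDomain ψ p)
      (by simp only [finrank_euclideanSpace_fin]; omega)
      (by rw [base_eq]; exact hM₁.hasPhiSectionalCurvature (ψ p).1)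
      (by rw [base_eq]; exact RiemGeom.fderiv_writtenInExtChartAt_eq_horizontal
            (hψ.mdifferentiableAt (by simp)) hw₁ hw₂)
      H_horizontal
  have constant_eq : ((2 * m + 1 : ℕ) - 1 : ℝ) + (c - 1) / 4 * ((2 * m + 1 : ℕ) + 1)
      = (c * (m + 1) + 3 * m - 1) / 2 := by
    push_cast
    ring
  simp only [finrank_euclideanSpace_fin, constant_eq] at chart_iff
  simp only [RiemGeom.covDerivGrad_comp_fst]
  rw [base_eq, Function.comp_apply, extChartAt_to_inv] at chart_iff
  exact chart_iff

end

theorem theorem3p1 (m n : ℕ) (c k : ℝ)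
    {M₁ : Type*} [TopologicalSpace M₁] [ChartedSpace (EuclideanSpace ℝ (Fin (2 * m + 1))) M₁]
    [IsManifold (𝓡 (2 * m + 1)) ∞ M₁]
    {M₂ : Type*} [TopologicalSpace M₂] [ChartedSpace (EuclideanSpace ℝ (Fin (2 * n))) M₂]
    [IsManifold (𝓡 (2 * n)) ∞ M₂]
    {M : Type*} [TopologicalSpace M] [ChartedSpace (EuclideanSpace ℝ (Fin (2 * (m + n)))) M]
    [IsManifold (𝓡 (2 * (m + n))) ∞ M]
    -- the Sasakian space form `M₁(c)` and the complex space form `M₂`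
    (g₁ : RiemGeom.RiemannianMetric (2 * m + 1) M₁)
    (φ : RiemGeom.SmoothEndoField (2 * m + 1) M₁) (ξ : RiemGeom.SmoothVectorField (2 * m + 1) M₁)
    (η : ∀ x : M₁, TangentSpace (𝓡 (2 * m + 1)) x →L[ℝ] ℝ)
    (hM₁ : RiemGeom.IsSasakianSpaceForm g₁ φ ξ η c)
    (g₂ : RiemGeom.RiemannianMetric (2 * n) M₂) (J : RiemGeom.SmoothEndoField (2 * n) M₂)
    (hM₂ : RiemGeom.IsComplexSpaceForm g₂ J k)
    -- the warping function and the warped product metric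
    (f : M₁ → ℝ) (hf : ContMDiff (𝓡 (2 * m + 1)) 𝓘(ℝ, ℝ) ∞ f) (hf_pos : ∀ x, 0 < f x)
    (gf : RiemGeom.BilinField ((𝓡 (2 * m + 1)).prod (𝓡 (2 * n))) (M₁ × M₂))
    (hgf : gf = RiemGeom.warpedMetric g₁.inner g₂.inner f)
    -- the isometrically immersed hypersurface
    (g : RiemGeom.RiemannianMetric (2 * (m + n)) M) (ψ : M → M₁ × M₂)
    (hψ : ContMDiff (𝓡 (2 * (m + n))) ((𝓡 (2 * m + 1)).prod (𝓡 (2 * n))) ∞ ψ)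
    (hψ_iso : RiemGeom.IsIsometric g.inner gf ψ)
    -- `ξ` is tangent to `M`
    (hξ : ∀ p : M, ∃ w : TangentSpace (𝓡 (2 * (m + n))) p,
      mfderiv ((𝓡 (2 * m + 1)).prod (𝓡 (2 * n))) (𝓡 (2 * m + 1)) Prod.fst (ψ p)
          (mfderiv (𝓡 (2 * (m + n))) ((𝓡 (2 * m + 1)).prod (𝓡 (2 * n))) ψ p w) = ξ (ψ p).1 ∧
        mfderiv ((𝓡 (2 * m + 1)).prod (𝓡 (2 * n))) (𝓡 (2 * n)) Prod.snd (ψ p)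
          (mfderiv (𝓡 (2 * (m + n))) ((𝓡 (2 * m + 1)).prod (𝓡 (2 * n))) ψ p w) = 0)
    -- `H` is horizontal
    (hH : ∀ p : M, mfderiv ((𝓡 (2 * m + 1)).prod (𝓡 (2 * n))) (𝓡 (2 * n)) Prod.snd (ψ p)
      (RiemGeom.meanCurvature g.inner gf ψ p) = 0) :
    RiemGeom.IsBiharmonic g.inner gf ψ ↔
      ∀ p : M,
        RiemGeom.normalLaplacianH g.inner gf ψ p
            = RiemGeom.traceSffShapeH g.inner gf ψ p
              - ((c * (m + 1) + 3 * m - 1) / 2 : ℝ) • RiemGeom.meanCurvature g.inner gf ψ p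
              + (2 * n / f (ψ p).1 : ℝ) • RiemGeom.normalPart g.inner gf ψ p
                  (RiemGeom.covDerivGrad gf (fun x => f x.1) (ψ p)
                    (RiemGeom.meanCurvature g.inner gf ψ p)) ∧
          (-2 : ℝ) • RiemGeom.traceShapeNormalDerivH g.inner gf ψ p
              - (m + n : ℝ) • RiemGeom.gradNormSqH g.inner gf ψ p
              - (4 * n / f (ψ p).1 : ℝ) • RiemGeom.tangentialPart g.inner gf ψ p
                  (RiemGeom.covDerivGrad gf (fun x => f x.1) (ψ p)
                    (RiemGeom.meanCurvature g.inner gf ψ p)) = 0 := by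
  simpa [mul_add, ← mul_assoc, add_div, two_mul (2 : ℝ), two_add_two_eq_four] using
    theorem3p1_general m (mul_add 2 m n) hM₁ g₂ hf hf_pos hgf g hψ hψ_iso hξ hH
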